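/- Let $n\ge 2$ and let $G$ be a (finite-dimensional, real) Lie group; all maps between manifolds are $C^\infty$. Let $SO(n)$ act on the unit sphere $S^n\subset\mathbb R^{n+1}$ by orthogonal transformations of the first $n$ coordinates, fixing the poles $(0,\dots,0,\pm1)$, and regard $SO(n-1)$ as the subgroup of $SO(n)$ fixing the last coordinate. An $(n,G)$-bundle $\xi$ is a smooth principal $G$-bundle $p\colon E(\xi)\to S^n$ with a smooth left action of $SO(n)$ on $E(\xi)$ which commutes with the right action of $G$ and for which $p$ is equivariant. Two such bundles are isomorphic if there is an $SO(n)$- and $G$-equivariant diffeomorphism of their total spaces commuting with the projections to $S^n$; $\mathcal E(n,G)$ denotes the set of isomorphism classes. Let $\mathcal R(k,G)$ be the set of smooth homomorphisms $SO(k)\to G$ modulo conjugation by elements of $G$, let $\mathrm{Res}\colon\mathcal R(n,G)\to\mathcal R(n-1,G)$ be restriction, and let $\mathcal R(n,G)\times_{(n-1)}\mathcal R(n,G)$ be the set of pairs $(r,s)$ with $\mathrm{Res}(r)=\mathrm{Res}(s)$. For an $(n,G)$-bundle $\xi$ choose $a,b\in E(\xi)$ over the south pole $(0,\dots,0,-1)$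 and the north pole $(0,\dots,0,1)$ respectively, and define smooth homomorphisms $\alpha,\beta\colon SO(n)\to G$ by $A\cdot a=a\cdot\alpha(A)$ and $A\cdot b=b\cdot\beta(A)$. Put $J(\xi)=([\alpha],[\beta])\in\mathcal R(n,G)\times\mathcal R(n,G)$ and $\bar J(\xi)=\mathrm{Res}[\alpha]\in\mathcal R(n-1,G)$ (one has $\mathrm{Res}[\alpha]=\mathrm{Res}[\beta]$); these depend only on the isomorphism class of $\xi$. Let $\gamma\colon SO(n-1)\to G$ be a smooth homomorphism, and let $Z_\gamma\subset G$ be the centralizer of $\gamma(SO(n-1))$. Let $\mathcal R_\gamma(n,G)$ be the set of pairs $(\alpha,\beta)$ of smooth homomorphisms $SO(n)\to G$ with $\alpha|_{SO(n-1)}=\beta|_{SO(n-1)}=\gamma$, modulo the relation $(\alpha_1,\beta_1)\sim(\alpha_2,\beta_2)$ iff there is a smooth path $(g_t)_{t\in[-1,1]}$ in $Z_\gamma$ with $\alpha_2(A)=g_{-1}\alpha_1(A)g_{-1}^{-1}$ and $\beta_2(A)=g_1\beta_1(A)g_1^{-1}$ for all $A\in SO(n)$. Let $j\colon\mathcal R_\gamma(n,G)\to\mathcal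 R(n,G)\times_{(n-1)}\mathcal R(n,G)$ be the map induced by $(\alpha,\beta)\mapsto([\alpha],[\beta])$. **Proposition.** There exists a bijection $\tilde J_\gamma\colon\bar J^{-1}([\gamma])\to\mathcal R_\gamma(n,G)$ such that $j\circ\tilde J_\gamma=J$ on $\bar J^{-1}([\gamma])$. -/

import Mathlib

open scoped Manifold ContDiff
open Set Topology

noncomputable section

universe u v

namespace EquivBundle

/-! ### The groups `SO(n)`, the spheres, and the action of `SO(n)` on `S^n` -/

/-- The special orthogonal group `SO(n)`. -/
abbrev SO (n : ℕ) : Type := Matrix.specialOrthogonalGroup (Fin n) ℝ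

/-- The ambient vector space of real `n × n` matrices, as a normed space. -/
abbrev Mat (n : ℕ) : Type := Fin n → Fin n → ℝ

/-- The inclusion of `SO(n)` in the space of matrices. -/
def SO.mat {n : ℕ} (A : SO n) : Mat n := fun i j => A.1 i j

/-- The block matrix `diag(A, 1)` of size `m + 1`. -/
def blockOne {m : ℕ} (A : Matrix (Fin m) (Fin m) ℝ) : Matrix (Fin (m + 1)) (Fin (m + 1)) ℝ :=
  Matrix.reindex finSumFinEquiv finSumFinEquiv (Matrix.fromBlocks A 0 0 (1 : Matrix (Fin 1) (Fin 1) ℝ))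

theorem blockOne_one {m : ℕ} : blockOne (1 : Matrix (Fin m) (Fin m) ℝ) = 1 := by
  simp [blockOne, Matrix.fromBlocks_one]

theorem blockOne_mul {m : ℕ} (A B : Matrix (Fin m) (Fin m) ℝ) :
    blockOne (A * B) = blockOne A * blockOne B := by
  simp only [blockOne, Matrix.reindex_apply, Matrix.submatrix_mul_equiv, Matrix.fromBlocks_multiply,
    Matrix.mul_zero, Matrix.zero_mul, Matrix.mul_one, add_zero, zero_add]

theorem mem_SO_iff {n : ℕ} (A : Matrix (Fin n) (Fin n) ℝ) :
    A ∈ Matrix.specialOrthogonalGroup (Fin n) ℝ ↔ A * A.transpose = 1 ∧ A.det = 1 := by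
  rw [Matrix.mem_specialOrthogonalGroup_iff, Matrix.mem_orthogonalGroup_iff]

theorem blockOne_mem {m : ℕ} (A : SO m) :
    blockOne A.1 ∈ Matrix.specialOrthogonalGroup (Fin (m + 1)) ℝ := by
  have h := (mem_SO_iff A.1).1 A.2
  refine (mem_SO_iff _).2 ⟨?_, ?_⟩
  · have : (blockOne A.1).transpose = blockOne A.1.transpose := by
      simp [blockOne, Matrix.fromBlocks_transpose]
    rw [this, ← blockOne_mul, h.1, blockOne_one]
  · simp [blockOne, h.2]

/-- `SO(m)` as the subgroup of `SO(m + 1)` fixing the last coordinate: the homomorphism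
`A ↦ diag(A, 1)`. -/
def incl (m : ℕ) : SO m →* SO (m + 1) where
  toFun A := ⟨blockOne A.1, blockOne_mem A⟩
  map_one' := Subtype.ext blockOne_one
  map_mul' A B := Subtype.ext (blockOne_mul A.1 B.1)

/-- The unit sphere `S^n` of `ℝ^{n+1}`. -/
abbrev Sph (n : ℕ) : Type := Metric.sphere (0 : EuclideanSpace ℝ (Fin (n + 1))) 1

theorem norm_mulVec_SO {n : ℕ} (A : SO n) (x : EuclideanSpace ℝ (Fin n)) :
    ‖WithLp.toLp 2 (Matrix.mulVec A.1 x.ofLp)‖ = ‖x‖ := by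
  have h : A.1.transpose * A.1 = 1 := mul_eq_one_comm.1 ((mem_SO_iff A.1).1 A.2).1
  have key : ∀ y : EuclideanSpace ℝ (Fin n), ‖y‖ ^ 2 = y.ofLp ⬝ᵥ y.ofLp := by
    intro y
    rw [EuclideanSpace.norm_sq_eq]
    simp [dotProduct, sq]
  rw [← sq_eq_sq₀ (norm_nonneg _) (norm_nonneg _), key, key]
  simp only
  rw [Matrix.dotProduct_mulVec, Matrix.vecMul_mulVec, h, Matrix.vecMul_one]

/-- The action of `SO(n)` on `S^n` by the orthogonal transformations `diag(A, 1)` of `ℝ^{n+1}`,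
which fix the poles. -/
def rot {n : ℕ} (A : SO n) (x : Sph n) : Sph n :=
  ⟨WithLp.toLp 2 (Matrix.mulVec (incl n A).1 x.1.ofLp), by
    have := x.2
    rw [mem_sphere_zero_iff_norm] at this ⊢
    rw [norm_mulVec_SO, this]⟩

/-- The pole `(0, …, 0, s)` of `S^n`, for a sign `s = ± 1`. -/
def pole (n : ℕ) (s : ℝ) (hs : |s| = 1) : Sph n :=
  ⟨EuclideanSpace.single (Fin.last n) s, by
    rw [mem_sphere_zero_iff_norm, PiLp.norm_single, Real.norm_eq_abs, hs]⟩

/-- The south pole `(0, …, 0, -1)`. -/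
def south (n : ℕ) : Sph n := pole n (-1) (by simp)

/-- The north pole `(0, …, 0, 1)`. -/
def north (n : ℕ) : Sph n := pole n 1 (by simp)

theorem rot_pole {n : ℕ} (A : SO n) (s : ℝ) (hs : |s| = 1) : rot A (pole n s hs) = pole n s hs := by
  apply Subtype.ext
  ext i
  have hcol : ∀ i, blockOne A.1 i (Fin.last n) = if i = Fin.last n then 1 else 0 := by
    intro i
    have hl : (finSumFinEquiv.symm (Fin.last n) : Fin n ⊕ Fin 1) = Sum.inr 0 := by
      rw [Equiv.symm_apply_eq]; rfl
    refine Fin.lastCases ?_ (fun j => ?_) i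
    · simp [blockOne, hl]
    · have hj : (finSumFinEquiv.symm j.castSucc : Fin n ⊕ Fin 1) = Sum.inl j := by
        rw [Equiv.symm_apply_eq]; rfl
      simp [blockOne, hl, hj]
  simp [rot, pole, incl, hcol, PiLp.single_apply]

/-! ### Smoothness on `SO(n)` -/

/-- Smoothness of a map defined on a subset of a manifold. The subset of the manifold `X` is given
by an injection `ι : P → X`; a map `f` on `P` is smooth if around every point it is the
restriction of a smooth (`C^∞`) map defined on an open subset of `X`. For embedded submanifolds,
such as `SO(n)` in the space of matrices, or `SO(n) × E` in the product of the space of matrices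
and a manifold `E`, this is smoothness for the submanifold structure. -/
def SmoothAlong {P : Type*}
    {V : Type*} [NormedAddCommGroup V] [NormedSpace ℝ V] {H : Type*} [TopologicalSpace H]
    (I : ModelWithCorners ℝ V H) {X : Type*} [TopologicalSpace X] [ChartedSpace H X]
    {V' : Type*} [NormedAddCommGroup V'] [NormedSpace ℝ V'] {H' : Type*} [TopologicalSpace H']
    (I' : ModelWithCorners ℝ V' H') {N : Type*} [TopologicalSpace N] [ChartedSpace H' N]
    (ι : P → X) (f : P → N) : Prop :=
  ∀ p : P, ∃ U : Set X, IsOpen U ∧ ι p ∈ U ∧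
    ∃ F : X → N, ContMDiffOn I I' ∞ F U ∧ ∀ q : P, ι q ∈ U → F (ι q) = f q

section

variable (𝔤 : Type v) [NormedAddCommGroup 𝔤] [NormedSpace ℝ 𝔤]
  (G : Type u) [TopologicalSpace G] [ChartedSpace 𝔤 G] [Group G]

/-! ### Smooth homomorphisms `SO(n) → G` and the sets `R(n, G)` and `R_γ(n, G)` -/

/-- Smooth homomorphisms from `SO(n)` to the Lie group `G` (modelled on the vector space `𝔤`). -/
structure SmoothHom (n : ℕ) : Type u where
  hom : SO n →* G
  smooth : SmoothAlong 𝓘(ℝ, Mat n) 𝓘(ℝ, 𝔤) (SO.mat (n := n)) hom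

variable {G}

theorem SmoothHom.ext {n : ℕ} {α β : SmoothHom 𝔤 G n} (h : ∀ A, α.hom A = β.hom A) : α = β := by
  cases α; cases β
  congr
  exact MonoidHom.ext h

variable (G)

/-- Conjugacy of smooth homomorphisms by elements of `G`. -/
def conjSetoid (n : ℕ) : Setoid (SmoothHom 𝔤 G n) where
  r α β := ∃ g : G, ∀ A, β.hom A = g * α.hom A * g⁻¹
  iseqv :=
    { refl := fun _ => ⟨1, fun A => by simp⟩
      symm := by
        rintro _ _ ⟨g, hg⟩
        exact ⟨g⁻¹, fun A => by rw [hg]; group⟩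
      trans := by
        rintro _ _ _ ⟨g, hg⟩ ⟨h, hh⟩
        exact ⟨h * g, fun A => by rw [hh, hg]; group⟩ }

/-- The set `R(n, G)` of smooth homomorphisms `SO(n) → G` modulo conjugation by elements of `G`. -/
def R (n : ℕ) : Type u := Quotient (conjSetoid 𝔤 G n)

variable {𝔤 G}

theorem contDiff_blockOne (m : ℕ) :
    ContDiff ℝ ∞ (fun M : Mat m => (fun i j => blockOne (Matrix.of M) i j : Mat (m + 1))) := by
  rw [contDiff_pi]; intro i
  rw [contDiff_pi]; intro j
  simp only [blockOne, Matrix.reindex_apply, Matrix.submatrix_apply]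
  rcases finSumFinEquiv.symm i with a | a <;> rcases finSumFinEquiv.symm j with b | b
  · simp only [Matrix.fromBlocks_apply₁₁, Matrix.of_apply]; fun_prop
  · simp only [Matrix.fromBlocks_apply₁₂]; exact contDiff_const
  · simp only [Matrix.fromBlocks_apply₂₁]; exact contDiff_const
  · simp only [Matrix.fromBlocks_apply₂₂]; exact contDiff_const

/-- The restriction of a smooth homomorphism from `SO(m + 1)` to `SO(m)`. -/
def SmoothHom.restrict {m : ℕ} (α : SmoothHom 𝔤 G (m + 1)) : SmoothHom 𝔤 G m where
  hom := α.hom.comp (incl m)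
  smooth := by
    intro A
    obtain ⟨U, hU, hAU, F, hF, hFα⟩ := α.smooth (incl m A)
    have hb := contDiff_blockOne m
    refine ⟨(fun M : Mat m => (fun i j => blockOne (Matrix.of M) i j : Mat (m + 1))) ⁻¹' U,
      hU.preimage hb.continuous, hAU,
      F ∘ (fun M : Mat m => (fun i j => blockOne (Matrix.of M) i j : Mat (m + 1))),
      hF.comp hb.contMDiff.contMDiffOn (fun _ h => h), fun B hB => hFα (incl m B) hB⟩

variable (𝔤 G)

/-- The restriction map `Res : R(m + 1, G) → R(m, G)`. -/
def Res (m : ℕ) : R 𝔤 G (m + 1) → R 𝔤 G m :=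
  Quotient.map' SmoothHom.restrict (by
    rintro _ _ ⟨g, hg⟩
    exact ⟨g, fun A => hg (incl m A)⟩)

/-- The fibre product `R(m + 1, G) ×_{(m)} R(m + 1, G)`. -/
def FibreProd (m : ℕ) : Type u :=
  {p : R 𝔤 G (m + 1) × R 𝔤 G (m + 1) // Res 𝔤 G m p.1 = Res 𝔤 G m p.2}

variable {𝔤 G}

/-- Pairs `(α, β)` of smooth homomorphisms `SO(m + 1) → G` which both extend `γ`. -/
def ExtPairs {m : ℕ} (γ : SmoothHom 𝔤 G m) : Type u :=
  {p : SmoothHom 𝔤 G (m + 1) × SmoothHom 𝔤 G (m + 1) // p.1.restrict = γ ∧ p.2.restrict = γ}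

/-- The centralizer `Z_γ` of `γ(SO(m))` in `G`. -/
def Z {m : ℕ} (γ : SmoothHom 𝔤 G m) : Subgroup G :=
  Subgroup.centralizer (Set.range γ.hom)

/-- Two pairs are equivalent if they are conjugate at the two ends by a smooth path
`{g_t | t ∈ [-1, 1]}` in `Z_γ`. -/
def pathSetoid [LieGroup 𝓘(ℝ, 𝔤) ∞ G] {m : ℕ} (γ : SmoothHom 𝔤 G m) :
    Setoid (ExtPairs γ) where
  r p q := ∃ g : ℝ → G, ContMDiffOn 𝓘(ℝ, ℝ) 𝓘(ℝ, 𝔤) ∞ g (Icc (-1) 1) ∧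
    (∀ t ∈ Icc (-1 : ℝ) 1, g t ∈ Z γ) ∧
    (∀ A, q.1.1.hom A = g (-1) * p.1.1.hom A * (g (-1))⁻¹) ∧
    (∀ A, q.1.2.hom A = g 1 * p.1.2.hom A * (g 1)⁻¹)
  iseqv :=
    { refl := fun _ => ⟨fun _ => 1, contMDiffOn_const, fun _ _ => one_mem _,
        fun A => by simp, fun A => by simp⟩
      symm := by
        rintro _ _ ⟨g, h1, h2, h3, h4⟩
        exact ⟨fun t => (g t)⁻¹, h1.inv, fun t ht => inv_mem (h2 t ht),
          fun A => by rw [h3]; group, fun A => by rw [h4]; group⟩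
      trans := by
        rintro _ _ _ ⟨g, h1, h2, h3, h4⟩ ⟨k, k1, k2, k3, k4⟩
        exact ⟨fun t => k t * g t, k1.mul h1, fun t ht => mul_mem (k2 t ht) (h2 t ht),
          fun A => by rw [k3, h3]; group, fun A => by rw [k4, h4]; group⟩ }

/-- The set `R_γ(m + 1, G)`. -/
def Rγ [LieGroup 𝓘(ℝ, 𝔤) ∞ G] {m : ℕ} (γ : SmoothHom 𝔤 G m) : Type u :=
  Quotient (pathSetoid γ)

/-- The obvious map `j : R_γ(m + 1, G) → R(m + 1, G) ×_{(m)} R(m + 1, G)`. -/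
def j [LieGroup 𝓘(ℝ, 𝔤) ∞ G] {m : ℕ} (γ : SmoothHom 𝔤 G m) : Rγ γ → FibreProd 𝔤 G m :=
  Quotient.lift
    (fun p => ⟨(Quotient.mk _ p.1.1, Quotient.mk _ p.1.2), by
      change (Quotient.mk _ p.1.1.restrict : R 𝔤 G m) = Quotient.mk _ p.1.2.restrict
      rw [p.2.1, p.2.2]⟩)
    (by
      rintro _ _ ⟨g, -, -, h3, h4⟩
      exact Subtype.ext (Prod.ext (Quotient.sound ⟨g (-1), h3⟩) (Quotient.sound ⟨g 1, h4⟩)))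

end

/-! ### `(n, G)`-bundles -/

/-- The model with corners of the total space of a principal `G`-bundle over `S^n`: the manifold
has no boundary and is modelled on `ℝ^n × 𝔤`. -/
abbrev totalModel (𝔤 : Type v) [NormedAddCommGroup 𝔤] [NormedSpace ℝ 𝔤] (n : ℕ) :
    ModelWithCorners ℝ (EuclideanSpace ℝ (Fin n) × 𝔤)
      (ModelProd (EuclideanSpace ℝ (Fin n)) 𝔤) :=
  (𝓡 n).prod 𝓘(ℝ, 𝔤)

/-- An `(n, G)`-bundle: a smooth principal `G`-bundle over `S^n` with a smooth left action of
`SO(n)` on the total space which commutes with the right action of `G` and for which the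
projection is equivariant. The right action `z · g` of `G` is written `MulOpposite.op g • z`. -/
structure NGBundle (𝔤 : Type v) [NormedAddCommGroup 𝔤] [NormedSpace ℝ 𝔤]
    (G : Type u) [TopologicalSpace G] [ChartedSpace 𝔤 G] [Group G] (n : ℕ) where
  /-- the total space, a smooth manifold -/
  E : Type u
  [topE : TopologicalSpace E]
  [chartedE : ChartedSpace (ModelProd (EuclideanSpace ℝ (Fin n)) 𝔤) E]
  [manifoldE : IsManifold (totalModel 𝔤 n) ∞ E]
  /-- the projection -/
  proj : E → Sph n
  smooth_proj : ContMDiff (totalModel 𝔤 n) (𝓡 n) ∞ proj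
  /-- the free right action of `G` -/
  [actG : MulAction Gᵐᵒᵖ E]
  smooth_actG : ContMDiff ((totalModel 𝔤 n).prod 𝓘(ℝ, 𝔤)) (totalModel 𝔤 n) ∞
    (fun q : E × G => MulOpposite.op q.2 • q.1)
  free_actG : ∀ (z : E) (g : G), MulOpposite.op g • z = z → g = 1
  proj_actG : ∀ (z : E) (g : G), proj (MulOpposite.op g • z) = proj z
  /-- around every point there is a smooth `G`-equivariant trivialization -/
  locally_trivial : ∀ x : Sph n, ∃ e : Bundle.Trivialization G proj, x ∈ e.baseSet ∧
    ContMDiffOn (totalModel 𝔤 n) (totalModel 𝔤 n) ∞ e e.source ∧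
    ContMDiffOn (totalModel 𝔤 n) (totalModel 𝔤 n) ∞ e.toOpenPartialHomeomorph.symm e.target ∧
    ∀ z ∈ e.source, ∀ g : G, (e (MulOpposite.op g • z)).2 = (e z).2 * g
  /-- the left action of `SO(n)` -/
  [actSO : MulAction (SO n) E]
  smooth_actSO : SmoothAlong (𝓘(ℝ, Mat n).prod (totalModel 𝔤 n)) (totalModel 𝔤 n)
    (fun q : SO n × E => ((SO.mat q.1, q.2) : Mat n × E)) (fun q : SO n × E => q.1 • q.2)
  comm : ∀ (A : SO n) (g : G) (z : E), A • (MulOpposite.op g • z) = MulOpposite.op g • (A • z)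
  proj_actSO : ∀ (A : SO n) (z : E), proj (A • z) = rot A (proj z)

attribute [instance] NGBundle.topE NGBundle.chartedE NGBundle.manifoldE NGBundle.actG
  NGBundle.actSO

section

variable {𝔤 : Type v} [NormedAddCommGroup 𝔤] [NormedSpace ℝ 𝔤]
  {G : Type u} [TopologicalSpace G] [ChartedSpace 𝔤 G] [Group G] {n : ℕ}

/-- Isomorphism of `(n, G)`-bundles: a diffeomorphism of the total spaces which is `SO(n)`- and
`G`-equivariant and commutes with the projections to `S^n`. -/
def NGBundle.Iso (ξ ξ' : NGBundle 𝔤 G n) : Prop :=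
  ∃ h : ξ.E ≃ₘ^∞⟮totalModel 𝔤 n, totalModel 𝔤 n⟯ ξ'.E,
    (∀ (A : SO n) (z : ξ.E), h (A • z) = A • h z) ∧
    (∀ (g : G) (z : ξ.E), h (MulOpposite.op g • z) = MulOpposite.op g • h z) ∧
    ∀ z : ξ.E, ξ'.proj (h z) = ξ.proj z

variable (𝔤 G n) in
/-- The isomorphism relation on `(n, G)`-bundles. -/
def isoSetoid : Setoid (NGBundle 𝔤 G n) where
  r := NGBundle.Iso
  iseqv :=
    { refl := fun ξ => ⟨Diffeomorph.refl _ _ _, fun _ _ => rfl, fun _ _ => rfl, fun _ => rfl⟩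
      symm := by
        rintro ξ ξ' ⟨h, h1, h2, h3⟩
        refine ⟨h.symm, fun A z => ?_, fun g z => ?_, fun z => ?_⟩
        · refine h.injective ?_
          change h _ = h _
          rw [h1, h.apply_symm_apply, h.apply_symm_apply]
        · refine h.injective ?_
          change h _ = h _
          rw [h2, h.apply_symm_apply, h.apply_symm_apply]
        · rw [← h3, h.apply_symm_apply]
      trans := by
        rintro ξ ξ' ξ'' ⟨h, h1, h2, h3⟩ ⟨k, k1, k2, k3⟩
        refine ⟨h.trans k, fun A z => ?_, fun g z => ?_, fun z => ?_⟩
        · simp [h1, k1]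
        · simp [h2, k2]
        · simp [h3, k3] }

variable (𝔤 G n) in
/-- The set `𝓔(n, G)` of isomorphism classes of `(n, G)`-bundles. -/
def BundleClasses : Type (max (u + 1) v) := Quotient (isoSetoid 𝔤 G n)

/-! ### Isotropy representations -/

theorem NGBundle.exists_fibre (ξ : NGBundle 𝔤 G n) (x : Sph n) : ∃ a : ξ.E, ξ.proj a = x := by
  obtain ⟨e, hx, -⟩ := ξ.locally_trivial x
  exact ⟨e.toOpenPartialHomeomorph.symm (x, 1), e.proj_symm_apply' hx⟩

theorem NGBundle.act_injective (ξ : NGBundle 𝔤 G n) (z : ξ.E) {g h : G}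
    (H : MulOpposite.op g • z = MulOpposite.op h • z) : g = h := by
  have : MulOpposite.op (g * h⁻¹) • z = z := by
    rw [MulOpposite.op_mul, mul_smul, H, ← mul_smul, ← MulOpposite.op_mul]
    simp
  exact mul_inv_eq_one.1 (ξ.free_actG z _ this)

theorem NGBundle.exists_act (ξ : NGBundle 𝔤 G n) (a b : ξ.E) (h : ξ.proj a = ξ.proj b) :
    ∃ g : G, b = MulOpposite.op g • a := by
  obtain ⟨e, hx, -, -, he⟩ := ξ.locally_trivial (ξ.proj a)
  have ha : a ∈ e.source := e.mem_source.2 hx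
  have hb : b ∈ e.source := e.mem_source.2 (h ▸ hx)
  refine ⟨(e a).2⁻¹ * (e b).2, ?_⟩
  have hc : MulOpposite.op ((e a).2⁻¹ * (e b).2) • a ∈ e.source := by
    rw [e.mem_source, ξ.proj_actG]; exact hx
  apply e.injOn hb hc
  apply Prod.ext
  · change (e b).1 = (e _).1
    rw [e.coe_fst hb, e.coe_fst hc, ξ.proj_actG, h]
  · change (e b).2 = (e _).2
    rw [he a ha]; group

theorem NGBundle.exists_isotropy (ξ : NGBundle 𝔤 G n) (a : ξ.E)
    (ha : ∀ A : SO n, rot A (ξ.proj a) = ξ.proj a) (A : SO n) :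
    ∃ g : G, A • a = MulOpposite.op g • a :=
  ξ.exists_act a (A • a) (by rw [ξ.proj_actSO, ha])

/-- The element `α(A)` of `G` such that `A · a = a · α(A)`, for a point `a` over a fixed point of
`SO(n)`. -/
def NGBundle.isotropyElt (ξ : NGBundle 𝔤 G n) (a : ξ.E)
    (ha : ∀ A : SO n, rot A (ξ.proj a) = ξ.proj a) (A : SO n) : G :=
  (ξ.exists_isotropy a ha A).choose

theorem NGBundle.isotropyElt_spec (ξ : NGBundle 𝔤 G n) (a : ξ.E)
    (ha : ∀ A : SO n, rot A (ξ.proj a) = ξ.proj a) (A : SO n) :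
    A • a = MulOpposite.op (ξ.isotropyElt a ha A) • a :=
  (ξ.exists_isotropy a ha A).choose_spec

variable [LieGroup 𝓘(ℝ, 𝔤) ∞ G]

/-- The isotropy representation of an `(n, G)`-bundle associated to a point `a` over a fixed point
of `SO(n)`: the smooth homomorphism `α : SO(n) → G` determined by `A · a = a · α(A)`. -/
def NGBundle.isotropy (ξ : NGBundle 𝔤 G n) (a : ξ.E)
    (ha : ∀ A : SO n, rot A (ξ.proj a) = ξ.proj a) : SmoothHom 𝔤 G n where
  hom := MonoidHom.mk' (ξ.isotropyElt a ha) (by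
    intro B A
    apply ξ.act_injective a
    rw [← ξ.isotropyElt_spec, mul_smul, ξ.isotropyElt_spec a ha A, ξ.comm,
      ξ.isotropyElt_spec a ha B, ← mul_smul, MulOpposite.op_mul])
  smooth := by
    intro A₀
    obtain ⟨e, hx, hes, -, he⟩ := ξ.locally_trivial (ξ.proj a)
    have has : a ∈ e.source := e.mem_source.2 hx
    obtain ⟨U, hU, hAU, F, hF, hFa⟩ := ξ.smooth_actSO (A₀, a)
    have hι : ContMDiff 𝓘(ℝ, Mat n) (𝓘(ℝ, Mat n).prod (totalModel 𝔤 n)) ∞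
        (fun M : Mat n => ((M, a) : Mat n × ξ.E)) := contMDiff_id.prodMk contMDiff_const
    set V : Set (Mat n) := (fun M : Mat n => ((M, a) : Mat n × ξ.E)) ⁻¹' U with hV
    have hVo : IsOpen V := hU.preimage hι.continuous
    have hG : ContMDiffOn 𝓘(ℝ, Mat n) (totalModel 𝔤 n) ∞ (fun M : Mat n => F (M, a)) V :=
      hF.comp hι.contMDiffOn (fun _ h => h)
    have hmem : ∀ A : SO n, A • a ∈ e.source := fun A => by
      rw [e.mem_source, ξ.proj_actSO, ha]; exact hx
    refine ⟨V ∩ (fun M : Mat n => F (M, a)) ⁻¹' e.source,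
      hG.continuousOn.isOpen_inter_preimage hVo e.open_source, ⟨hAU, ?_⟩,
      fun M => (e a).2⁻¹ * (e (F (M, a))).2, ?_, ?_⟩
    · change F (SO.mat A₀, a) ∈ e.source
      rw [hFa (A₀, a) hAU]; exact hmem A₀
    · have h1 : ContMDiffOn 𝓘(ℝ, Mat n) (totalModel 𝔤 n) ∞ (fun M : Mat n => e (F (M, a)))
          (V ∩ (fun M : Mat n => F (M, a)) ⁻¹' e.source) :=
        hes.comp (hG.mono inter_subset_left) (fun _ h => h.2)
      exact contMDiffOn_const.mul (contMDiff_snd.comp_contMDiffOn h1)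
    · rintro A ⟨hA, -⟩
      change (e a).2⁻¹ * (e (F (SO.mat A, a))).2 = ξ.isotropyElt a ha A
      rw [hFa (A, a) hA]
      change (e a).2⁻¹ * (e (A • a)).2 = _
      rw [ξ.isotropyElt_spec a ha A, he a has]
      group

theorem NGBundle.isotropy_spec (ξ : NGBundle 𝔤 G n) (a : ξ.E)
    (ha : ∀ A : SO n, rot A (ξ.proj a) = ξ.proj a) (A : SO n) :
    A • a = MulOpposite.op ((ξ.isotropy a ha).hom A) • a :=
  ξ.isotropyElt_spec a ha A

/-- The class of the isotropy representation does not depend on the point in the fibre, and is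
invariant under isomorphism. -/
theorem NGBundle.isotropy_conj {ξ ξ' : NGBundle 𝔤 G n} (h : ξ.Iso ξ') (a : ξ.E) (a' : ξ'.E)
    (haa' : ξ.proj a = ξ'.proj a') (ha : ∀ A : SO n, rot A (ξ.proj a) = ξ.proj a)
    (ha' : ∀ A : SO n, rot A (ξ'.proj a') = ξ'.proj a') :
    (conjSetoid 𝔤 G n).r (ξ.isotropy a ha) (ξ'.isotropy a' ha') := by
  obtain ⟨h, h1, h2, h3⟩ := h
  obtain ⟨g, hg⟩ := ξ'.exists_act a' (h a) (by rw [h3, haa'])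
  refine ⟨g, fun A => ?_⟩
  have e1 : A • h a = MulOpposite.op ((ξ.isotropy a ha).hom A) • h a := by
    rw [← h1, ← h2, ← ξ.isotropy_spec]
  rw [hg, ξ'.comm, ξ'.isotropy_spec a' ha' A, ← mul_smul, ← mul_smul, ← MulOpposite.op_mul,
    ← MulOpposite.op_mul] at e1
  rw [← ξ'.act_injective a' e1]
  group

variable (𝔤 G n)

/-- The class in `R(n, G)` of the isotropy representation of a bundle at a point of the fibre over a
pole of `S^n`. -/
def isotropyClass (s : ℝ) (hs : |s| = 1) : BundleClasses 𝔤 G n → R 𝔤 G n :=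
  Quotient.lift
    (fun ξ => Quotient.mk _ (ξ.isotropy (ξ.exists_fibre (pole n s hs)).choose
      (fun A => by rw [(ξ.exists_fibre (pole n s hs)).choose_spec, rot_pole])))
    (fun ξ ξ' h => Quotient.sound (NGBundle.isotropy_conj h _ _
      (by rw [(ξ.exists_fibre _).choose_spec, (ξ'.exists_fibre _).choose_spec]) _ _))

/-- The map `J : 𝓔(n, G) → R(n, G) × R(n, G)`, `J(ξ) = ([α], [β])`, where `α` and `β` are isotropy
representations over the south pole and the north pole. -/
def J (x : BundleClasses 𝔤 G n) : R 𝔤 G n × R 𝔤 G n :=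
  (isotropyClass 𝔤 G n (-1) (by simp) x, isotropyClass 𝔤 G n 1 (by simp) x)

/-- The map `J̄ : 𝓔(m + 1, G) → R(m, G)`, `J̄(ξ) = Res [α]`. -/
def Jbar (m : ℕ) (x : BundleClasses 𝔤 G (m + 1)) : R 𝔤 G m := Res 𝔤 G m (J 𝔤 G (m + 1) x).1

end

end EquivBundle

end

noncomputable section

universe u v

namespace EquivBundle

/-! ### `SO(n)` as a compact group and its Haar measure -/

/-! Write n = m + 1. The meridian `merid m` joins the two poles and, since m ≥ 1, meets every
SO(n)-orbit of the sphere in exactly one point; the stabilizer of that point is SO(n) at the poles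
and SO(m) elsewhere. An (n, G)-bundle is therefore governed by a smooth lift z of the meridian on
which SO(m) acts through γ. At the ends of z the group SO(n) acts through homomorphisms α, β
extending γ. Two such lifts, even in isomorphic bundles, differ by a smooth path in Z γ
(`IsLiftWith.exists_path`), so the class of (α, β) in Rγ depends only on the isomorphism class of
the bundle. This class is the value of the required map.

Lifts exist because a smooth action of a compact group has an invariant local section through each
fixed point: averaging over Haar measure yields an equivariant function with invertible fibre
derivative, whose zero set is invariant and, by the implicit function theorem, a graph
(`exists_invariant_section_model`). Applied to z ↦ A z α(A)⁻¹, this gives equivariant sections,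
hence local lifts of the meridian. These are joined on overlaps by letting the connecting path in Z
γ come to rest (`IsLiftOn.exists_join`, `IsLiftOn.exists_extension`).

Injectivity: if two bundles have lifts z, z' with the same α, β, then A z(t) g ↦ A z'(t) g is a
well-defined equivariant bijection. It is smooth away from the poles, where the sphere is locally
described by the height and a smoothly chosen rotation. At the poles smoothness is secured by taking
lifts that are radial there, that is, restrictions of equivariant sections
(`NGBundle.exists_radialLift`, `IsRadialLift.iso`). An equivalence between two pairs can be realized
by a path constant near the ends, which preserves radiality (`IsRadialLift.exists_of_path`).

Surjectivity: given (α, β), two trivial bundles over the complements of the poles, with SO(n) acting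
through α and β, are glued along A · merid(t) ↦ β(A) α(A)⁻¹. This is well defined because α and β
agree on SO(m) (`clutchingCocycle`, `exists_bundle_isLiftWith`). -/

theorem SO.continuous_mat {k : ℕ} : Continuous (SO.mat (n := k)) := continuous_subtype_val

instance SO.isTopologicalGroup (k : ℕ) : IsTopologicalGroup (SO k) where
  continuous_inv := by
    refine Continuous.subtype_mk (f := fun A : SO k => star A.1) ?_ _
    exact continuous_subtype_val.star

theorem SO.abs_entry_le {k : ℕ} (A : SO k) (i j : Fin k) : |A.1 i j| ≤ 1 := by
  have h := congrFun (congrFun ((mem_SO_iff A.1).1 A.2).1 i) i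
  rw [Matrix.mul_apply, Matrix.one_apply_eq] at h
  have : A.1 i j * A.1 i j ≤ 1 := by
    rw [← h]
    exact Finset.single_le_sum (f := fun l => A.1 i l * A.1 i l)
      (fun l _ => mul_self_nonneg _) (Finset.mem_univ j)
  exact abs_le_one_iff_mul_self_le_one.2 this

instance SO.compactSpace (k : ℕ) : CompactSpace (SO k) := by
  refine (isCompact_iff_compactSpace (s := (Matrix.specialOrthogonalGroup (Fin k) ℝ :
    Set (Matrix (Fin k) (Fin k) ℝ)))).1 ?_
  have hK : IsCompact (Set.pi univ fun _ : Fin k => Set.pi univ fun _ : Fin k => Icc (-1 : ℝ) 1) :=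
    isCompact_univ_pi fun _ => isCompact_univ_pi fun _ => isCompact_Icc
  refine IsCompact.of_isClosed_subset (s := (Set.pi univ fun _ : Fin k =>
    Set.pi univ fun _ : Fin k => Icc (-1 : ℝ) 1 : Set (Matrix (Fin k) (Fin k) ℝ))) hK ?_ ?_
  · have : (Matrix.specialOrthogonalGroup (Fin k) ℝ : Set (Matrix (Fin k) (Fin k) ℝ)) =
        {A | A * A.transpose = 1} ∩ {A | A.det = 1} := by
      ext A; exact mem_SO_iff A
    rw [this]
    exact (isClosed_eq (by fun_prop) continuous_const).inter
      (isClosed_eq (by fun_prop) continuous_const)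
  · intro A hA i _ j _
    exact abs_le.1 (SO.abs_entry_le ⟨A, hA⟩ i j)

instance SO.measurableSpace (k : ℕ) : MeasurableSpace (SO k) := borel _

instance SO.borelSpace (k : ℕ) : BorelSpace (SO k) := ⟨rfl⟩

/-- The normalized Haar measure of `SO(k)`. -/
def SO.haar (k : ℕ) : MeasureTheory.Measure (SO k) :=
  MeasureTheory.Measure.haarMeasure ⊤

instance SO.haar_prob (k : ℕ) : MeasureTheory.IsProbabilityMeasure (SO.haar k) :=
  ⟨by rw [SO.haar, ← TopologicalSpace.PositiveCompacts.coe_top,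
    MeasureTheory.Measure.haarMeasure_self]⟩

instance SO.haar_isMulLeftInvariant (k : ℕ) : (SO.haar k).IsMulLeftInvariant := by
  unfold SO.haar; infer_instance

/-! ### Families of maps depending smoothly on a parameter in `SO(k)` -/

section Param

variable {k : ℕ} {X : Type*} [NormedAddCommGroup X] [NormedSpace ℝ X]
  {V : Type*} [NormedAddCommGroup V] [NormedSpace ℝ V]
  {V' : Type*} [NormedAddCommGroup V'] [NormedSpace ℝ V']

/-- A family of maps between normed spaces, defined on `W`, depending smoothly on a parameter
in `SO(k)`. -/
def ParamSmooth (f : SO k → X → V) (W : Set X) : Prop :=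
  ∀ A : SO k, ∀ x ∈ W, ∃ U : Set (Mat k × X), IsOpen U ∧ (A.mat, x) ∈ U ∧
    ∃ F : Mat k × X → V, ContDiffOn ℝ ∞ F U ∧ ∀ (B : SO k) (y : X), (B.mat, y) ∈ U →
      F (B.mat, y) = f B y

theorem ParamSmooth.continuousOn {f : SO k → X → V} {W : Set X} (hf : ParamSmooth f W) :
    ContinuousOn (fun p : X × SO k => f p.2 p.1) (W ×ˢ univ) := by
  rintro ⟨x, A⟩ ⟨hx, -⟩
  obtain ⟨U, hU, hAU, F, hF, hFf⟩ := hf A x hx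
  have hc : Continuous (fun p : X × SO k => (p.2.mat, p.1)) :=
    (SO.continuous_mat.comp continuous_snd).prodMk continuous_fst
  have hm : ∀ᶠ p : X × SO k in 𝓝 (x, A), (p.2.mat, p.1) ∈ U :=
    hc.continuousAt.eventually (hU.mem_nhds hAU)
  have : ContinuousAt (fun p : X × SO k => F (p.2.mat, p.1)) (x, A) :=
    ContinuousAt.comp (f := fun p : X × SO k => (p.2.mat, p.1))
      (hF.continuousOn.continuousAt (hU.mem_nhds hAU)) hc.continuousAt
  refine (this.congr ?_).continuousWithinAt
  filter_upwards [hm] with p hp using hFf _ _ hp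

theorem ParamSmooth.continuous {f : SO k → X → V} {W : Set X} (hf : ParamSmooth f W)
    {x : X} (hx : x ∈ W) : Continuous (fun A => f A x) :=
  continuousOn_univ.1 (hf.continuousOn.comp (f := fun A => (x, A)) (by fun_prop)
    (fun _ _ => ⟨hx, mem_univ _⟩))

theorem ParamSmooth.contDiffAt {f : SO k → X → V} {W : Set X} (hf : ParamSmooth f W) (A : SO k)
    {x : X} (hx : x ∈ W) : ContDiffAt ℝ ∞ (f A) x := by
  obtain ⟨U, hU, hAU, F, hF, hFf⟩ := hf A x hx
  have h1 : ContDiffAt ℝ ∞ (fun y => F (A.mat, y)) x :=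
    ContDiffAt.comp x (f := fun y => (A.mat, y)) (hF.contDiffAt (hU.mem_nhds hAU)) (by fun_prop)
  refine h1.congr_of_eventuallyEq ?_
  have hc : Continuous (fun y : X => (A.mat, y)) := by fun_prop
  filter_upwards [hc.continuousAt.eventually (hU.mem_nhds hAU)] with y hy
  exact (hFf A y hy).symm

theorem ParamSmooth.fderiv {f : SO k → X → V} {W : Set X} (hf : ParamSmooth f W) :
    ParamSmooth (fun A x => _root_.fderiv ℝ (f A) x) W := by
  intro A x hx
  obtain ⟨U, hU, hAU, F, hF, hFf⟩ := hf A x hx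
  refine ⟨U, hU, hAU, fun p => (_root_.fderiv ℝ F p).comp (ContinuousLinearMap.inr ℝ (Mat k) X), ?_, ?_⟩
  · exact (hF.fderiv_of_isOpen hU (m := ∞) le_rfl).clm_comp contDiffOn_const
  · intro B y hB
    have h1 : HasFDerivAt F (_root_.fderiv ℝ F (B.mat, y)) (B.mat, y) :=
      ((hF.contDiffAt (hU.mem_nhds hB)).differentiableAt (by simp)).hasFDerivAt
    have h2 : HasFDerivAt (fun y : X => (B.mat, y)) (ContinuousLinearMap.inr ℝ (Mat k) X) y :=
      hasFDerivAt_prodMk_right _ _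
    have h3 : HasFDerivAt (fun y : X => F (B.mat, y)) _ y := h1.comp y h2
    refine (HasFDerivAt.fderiv (h3.congr_of_eventuallyEq ?_)).symm
    filter_upwards [h2.continuousAt.eventually (hU.mem_nhds hB)] with z hz
    exact (hFf B z hz).symm

/-- Differentiation under the integral sign. Compactness of SO(k) gives one neighbourhood of `x` on
which the derivatives are bounded by a constant uniformly in the parameter, and constants are
integrable. -/
theorem ParamSmooth.hasFDerivAt_integral [CompleteSpace V] {f : SO k → X → V} {W : Set X}
    (hW : IsOpen W)
    (hf : ParamSmooth f W) {x : X} (hx : x ∈ W) :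
    HasFDerivAt (fun x => ∫ A, f A x ∂(SO.haar k)) (∫ A, _root_.fderiv ℝ (f A) x ∂(SO.haar k)) x := by
  have hc := hf.fderiv.continuousOn
  set C : ℝ := sSup (range fun A : SO k => ‖_root_.fderiv ℝ (f A) x‖) with hC
  have hbdd : ∃ C : ℝ, ∀ A : SO k, ‖_root_.fderiv ℝ (f A) x‖ < C := by
    obtain ⟨C, hC⟩ := isCompact_univ.exists_bound_of_continuousOn
      (hf.fderiv.continuous hx).continuousOn
    exact ⟨C + 1, fun A => lt_of_le_of_lt (hC A (mem_univ _)) (lt_add_one _)⟩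
  obtain ⟨C, hC⟩ := hbdd
  have hev : ∀ᶠ y in 𝓝 x, ∀ A ∈ (univ : Set (SO k)), y ∈ W ∧ ‖_root_.fderiv ℝ (f A) y‖ < C := by
    refine isCompact_univ.eventually_forall_of_forall_eventually fun A _ => ?_
    have hWn : W ×ˢ (univ : Set (SO k)) ∈ 𝓝 (x, A) :=
      (hW.prod isOpen_univ).mem_nhds ⟨hx, mem_univ _⟩
    have := (hc.continuousAt hWn).norm.eventually_lt_const (hC A)
    filter_upwards [this, hWn] with p hp hp' using ⟨hp'.1, hp⟩
  have hint : ∀ y ∈ W, MeasureTheory.Integrable (fun A => f A y) (SO.haar k) := fun y hy =>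
    (hf.continuous hy).integrable_of_hasCompactSupport (HasCompactSupport.of_compactSpace _)
  refine hasFDerivAt_integral_of_dominated_of_fderiv_le (𝕜 := ℝ) (bound := fun _ => C)
    (F := fun x A => f A x) (F' := fun x A => _root_.fderiv ℝ (f A) x) hev ?_ (hint x hx) ?_ ?_
    (MeasureTheory.integrable_const _) ?_
  · filter_upwards [hW.mem_nhds hx] with y hy using (hint y hy).aestronglyMeasurable
  · exact ((hf.fderiv.continuous hx).integrable_of_hasCompactSupport
      (HasCompactSupport.of_compactSpace _)).aestronglyMeasurable
  · exact Filter.Eventually.of_forall fun A y hy => (hy A (mem_univ _)).2.le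
  · exact Filter.Eventually.of_forall fun A y hy =>
      ((hf.contDiffAt A (hy A (mem_univ _)).1).differentiableAt (by simp)).hasFDerivAt

theorem ParamSmooth.comp_right {f : SO k → X → V} {W : Set X} (hf : ParamSmooth f W)
    {g : V → V'} (hg : ContDiff ℝ ∞ g) : ParamSmooth (fun A x => g (f A x)) W := by
  intro A x hx
  obtain ⟨U, hU, hAU, F, hF, hFf⟩ := hf A x hx
  exact ⟨U, hU, hAU, fun p => g (F p), hg.comp_contDiffOn hF, fun B y h => by simp only [hFf B y h]⟩

theorem SO.contDiff_transpose : ContDiff ℝ ∞ (fun M : Mat k => (fun i j => M j i : Mat k)) := by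
  fun_prop

theorem ParamSmooth.inv {f : SO k → X → V} {W : Set X} (hf : ParamSmooth f W) :
    ParamSmooth (fun A x => f A⁻¹ x) W := by
  intro A x hx
  obtain ⟨U, hU, hAU, F, hF, hFf⟩ := hf A⁻¹ x hx
  have hc : ContDiff ℝ ∞ (fun p : Mat k × X => ((fun i j => p.1 j i : Mat k), p.2)) :=
    (SO.contDiff_transpose.comp contDiff_fst).prodMk contDiff_snd
  exact ⟨_, hU.preimage hc.continuous, hAU, _, hF.comp hc.contDiffOn (fun _ h => h),
    fun B y h => hFf B⁻¹ y h⟩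

theorem ParamSmooth.clm_apply {f : SO k → X → V} {L : SO k → X → V →L[ℝ] V'} {W : Set X}
    (hL : ParamSmooth L W) (hf : ParamSmooth f W) : ParamSmooth (fun A x => L A x (f A x)) W := by
  intro A x hx
  obtain ⟨U, hU, hAU, F, hF, hFf⟩ := hf A x hx
  obtain ⟨U', hU', hAU', F', hF', hFf'⟩ := hL A x hx
  refine ⟨U ∩ U', hU.inter hU', ⟨hAU, hAU'⟩, fun p => F' p (F p),
    (hF'.mono inter_subset_right).clm_apply (hF.mono inter_subset_left), fun B y h => ?_⟩
  simp only [hFf B y h.1, hFf' B y h.2]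

/-- A value of a parametrized family, as a family of constant maps. -/
theorem ParamSmooth.const_at {f : SO k → X → V} {W : Set X} (hf : ParamSmooth f W) {x₀ : X}
    (hx₀ : x₀ ∈ W) (W' : Set V') : ParamSmooth (fun A (_ : V') => f A x₀) W' := by
  intro A x hx
  obtain ⟨U, hU, hAU, F, hF, hFf⟩ := hf A x₀ hx₀
  have hc : ContDiff ℝ ∞ (fun p : Mat k × V' => (p.1, x₀)) := by fun_prop
  exact ⟨_, hU.preimage hc.continuous, hAU, _, hF.comp hc.contDiffOn (fun _ h => h),
    fun B y h => hFf B x₀ h⟩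

end Param

/-- Induction on the order: the derivative of the integral is the integral of the derivatives, again
a smooth parametrized family. `X` and `V` share a universe so that `X →L[ℝ] V` may take the place of
`V`. -/
theorem ParamSmooth.contDiffOn_integral {k : ℕ} {X V : Type v} [NormedAddCommGroup X]
    [NormedSpace ℝ X] [NormedAddCommGroup V] [NormedSpace ℝ V] [CompleteSpace V]
    {f : SO k → X → V} {W : Set X}
    (hW : IsOpen W) (hf : ParamSmooth f W) :
    ContDiffOn ℝ ∞ (fun x => ∫ A, f A x ∂(SO.haar k)) W := by
  refine contDiffOn_infty.2 fun n => ?_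
  induction n generalizing V with
  | zero =>
    refine contDiffOn_zero.2 fun x hx =>
      (hf.hasFDerivAt_integral hW hx).continuousAt.continuousWithinAt
  | succ n ih =>
    rw [Nat.cast_succ, contDiffOn_succ_iff_fderiv_of_isOpen hW]
    refine ⟨fun x hx => (hf.hasFDerivAt_integral hW hx).differentiableAt.differentiableWithinAt,
      by simp, (ih hf.fderiv).congr fun x hx => (hf.hasFDerivAt_integral hW hx).fderiv⟩

/-- The implicit function theorem with a smooth solution on a whole neighbourhood, and local
uniqueness of the solutions. -/
theorem exists_implicit_section {X V : Type*} [NormedAddCommGroup X] [NormedSpace ℝ X]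
    [CompleteSpace X] [NormedAddCommGroup V] [NormedSpace ℝ V] [CompleteSpace V]
    {W : Set (X × V)} (hW : IsOpen W) {r : X × V → V} (hr : ContDiffOn ℝ ∞ r W) {w₀ : X × V}
    (hw₀ : w₀ ∈ W)
    (hinv : (fderiv ℝ r w₀ ∘L ContinuousLinearMap.inr ℝ X V).IsInvertible) :
    ∃ (D : Set X) (s : X → V), IsOpen D ∧ w₀.1 ∈ D ∧ ContDiffOn ℝ ∞ s D ∧ s w₀.1 = w₀.2 ∧
      (∀ x ∈ D, (x, s x) ∈ W ∧ r (x, s x) = r w₀) ∧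
      ∀ᶠ w in 𝓝 w₀, r w = r w₀ → s w.1 = w.2 := by
  have hrat : ∀ w ∈ W, ContDiffAt ℝ ∞ r w := fun w hw => hr.contDiffAt (hW.mem_nhds hw)
  have h0 := hrat w₀ hw₀
  have hne : (∞ : WithTop ℕ∞) ≠ 0 := by simp
  set s := h0.implicitFunction hne hinv with hs
  have hs0 : s w₀.1 = w₀.2 := h0.implicitFunction_apply_self hne hinv
  have hcs : ContDiffAt ℝ ∞ s w₀.1 := h0.contDiffAt_implicitFunction hne hinv
  -- Smoothness of order ∞ at a single point does not spread to a neighbourhood, but smoothness of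
  -- order 1 does; it provides continuity of `s` nearby.
  have hcont : ∀ᶠ x in 𝓝 w₀.1, ContinuousAt s x := by
    have h1 : ContDiffAt ℝ 1 s w₀.1 := hcs.of_le (by exact_mod_cast le_top)
    filter_upwards [h1.eventually (by simp)] with x hx using hx.continuousAt
  have hpair : ContinuousAt (fun x => (x, s x)) w₀.1 := by
    exact continuousAt_id.prodMk hcs.continuousAt
  have hw0 : ((w₀.1, s w₀.1) : X × V) = w₀ := by rw [hs0]
  have hinvev : ∀ᶠ w in 𝓝 w₀, (fderiv ℝ r w ∘L ContinuousLinearMap.inr ℝ X V).IsInvertible := by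
    have hc : ContinuousAt (fun w => fderiv ℝ r w ∘L ContinuousLinearMap.inr ℝ X V) w₀ := by
      have : ContinuousAt (fderiv ℝ r) w₀ :=
        ((h0.fderiv_right (m := 0) (by simp)).continuousAt)
      exact this.clm_comp continuousAt_const
    have ho : {L : V →L[ℝ] V | L.IsInvertible} ∈ 𝓝 (fderiv ℝ r w₀ ∘L ContinuousLinearMap.inr ℝ X V) := by
      obtain ⟨M, hM⟩ := hinv
      rw [← hM]
      filter_upwards [M.nhds] with L hL
      exact hL
    exact hc.eventually ho
  have hev : ∀ᶠ x in 𝓝 w₀.1, ContinuousAt s x ∧ (x, s x) ∈ W ∧ r (x, s x) = r w₀ ∧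
      (fderiv ℝ r (x, s x) ∘L ContinuousLinearMap.inr ℝ X V).IsInvertible := by
    have hpair' : Filter.Tendsto (fun x => (x, s x)) (𝓝 w₀.1) (𝓝 w₀) := by
      have := hpair.tendsto; rwa [hw0] at this
    filter_upwards [hcont, hpair'.eventually (hW.mem_nhds hw₀),
      h0.eventually_apply_implicitFunction hne hinv, hpair'.eventually hinvev] with x h1 h2 h3 h4
    exact ⟨h1, h2, h3, h4⟩
  obtain ⟨D, hD, hDo, hmem⟩ := mem_nhds_iff.1 hev
  refine ⟨D, s, hDo, hmem, ?_, hs0, fun x hx => ⟨(hD hx).2.1, (hD hx).2.2.1⟩, ?_⟩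
  -- The implicit function theorem is applied afresh at (x, s x), where the fibre derivative is
  -- still invertible. Local uniqueness identifies its solution with `s`, which is thus smooth at
  -- `x`.
  · intro x hx
    obtain ⟨h1, h2, h3, h4⟩ := hD hx
    have hx0 := hrat _ h2
    refine ContDiffAt.contDiffWithinAt ?_
    refine (hx0.contDiffAt_implicitFunction hne h4).congr_of_eventuallyEq ?_
    have hp : Filter.Tendsto (fun x => (x, s x)) (𝓝 x) (𝓝 (x, s x)) :=
      (continuousAt_id.prodMk h1).tendsto
    filter_upwards [hp.eventually (hx0.eventually_apply_eq_iff_implicitFunction hne h4),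
      hDo.mem_nhds hx] with y hy hyD
    exact (hy.1 (by rw [(hD hyD).2.2.1, h3])).symm
  · filter_upwards [h0.eventually_apply_eq_iff_implicitFunction hne hinv] with w hw h
    exact hw.1 h

/-- A smooth fibre-preserving action of `SO(k)` on an open subset of `X × V` has, near a fixed
point, a smooth invariant section. -/
theorem exists_invariant_section_model {k : ℕ} {X : Type} [NormedAddCommGroup X]
    [NormedSpace ℝ X] [CompleteSpace X] {V : Type v} [NormedAddCommGroup V] [NormedSpace ℝ V]
    [CompleteSpace V] {W : Set (X × V)} (hW : IsOpen W) {x₀ : X} {v₀ : V} (hw₀ : (x₀, v₀) ∈ W)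
    {T : SO k → X × V → X × V} (hT : ParamSmooth T W)
    (hT1 : ∀ w ∈ W, T 1 w = w) (hTmul : ∀ A B, ∀ w ∈ W, T (A * B) w = T A (T B w))
    (hT0 : ∀ A, T A (x₀, v₀) = (x₀, v₀))
    (hfib : ∀ A, ∀ w ∈ W, ∀ w' ∈ W, w.1 = w'.1 → (T A w).1 = (T A w').1) :
    ∃ (D : Set X) (s : X → V), IsOpen D ∧ x₀ ∈ D ∧ ContDiffOn ℝ ∞ s D ∧ s x₀ = v₀ ∧
      (∀ x ∈ D, (x, s x) ∈ W) ∧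
      ∀ x ∈ D, ∀ A, s (T A (x, s x)).1 = (T A (x, s x)).2 := by
  set θ : SO k → X × V → V := fun A w => (T A w).2 with hθ
  have hθs : ParamSmooth θ W := hT.comp_right contDiff_snd
  set L : SO k → V →L[ℝ] V := fun A => fderiv ℝ (θ A) (x₀, v₀) ∘L ContinuousLinearMap.inr ℝ X V
    with hL
  have hLs : ParamSmooth (fun A (_ : X × V) => L A) W := by
    have h1 : ParamSmooth (fun A w => fderiv ℝ (θ A) w ∘L ContinuousLinearMap.inr ℝ X V) W :=
      hθs.fderiv.comp_right (g := fun M => M ∘L ContinuousLinearMap.inr ℝ X V)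
        (contDiff_id.clm_comp contDiff_const)
    exact h1.const_at hw₀ W
  have hLd : ∀ A, HasFDerivAt (fun v => θ A (x₀, v)) (L A) v₀ := fun A =>
    HasFDerivAt.comp (f := fun v : V => (x₀, v)) v₀
      ((hθs.contDiffAt A hw₀).differentiableAt (by simp)).hasFDerivAt
      (hasFDerivAt_prodMk_right x₀ v₀)
  have hθ0 : ∀ A, θ A (x₀, v₀) = v₀ := fun A => by simp [hθ, hT0]
  have hnear : ∀ᶠ v in 𝓝 v₀, (x₀, v) ∈ W :=
    (Continuous.prodMk_right x₀).continuousAt.eventually (hW.mem_nhds hw₀)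
  -- The fibre over `x₀` is carried to itself, so the chain rule on this fibre makes `L`
  -- multiplicative.
  have hT2 : ∀ A, ∀ v, (x₀, v) ∈ W → T A (x₀, v) = (x₀, θ A (x₀, v)) := fun A v hv =>
    Prod.ext (by rw [hfib A _ hv _ hw₀ rfl, hT0]) rfl
  have hL1 : L 1 = ContinuousLinearMap.id ℝ V := by
    refine (hLd 1).unique ((hasFDerivAt_id v₀).congr_of_eventuallyEq ?_)
    filter_upwards [hnear] with v hv
    simp [hθ, hT1 _ hv]
  have hLmul : ∀ A B, L (A * B) = L A ∘L L B := fun A B => by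
    have h1 : HasFDerivAt (fun v => θ A (x₀, θ B (x₀, v))) (L A ∘L L B) v₀ := by
      refine HasFDerivAt.comp (g := fun v => θ A (x₀, v)) (f := fun v => θ B (x₀, v)) v₀ ?_ (hLd B)
      rw [hθ0]; exact hLd A
    refine (hLd (A * B)).unique (h1.congr_of_eventuallyEq ?_)
    filter_upwards [hnear] with v hv
    change (T (A * B) (x₀, v)).2 = (T A (x₀, θ B (x₀, v))).2
    rw [hTmul A B _ hv, hT2 B v hv]
  -- The average `r` of `f` satisfies r ∘ T B = L B ∘ r by invariance of Haar measure, so its zero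
  -- set is invariant. Its fibre derivative at the fixed point averages L A ∘ L A⁻¹ = id, so near
  -- that point the zero set is a graph.
  set f : SO k → X × V → V := fun A w => L A (θ A⁻¹ w - v₀) with hf
  have hfs : ParamSmooth f W := hLs.clm_apply
    (hθs.inv.comp_right (g := fun v => v - v₀) (contDiff_id.sub contDiff_const))
  set r : X × V → V := fun w => ∫ A, f A w ∂(SO.haar k) with hr
  have hrs : ContDiffOn ℝ ∞ r W := hfs.contDiffOn_integral hW
  have hint : ∀ w ∈ W, MeasureTheory.Integrable (fun A => f A w) (SO.haar k) := fun w hw =>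
    (hfs.continuous hw).integrable_of_hasCompactSupport (HasCompactSupport.of_compactSpace _)
  have hreq : ∀ B, ∀ w ∈ W, r (T B w) = L B (r w) := fun B w hw => by
    simp only [hr]
    rw [← MeasureTheory.integral_mul_left_eq_self _ B, ← (L B).integral_comp_comm (hint w hw)]
    refine MeasureTheory.integral_congr_ae (Filter.Eventually.of_forall fun A => ?_)
    simp only [hf, hθ]
    rw [← hTmul _ _ _ hw, hLmul]
    simp
  have hr0 : r (x₀, v₀) = 0 := by simp [hr, hf, hθ0]
  have hder : fderiv ℝ r (x₀, v₀) ∘L ContinuousLinearMap.inr ℝ X V = ContinuousLinearMap.id ℝ V := by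
    rw [(hfs.hasFDerivAt_integral hW hw₀).fderiv]
    ext v
    have hi : MeasureTheory.Integrable (fun A => fderiv ℝ (f A) (x₀, v₀)) (SO.haar k) :=
      (hfs.fderiv.continuous hw₀).integrable_of_hasCompactSupport
        (HasCompactSupport.of_compactSpace _)
    change (∫ A, fderiv ℝ (f A) (x₀, v₀) ∂(SO.haar k)) (0, v) = v
    rw [ContinuousLinearMap.integral_apply hi]
    have : ∀ A, fderiv ℝ (f A) (x₀, v₀) (0, v) = v := fun A => by
      have h1 : HasFDerivAt (f A) (L A ∘L fderiv ℝ (θ A⁻¹) (x₀, v₀)) (x₀, v₀) :=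
        (L A).hasFDerivAt.comp _
          (((hθs.contDiffAt A⁻¹ hw₀).differentiableAt (by simp)).hasFDerivAt.sub_const v₀)
      rw [h1.fderiv]
      change (L A ∘L L A⁻¹) v = v
      rw [← hLmul, mul_inv_cancel, hL1]; rfl
    simp [this]
  obtain ⟨D, s, hDo, hxD, hsD, hs0, hsW, huniq⟩ := exists_implicit_section hW hrs hw₀
    (by rw [hder]; exact ⟨ContinuousLinearEquiv.refl ℝ V, rfl⟩)
  -- By compactness the whole orbit of (x, s x) stays, for `x` close to `x₀`, in the neighbourhood
  -- of the fixed point where local uniqueness holds; so the orbit lies on the graph of `s`.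
  have hev : ∀ᶠ x in 𝓝 x₀, ∀ A ∈ (univ : Set (SO k)), x ∈ D ∧
      (r (T A (x, s x)) = r (x₀, v₀) → s (T A (x, s x)).1 = (T A (x, s x)).2) := by
    refine isCompact_univ.eventually_forall_of_forall_eventually fun A _ => ?_
    have hsc : ContinuousAt s x₀ := hsD.continuousOn.continuousAt (hDo.mem_nhds hxD)
    have h1 : ContinuousAt (fun p : X × SO k => ((p.1, s p.1), p.2)) (x₀, A) := by
      refine ContinuousAt.prodMk (ContinuousAt.prodMk continuousAt_fst ?_) continuousAt_snd
      exact ContinuousAt.comp (f := fun p : X × SO k => p.1) (x := (x₀, A)) hsc continuousAt_fst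
    have h2 : ContinuousAt (fun p : (X × V) × SO k => T p.2 p.1) ((x₀, s x₀), A) := by
      refine hT.continuousOn.continuousAt ((hW.prod isOpen_univ).mem_nhds ⟨?_, mem_univ _⟩)
      exact (hsW x₀ hxD).1
    have h3 : ContinuousAt (fun p : X × SO k => T p.2 (p.1, s p.1)) (x₀, A) :=
      ContinuousAt.comp (g := fun p : (X × V) × SO k => T p.2 p.1)
        (f := fun p : X × SO k => ((p.1, s p.1), p.2)) h2 h1
    have h4 : Filter.Tendsto (fun p : X × SO k => T p.2 (p.1, s p.1)) (𝓝 (x₀, A))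
        (𝓝 (x₀, v₀)) := by
      have := h3.tendsto
      simp only [hs0, hT0] at this
      exact this
    filter_upwards [h4.eventually huniq,
      continuousAt_fst.eventually (hDo.mem_nhds hxD)] with p hp hp'
    exact ⟨hp', hp⟩
  obtain ⟨D', hD', hDo', hmem⟩ := mem_nhds_iff.1 hev
  have hsub : D' ⊆ D := fun x hx => (hD' hx 1 (mem_univ _)).1
  refine ⟨D', s, hDo', hmem, hsD.mono hsub, hs0, fun x hx => (hsW x (hsub hx)).1, fun x hx A => ?_⟩
  refine (hD' hx A (mem_univ _)).2 ?_
  rw [hreq A _ (hsW x (hsub hx)).1, (hsW x (hsub hx)).2, hr0, map_zero]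

/-! ### Invariant local sections of bundles -/

section Sections

variable {𝔤 : Type v} [NormedAddCommGroup 𝔤] [NormedSpace ℝ 𝔤]
  {G : Type u} [TopologicalSpace G] [ChartedSpace 𝔤 G] [Group G] {n : ℕ}

/-- A family of self-maps of the total space of a bundle depending smoothly on a parameter in
`SO(k)`. -/
def SmoothFamily (ξ : NGBundle 𝔤 G n) {k : ℕ} (T : SO k → ξ.E → ξ.E) : Prop :=
  SmoothAlong (𝓘(ℝ, Mat k).prod (totalModel 𝔤 n)) (totalModel 𝔤 n)
    (fun q : SO k × ξ.E => ((SO.mat q.1, q.2) : Mat k × ξ.E)) (fun q : SO k × ξ.E => T q.1 q.2)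

theorem SmoothFamily.continuous {ξ : NGBundle 𝔤 G n} {k : ℕ} {T : SO k → ξ.E → ξ.E}
    (hT : SmoothFamily ξ T) : Continuous (fun p : ξ.E × SO k => T p.2 p.1) := by
  refine continuous_iff_continuousAt.2 ?_
  rintro ⟨z, A⟩
  obtain ⟨U, hU, hAU, F, hF, hFT⟩ := hT (A, z)
  have hc : Continuous (fun p : ξ.E × SO k => ((p.2.mat, p.1) : Mat k × ξ.E)) :=
    (SO.continuous_mat.comp continuous_snd).prodMk continuous_fst
  have h1 : ContinuousAt (fun p : ξ.E × SO k => F (p.2.mat, p.1)) (z, A) :=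
    ContinuousAt.comp (f := fun p : ξ.E × SO k => ((p.2.mat, p.1) : Mat k × ξ.E))
      (hF.continuousOn.continuousAt (hU.mem_nhds hAU)) hc.continuousAt
  refine h1.congr ?_
  filter_upwards [hc.continuousAt.eventually (hU.mem_nhds hAU)] with p hp using hFT (p.2, p.1) hp

/-- A chart of the total space of a bundle in which the projection is a linear projection. -/
theorem NGBundle.exists_fibred_chart [IsManifold 𝓘(ℝ, 𝔤) ∞ G] (ξ : NGBundle 𝔤 G n) (a : ξ.E) :
    ∃ ψ : PartialEquiv ξ.E (EuclideanSpace ℝ (Fin n) × 𝔤), a ∈ ψ.source ∧ IsOpen ψ.source ∧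
      IsOpen ψ.target ∧ ContMDiffOn (totalModel 𝔤 n) 𝓘(ℝ, EuclideanSpace ℝ (Fin n) × 𝔤) ∞ ψ
        ψ.source ∧ ContMDiffOn 𝓘(ℝ, EuclideanSpace ℝ (Fin n) × 𝔤) (totalModel 𝔤 n) ∞ ψ.symm
        ψ.target ∧
      ∀ z ∈ ψ.source, ξ.proj z ∈ (extChartAt (𝓡 n) (ξ.proj a)).source ∧
        (ψ z).1 = extChartAt (𝓡 n) (ξ.proj a) (ξ.proj z) := by
  obtain ⟨e, hx, hes, het, -⟩ := ξ.locally_trivial (ξ.proj a)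
  have ha : a ∈ e.source := e.mem_source.2 hx
  have hea : (e a).1 = ξ.proj a := e.coe_fst ha
  set c := extChartAt (totalModel 𝔤 n) (e a) with hc
  have hcp : c = (extChartAt (𝓡 n) (e a).1).prod (extChartAt 𝓘(ℝ, 𝔤) (e a).2) :=
    extChartAt_prod (e a)
  have hcs : ContMDiffOn (totalModel 𝔤 n) 𝓘(ℝ, EuclideanSpace ℝ (Fin n) × 𝔤) ∞ c c.source := by
    rw [hc, extChartAt_source]; exact contMDiffOn_extChartAt
  have hct : ContMDiffOn 𝓘(ℝ, EuclideanSpace ℝ (Fin n) × 𝔤) (totalModel 𝔤 n) ∞ c.symm c.target :=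
    contMDiffOn_extChartAt_symm (e a)
  have hco : IsOpen c.source := isOpen_extChartAt_source _
  have hct' : IsOpen c.target := isOpen_extChartAt_target _
  refine ⟨e.toPartialEquiv.trans c, ⟨ha, mem_extChartAt_source _⟩, ?_, ?_, ?_, ?_, ?_⟩
  · exact e.continuousOn_toFun.isOpen_inter_preimage e.open_source hco
  · exact hct.continuousOn.isOpen_inter_preimage hct' e.open_target
  · exact hcs.comp (hes.mono inter_subset_left) (fun _ h => h.2)
  · exact het.comp (hct.mono inter_subset_left) (fun _ h => h.2)
  · rintro z ⟨hz, hz'⟩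
    have hez : (e z).1 = ξ.proj z := e.coe_fst hz
    have h2 : e z ∈ c.source := hz'
    rw [hcp, hea] at h2
    refine ⟨hez ▸ h2.1, ?_⟩
    change (c (e z)).1 = _
    rw [hcp, hea, ← hez]
    rfl

/-- A smooth action of `SO(k)` on the total space of a bundle which covers an action on the sphere
has a smooth invariant local section through every fixed point. -/
theorem NGBundle.exists_invariant_section [IsManifold 𝓘(ℝ, 𝔤) ∞ G] [CompleteSpace 𝔤]
    (ξ : NGBundle 𝔤 G n) {k : ℕ}
    {T : SO k → ξ.E → ξ.E} (hT : SmoothFamily ξ T) (hT1 : ∀ z, T 1 z = z)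
    (hTmul : ∀ A B z, T (A * B) z = T A (T B z)) {τ : SO k → Sph n → Sph n}
    (hτ : ∀ A z, ξ.proj (T A z) = τ A (ξ.proj z))
    {a : ξ.E} (ha : ∀ A, T A a = a) :
    ∃ (D : Set (Sph n)) (s : Sph n → ξ.E), IsOpen D ∧ ξ.proj a ∈ D ∧
      ContMDiffOn (𝓡 n) (totalModel 𝔤 n) ∞ s D ∧ s (ξ.proj a) = a ∧
      (∀ x ∈ D, ξ.proj (s x) = x) ∧ ∀ x ∈ D, ∀ A, τ A x ∈ D ∧ T A (s x) = s (τ A x) := by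
  obtain ⟨ψ, haψ, hso, hto, hψ, hψs, hfib⟩ := ξ.exists_fibred_chart a
  have hcT := hT.continuous
  -- The chart points whose entire orbit remains in the domain of the chart; this set is open
  -- because SO(k) is compact.
  set W : Set (EuclideanSpace ℝ (Fin n) × 𝔤) :=
    {w | w ∈ ψ.target ∧ ∀ A, T A (ψ.symm w) ∈ ψ.source} with hWdef
  have hWo : IsOpen W := by
    refine isOpen_iff_mem_nhds.2 fun w hw => ?_
    have : ∀ᶠ w' in 𝓝 w, ∀ A ∈ (univ : Set (SO k)), w' ∈ ψ.target ∧
        T A (ψ.symm w') ∈ ψ.source := by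
      refine isCompact_univ.eventually_forall_of_forall_eventually fun A _ => ?_
      have h1 : ContinuousAt (fun p : (EuclideanSpace ℝ (Fin n) × 𝔤) × SO k =>
          T p.2 (ψ.symm p.1)) (w, A) := by
        have h2 : ContinuousAt (fun p : (EuclideanSpace ℝ (Fin n) × 𝔤) × SO k => ψ.symm p.1)
            (w, A) := ContinuousAt.comp (f := fun p : (EuclideanSpace ℝ (Fin n) × 𝔤) × SO k => p.1)
              (hψs.continuousOn.continuousAt (hto.mem_nhds hw.1)) continuousAt_fst
        exact ContinuousAt.comp
          (f := fun p : (EuclideanSpace ℝ (Fin n) × 𝔤) × SO k => (ψ.symm p.1, p.2))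
          hcT.continuousAt (h2.prodMk continuousAt_snd)
      filter_upwards [h1.eventually (hso.mem_nhds (hw.2 A)),
        continuousAt_fst.eventually (hto.mem_nhds hw.1)] with p h h' using ⟨h', h⟩
    filter_upwards [this] with w' hw'
    exact ⟨(hw' 1 (mem_univ _)).1, fun A => (hw' A (mem_univ _)).2⟩
  have hleft : ∀ z ∈ ψ.source, ψ.symm (ψ z) = z := fun z hz => ψ.left_inv hz
  set κ := extChartAt (𝓡 n) (ξ.proj a) with hκ
  have hψa : ψ a = (κ (ξ.proj a), (ψ a).2) := Prod.ext (hfib a haψ).2 rfl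
  have hw₀ : (κ (ξ.proj a), (ψ a).2) ∈ W := by
    rw [← hψa]
    exact ⟨ψ.map_source haψ, fun A => by rw [hleft a haψ, ha]; exact haψ⟩
  have hproj : ∀ w ∈ ψ.target, ξ.proj (ψ.symm w) = κ.symm w.1 := fun w hw => by
    have h := hfib _ (ψ.map_target hw)
    rw [ψ.right_inv hw] at h
    rw [h.2, κ.left_inv h.1]
  have hPS : ParamSmooth (fun A w => ψ (T A (ψ.symm w))) W := by
    intro A w hw
    obtain ⟨U, hU, hAU, F, hF, hFT⟩ := hT (A, ψ.symm w)
    have h1 : ContMDiffOn 𝓘(ℝ, Mat k × (EuclideanSpace ℝ (Fin n) × 𝔤))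
        (𝓘(ℝ, Mat k).prod (totalModel 𝔤 n)) ∞
        (fun p : Mat k × (EuclideanSpace ℝ (Fin n) × 𝔤) => ((p.1, ψ.symm p.2) : Mat k × ξ.E))
        (univ ×ˢ ψ.target) := by
      refine ContMDiffOn.prodMk (contDiff_fst.contMDiff.contMDiffOn) ?_
      exact hψs.comp contDiff_snd.contMDiff.contMDiffOn (fun _ h => h.2)
    have ho1 : IsOpen ((univ : Set (Mat k)) ×ˢ ψ.target) := isOpen_univ.prod hto
    have ho2 := h1.continuousOn.isOpen_inter_preimage ho1 hU
    have h2 := hF.comp (h1.mono (inter_subset_left (t := _ ⁻¹' U))) (fun _ h => h.2)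
    have ho3 := h2.continuousOn.isOpen_inter_preimage ho2 hso
    have h3 := hψ.comp (h2.mono (inter_subset_left (t := _ ⁻¹' ψ.source))) (fun _ h => h.2)
    refine ⟨_, ho3, ⟨⟨⟨mem_univ _, hw.1⟩, hAU⟩, ?_⟩, _, contMDiffOn_iff_contDiffOn.1 h3, ?_⟩
    · change F (A.mat, ψ.symm w) ∈ ψ.source
      rw [hFT (A, ψ.symm w) hAU]; exact hw.2 A
    · rintro B y ⟨⟨-, hB⟩, -⟩
      change ψ (F (B.mat, ψ.symm y)) = _
      rw [hFT (B, ψ.symm y) hB]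
  obtain ⟨D, s, hDo, hxD, hs, hs0, hsW, hsT⟩ := exists_invariant_section_model hWo hw₀ hPS
    (fun w hw => by simp only [hT1]; exact ψ.right_inv hw.1)
    (fun A B w hw => by simp only [hTmul]; rw [hleft _ (hw.2 B)])
    (fun A => by rw [← hψa, hleft a haψ, ha])
    (fun A w hw w' hw' h => by
      rw [(hfib _ (hw.2 A)).2, (hfib _ (hw'.2 A)).2, hτ, hτ, hproj w hw.1, hproj w' hw'.1, h])
  have hκs : ContMDiffOn (𝓡 n) (𝓡 n) ∞ κ κ.source := by
    rw [hκ, extChartAt_source]; exact contMDiffOn_extChartAt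
  have hκo : IsOpen κ.source := isOpen_extChartAt_source _
  set D₁ : Set (Sph n) := κ.source ∩ κ ⁻¹' D with hD₁
  have hD₁o : IsOpen D₁ := hκs.continuousOn.isOpen_inter_preimage hκo hDo
  set S : Sph n → ξ.E := fun x => ψ.symm (κ x, s (κ x)) with hS
  have hSs : ContMDiffOn (𝓡 n) (totalModel 𝔤 n) ∞ S D₁ := by
    have h1 : ContMDiffOn (𝓡 n) 𝓘(ℝ, EuclideanSpace ℝ (Fin n) × 𝔤) ∞ (fun x => (κ x, s (κ x)))
        D₁ := by
      have h2 : ContDiffOn ℝ ∞ (fun y => (y, s y)) D := contDiffOn_id.prodMk hs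
      exact h2.contMDiffOn.comp (hκs.mono inter_subset_left) (fun _ h => h.2)
    exact hψs.comp h1 (fun x hx => (hsW _ hx.2).1)
  have hSp : ∀ x ∈ D₁, ξ.proj (S x) = x := fun x hx => by
    rw [hS, hproj _ (hsW _ hx.2).1]; exact κ.left_inv hx.1
  have hSa : S (ξ.proj a) = a := by
    simp only [hS]
    rw [hs0, ← hψa, hleft a haψ]
  have haD : ξ.proj a ∈ D₁ := ⟨mem_extChartAt_source _, hxD⟩
  have hST : ∀ x ∈ D₁, ∀ A, T A (S x) = S (τ A x) := fun x hx A => by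
    have hin : T A (S x) ∈ ψ.source := (hsW _ hx.2).2 A
    have h1 := hsT _ hx.2 A
    have h2 : (ψ (T A (S x))).1 = κ (τ A x) := by rw [(hfib _ hin).2, hτ, hSp x hx]
    change s (ψ (T A (S x))).1 = (ψ (T A (S x))).2 at h1
    rw [h2] at h1
    change _ = ψ.symm (κ (τ A x), s (κ (τ A x)))
    rw [h1, ← h2]
    exact (hleft _ hin).symm
  -- Nothing is assumed about `τ` itself; over `D₁` its multiplicativity and continuity are
  -- inherited from `T` through the section.
  have hτx : ∀ x ∈ D₁, ∀ A, τ A x = ξ.proj (T A (S x)) := fun x hx A => by rw [hτ, hSp x hx]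
  have hτmul : ∀ x ∈ D₁, ∀ A B, τ (A * B) x = τ A (τ B x) := fun x hx A B => by
    rw [hτx x hx, hTmul, hτ, ← hτx x hx]
  -- Restricting to the points whose orbits stay in `D₁` makes the domain invariant; it is open by
  -- compactness once more.
  set D₂ : Set (Sph n) := {x | x ∈ D₁ ∧ ∀ A, τ A x ∈ D₁} with hD₂
  refine ⟨D₂, S, ?_, ⟨haD, fun A => ?_⟩, hSs.mono fun x hx => hx.1, hSa, fun x hx => hSp x hx.1,
    fun x hx A => ⟨⟨hx.2 A, fun B => ?_⟩, hST x hx.1 A⟩⟩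
  · refine isOpen_iff_mem_nhds.2 fun x hx => ?_
    have : ∀ᶠ y in 𝓝 x, ∀ A ∈ (univ : Set (SO k)), y ∈ D₁ ∧ ξ.proj (T A (S y)) ∈ D₁ := by
      refine isCompact_univ.eventually_forall_of_forall_eventually fun A _ => ?_
      have h1 : ContinuousAt (fun p : Sph n × SO k => ξ.proj (T p.2 (S p.1))) (x, A) := by
        have h2 : ContinuousAt (fun p : Sph n × SO k => S p.1) (x, A) :=
          ContinuousAt.comp (f := fun p : Sph n × SO k => p.1)
            (hSs.continuousOn.continuousAt (hD₁o.mem_nhds hx.1)) continuousAt_fst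
        exact ContinuousAt.comp (f := fun p : Sph n × SO k => (S p.1, p.2))
          (ξ.smooth_proj.continuous.comp hcT).continuousAt (h2.prodMk continuousAt_snd)
      have h3 : ξ.proj (T A (S x)) ∈ D₁ := by rw [← hτx x hx.1]; exact hx.2 A
      filter_upwards [h1.eventually (hD₁o.mem_nhds h3),
        continuousAt_fst.eventually (hD₁o.mem_nhds hx.1)] with p h h' using ⟨h', h⟩
    filter_upwards [this] with y hy
    have hy1 := (hy 1 (mem_univ _)).1
    exact ⟨hy1, fun A => by rw [hτx y hy1]; exact (hy A (mem_univ _)).2⟩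
  · rw [hτx _ haD, hSa, ha]; exact haD
  · rw [← hτmul x hx.1]; exact hx.2 _

end Sections

/-! ### Smoothness of differences, translations and actions in a bundle -/

section Calculus

variable {𝔤 : Type v} [NormedAddCommGroup 𝔤] [NormedSpace ℝ 𝔤]
  {G : Type u} [TopologicalSpace G] [ChartedSpace 𝔤 G] [Group G] {n : ℕ}

/-- A shortcut instance. -/
instance NGBundle.smulSO (ξ : NGBundle 𝔤 G n) : SMul (SO n) ξ.E := ξ.actSO.toSMul

theorem NGBundle.act_act (ξ : NGBundle 𝔤 G n) (g h : G) (z : ξ.E) :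
    MulOpposite.op h • MulOpposite.op g • z = MulOpposite.op (g * h) • z := by
  rw [MulOpposite.op_mul, mul_smul]

/-- The element `g` of `G` such that `b = a · g`, for points `a`, `b` of the same fibre. -/
def NGBundle.diff (ξ : NGBundle 𝔤 G n) (a b : ξ.E) : G :=
  open Classical in if h : ξ.proj a = ξ.proj b then (ξ.exists_act a b h).choose else 1

theorem NGBundle.act_diff (ξ : NGBundle 𝔤 G n) {a b : ξ.E} (h : ξ.proj a = ξ.proj b) :
    MulOpposite.op (ξ.diff a b) • a = b := by
  rw [NGBundle.diff, dif_pos h]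
  exact (ξ.exists_act a b h).choose_spec.symm

variable {E' : Type*} [NormedAddCommGroup E'] [NormedSpace ℝ E'] {H' : Type*}
  [TopologicalSpace H'] {I' : ModelWithCorners ℝ E' H'} {M : Type*} [TopologicalSpace M]
  [ChartedSpace H' M] {S : Set M} {x : M}

/-- In an equivariant trivialization `e`, the difference of `a` and `b` is `(e a).2⁻¹ * (e b).2`, a
smooth expression in the Lie group. -/
theorem NGBundle.contMDiffWithinAt_diff [LieGroup 𝓘(ℝ, 𝔤) ∞ G] (ξ : NGBundle 𝔤 G n)
    {f₁ f₂ : M → ξ.E}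
    (h₁ : ContMDiffWithinAt I' (totalModel 𝔤 n) ∞ f₁ S x)
    (h₂ : ContMDiffWithinAt I' (totalModel 𝔤 n) ∞ f₂ S x)
    (h : ∀ y ∈ S, ξ.proj (f₁ y) = ξ.proj (f₂ y)) (hx : x ∈ S) :
    ContMDiffWithinAt I' 𝓘(ℝ, 𝔤) ∞ (fun y => ξ.diff (f₁ y) (f₂ y)) S x := by
  obtain ⟨e, hxe, hes, -, he⟩ := ξ.locally_trivial (ξ.proj (f₁ x))
  have m1 : f₁ x ∈ e.source := e.mem_source.2 hxe
  have m2 : f₂ x ∈ e.source := e.mem_source.2 (h x hx ▸ hxe)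
  have c : ∀ {f : M → ξ.E}, ContMDiffWithinAt I' (totalModel 𝔤 n) ∞ f S x → f x ∈ e.source →
      ContMDiffWithinAt I' 𝓘(ℝ, 𝔤) ∞ (fun y => (e (f y)).2) S x := fun hf hm =>
    contMDiffAt_snd.comp_contMDiffWithinAt x
      ((hes.contMDiffAt (e.open_source.mem_nhds hm)).comp_contMDiffWithinAt x hf)
  have ev : ∀ᶠ y in 𝓝[S] x, f₁ y ∈ e.source :=
    h₁.continuousWithinAt.eventually (e.open_source.mem_nhds m1)
  have key : ∀ y ∈ S, f₁ y ∈ e.source →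
      ξ.diff (f₁ y) (f₂ y) = (e (f₁ y)).2⁻¹ * (e (f₂ y)).2 := fun y hy hye => by
    conv_rhs => rw [← ξ.act_diff (h y hy), he _ hye]
    group
  refine ((c h₁ m1).inv.mul (c h₂ m2)).congr_of_eventuallyEq ?_ (key x hx m1)
  filter_upwards [ev, self_mem_nhdsWithin] with y hy hyS using key y hyS hy

theorem NGBundle.contMDiffWithinAt_act (ξ : NGBundle 𝔤 G n) {f : M → ξ.E} {g : M → G}
    (hf : ContMDiffWithinAt I' (totalModel 𝔤 n) ∞ f S x)
    (hg : ContMDiffWithinAt I' 𝓘(ℝ, 𝔤) ∞ g S x) :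
    ContMDiffWithinAt I' (totalModel 𝔤 n) ∞ (fun y => MulOpposite.op (g y) • f y) S x :=
  (ξ.smooth_actG (f x, g x)).comp_contMDiffWithinAt (f := fun y => (f y, g y)) x (hf.prodMk hg)

/-- The source `P`, such as SO(n), carries no manifold structure here. A map into `P` is tested
after composition with `ι`, and the local extensions of `f` then do the rest. -/
theorem SmoothAlong.comp_contMDiffWithinAt {P : Type*}
    {V : Type*} [NormedAddCommGroup V] [NormedSpace ℝ V] {H : Type*} [TopologicalSpace H]
    {I : ModelWithCorners ℝ V H} {X : Type*} [TopologicalSpace X] [ChartedSpace H X]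
    {V₂ : Type*} [NormedAddCommGroup V₂] [NormedSpace ℝ V₂] {H₂ : Type*} [TopologicalSpace H₂]
    {I₂ : ModelWithCorners ℝ V₂ H₂} {N : Type*} [TopologicalSpace N] [ChartedSpace H₂ N]
    {ι : P → X} {f : P → N} (hf : SmoothAlong I I₂ ι f) {p : M → P}
    (hp : ContMDiffWithinAt I' I ∞ (fun y => ι (p y)) S x) :
    ContMDiffWithinAt I' I₂ ∞ (fun y => f (p y)) S x := by
  obtain ⟨U, hU, hxU, F, hF, hFf⟩ := hf (p x)
  have h1 : ContMDiffWithinAt I' I₂ ∞ (fun y => F (ι (p y))) S x :=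
    (hF.contMDiffAt (hU.mem_nhds hxU)).comp_contMDiffWithinAt x hp
  refine h1.congr_of_eventuallyEq ?_ (hFf _ hxU).symm
  filter_upwards [hp.continuousWithinAt.eventually (hU.mem_nhds hxU)] with y hy
  exact (hFf _ hy).symm

theorem NGBundle.contMDiffWithinAt_smul (ξ : NGBundle 𝔤 G n) {f : M → ξ.E} {A : M → SO n}
    (hA : ContMDiffWithinAt I' 𝓘(ℝ, Mat n) ∞ (fun y => (A y).mat) S x)
    (hf : ContMDiffWithinAt I' (totalModel 𝔤 n) ∞ f S x) :
    ContMDiffWithinAt I' (totalModel 𝔤 n) ∞ (fun y => A y • f y) S x :=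
  ξ.smooth_actSO.comp_contMDiffWithinAt (p := fun y => (A y, f y)) (hA.prodMk hf)

theorem NGBundle.contMDiff_smul (ξ : NGBundle 𝔤 G n) (A : SO n) :
    ContMDiff (totalModel 𝔤 n) (totalModel 𝔤 n) ∞ (fun z : ξ.E => A • z) := fun _ =>
  ξ.contMDiffWithinAt_smul contMDiffWithinAt_const contMDiffWithinAt_id

theorem NGBundle.contMDiff_act [IsManifold 𝓘(ℝ, 𝔤) ∞ G] (ξ : NGBundle 𝔤 G n) (g : G) :
    ContMDiff (totalModel 𝔤 n) (totalModel 𝔤 n) ∞ (fun z : ξ.E => MulOpposite.op g • z) :=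
  fun _ => ξ.contMDiffWithinAt_act contMDiffWithinAt_id contMDiffWithinAt_const

end Calculus

/-! ### Isotropy homomorphisms and equivariant local sections -/

section Isotropy

variable {𝔤 : Type v} [NormedAddCommGroup 𝔤] [NormedSpace ℝ 𝔤]
  {G : Type u} [TopologicalSpace G] [ChartedSpace 𝔤 G] [Group G] {n : ℕ}
  [LieGroup 𝓘(ℝ, 𝔤) ∞ G] {k : ℕ}

/-- A homomorphism `SO(k) → SO(n)` which is the restriction of a smooth map between the spaces of
matrices. -/
def IsMatSmooth (ι : SO k →* SO n) : Prop :=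
  ∃ K : Mat k → Mat n, ContDiff ℝ ∞ K ∧ ∀ A, K A.mat = (ι A).mat

theorem isMatSmooth_id : IsMatSmooth (MonoidHom.id (SO n)) := ⟨id, contDiff_id, fun _ => rfl⟩

theorem isMatSmooth_incl (m : ℕ) : IsMatSmooth (incl m) := ⟨_, contDiff_blockOne m, fun _ => rfl⟩

/-- Used with `ι` the identity over the poles and with `ι` the inclusion of SO(m) over the meridian.
Multiplicativity holds because the two actions commute and `G` acts freely; smoothness is read off
in a trivialization. -/
theorem NGBundle.exists_isotropyHom (ξ : NGBundle 𝔤 G n) {ι : SO k →* SO n} (hι : IsMatSmooth ι)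
    (a : ξ.E) (ha : ∀ A, rot (ι A) (ξ.proj a) = ξ.proj a) :
    ∃ α : SmoothHom 𝔤 G k, ∀ A, ι A • a = MulOpposite.op (α.hom A) • a := by
  obtain ⟨K, hK, hKι⟩ := hι
  have hd : ∀ A, MulOpposite.op (ξ.diff a (ι A • a)) • a = ι A • a := fun A =>
    ξ.act_diff (by rw [ξ.proj_actSO, ha])
  refine ⟨⟨MonoidHom.mk' (fun A => ξ.diff a (ι A • a)) fun B A => ?_, ?_⟩, fun A => (hd A).symm⟩
  · apply ξ.act_injective a
    rw [hd, ← ξ.act_act, hd, ← ξ.comm, hd, map_mul, mul_smul]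
  · intro A₀
    obtain ⟨e, hx, hes, -, he⟩ := ξ.locally_trivial (ξ.proj a)
    have has : a ∈ e.source := e.mem_source.2 hx
    obtain ⟨U, hU, hAU, F, hF, hFa⟩ := ξ.smooth_actSO (ι A₀, a)
    have hj : ContMDiff 𝓘(ℝ, Mat k) (𝓘(ℝ, Mat n).prod (totalModel 𝔤 n)) ∞
        (fun M : Mat k => ((K M, a) : Mat n × ξ.E)) := hK.contMDiff.prodMk contMDiff_const
    have hVo := hU.preimage hj.continuous
    have hG := hF.comp hj.contMDiffOn (fun _ h => h)
    have hmem : ∀ A : SO k, ι A • a ∈ e.source := fun A => by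
      rw [e.mem_source, ξ.proj_actSO, ha]; exact hx
    refine ⟨_, hG.continuousOn.isOpen_inter_preimage hVo e.open_source, ⟨?_, ?_⟩,
      fun M => (e a).2⁻¹ * (e (F (K M, a))).2, ?_, ?_⟩
    · change (K A₀.mat, a) ∈ U
      rw [hKι]; exact hAU
    · change F (K A₀.mat, a) ∈ e.source
      rw [hKι, hFa (ι A₀, a) hAU]; exact hmem A₀
    · exact contMDiffOn_const.mul (contMDiff_snd.comp_contMDiffOn
        (hes.comp (hG.mono inter_subset_left) (fun _ h => h.2)))
    · rintro A ⟨hA, -⟩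
      change (K A.mat, a) ∈ U at hA
      rw [hKι] at hA
      change (e a).2⁻¹ * (e (F (K A.mat, a))).2 = ξ.diff a (ι A • a)
      rw [hKι, hFa (ι A, a) hA]
      change (e a).2⁻¹ * (e (ι A • a)).2 = _
      conv_lhs => rw [← hd A, he a has]
      group

/-- Through every point of a bundle which lies over a fixed point of a group `SO(k)` there is an
equivariant local section. -/
theorem NGBundle.exists_equivariant_section [CompleteSpace 𝔤] (ξ : NGBundle 𝔤 G n)
    {ι : SO k →* SO n} (hι : IsMatSmooth ι) (α : SmoothHom 𝔤 G k) (a : ξ.E)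
    (ha : ∀ A, ι A • a = MulOpposite.op (α.hom A) • a) :
    ∃ (D : Set (Sph n)) (s : Sph n → ξ.E), IsOpen D ∧ ξ.proj a ∈ D ∧
      ContMDiffOn (𝓡 n) (totalModel 𝔤 n) ∞ s D ∧ s (ξ.proj a) = a ∧
      (∀ x ∈ D, ξ.proj (s x) = x) ∧
      ∀ x ∈ D, ∀ A, rot (ι A) x ∈ D ∧ ι A • s x = MulOpposite.op (α.hom A) • s (rot (ι A) x) := by
  obtain ⟨K, hK, hKι⟩ := hι
  -- The twisted action z ↦ A z α(A)⁻¹ fixes `a`, and its invariant sections are the sections that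
  -- are equivariant with respect to `α`.
  have hT : SmoothFamily ξ (fun A z => ι A • MulOpposite.op (α.hom A)⁻¹ • z) := by
    rintro ⟨A₀, z₀⟩
    obtain ⟨U₁, hU₁, hm₁, F₁, hF₁, hFα⟩ := α.smooth A₀
    obtain ⟨U₂, hU₂, hm₂, F₂, hF₂, hFa⟩ :=
      ξ.smooth_actSO (ι A₀, MulOpposite.op (α.hom A₀)⁻¹ • z₀)
    have ho : IsOpen ((Prod.fst : Mat k × ξ.E → Mat k) ⁻¹' U₁) := hU₁.preimage continuous_fst
    have h1 : ContMDiffOn (𝓘(ℝ, Mat k).prod (totalModel 𝔤 n)) (totalModel 𝔤 n) ∞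
        (fun p : Mat k × ξ.E => MulOpposite.op (F₁ p.1)⁻¹ • p.2) (Prod.fst ⁻¹' U₁) :=
      fun p hp => ξ.contMDiffWithinAt_act contMDiffWithinAt_snd
        ((hF₁.comp contMDiffOn_fst (fun _ h => h)) p hp).inv
    have h2 : ContMDiffOn (𝓘(ℝ, Mat k).prod (totalModel 𝔤 n))
        (𝓘(ℝ, Mat n).prod (totalModel 𝔤 n)) ∞
        (fun p : Mat k × ξ.E => ((K p.1, MulOpposite.op (F₁ p.1)⁻¹ • p.2) : Mat n × ξ.E))
        (Prod.fst ⁻¹' U₁) :=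
      (hK.contMDiff.comp_contMDiffOn contMDiffOn_fst).prodMk h1
    refine ⟨_, h2.continuousOn.isOpen_inter_preimage ho hU₂, ⟨hm₁, ?_⟩, _,
      hF₂.comp (h2.mono (inter_subset_left (t := _ ⁻¹' U₂))) (fun _ h => h.2), ?_⟩
    · change (K A₀.mat, MulOpposite.op (F₁ A₀.mat)⁻¹ • z₀) ∈ U₂
      rw [hKι, hFα A₀ hm₁]; exact hm₂
    · rintro ⟨A, z⟩ ⟨hA, hA'⟩
      change (K A.mat, MulOpposite.op (F₁ A.mat)⁻¹ • z) ∈ U₂ at hA'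
      change F₂ (K A.mat, MulOpposite.op (F₁ A.mat)⁻¹ • z) = _
      rw [hKι, hFα A hA] at hA' ⊢
      exact hFa (ι A, _) hA'
  obtain ⟨D, s, h1, h2, h3, h4, h5, h6⟩ := ξ.exists_invariant_section hT (by simp)
    (fun A B z => by
      simp only [map_mul, mul_inv_rev, mul_smul, MulOpposite.op_mul, ξ.comm])
    (τ := fun A x => rot (ι A) x) (fun A z => by rw [ξ.proj_actSO, ξ.proj_actG]) (a := a)
    (fun A => by rw [ξ.comm, ha, ξ.act_act]; simp)
  refine ⟨D, s, h1, h2, h3, h4, h5, fun x hx A => ⟨(h6 x hx A).1, ?_⟩⟩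
  rw [← (h6 x hx A).2, ← ξ.comm, ξ.act_act]; simp

end Isotropy

/-! ### Rotations and reflections -/

section Reflections

open Matrix

variable {n : ℕ}

/-- The reflection `1 - c v vᵀ`. -/
def reflMat (c : ℝ) (v : Fin n → ℝ) : Matrix (Fin n) (Fin n) ℝ := 1 - c • vecMulVec v v

theorem reflMat_transpose (c : ℝ) (v : Fin n → ℝ) : (reflMat c v)ᵀ = reflMat c v := by
  simp [reflMat, transpose_vecMulVec]

/-- The normalization c |v|² = 2 is what makes the matrix the orthogonal reflection in the
hyperplane perpendicular to `v`. -/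
theorem reflMat_mul_self {c : ℝ} {v : Fin n → ℝ} (h : c * (v ⬝ᵥ v) = 2) :
    reflMat c v * reflMat c v = 1 := by
  have h2 : (c • vecMulVec v v) * (c • vecMulVec v v) = (2 : ℝ) • (c • vecMulVec v v) := by
    rw [smul_mul_smul_comm, vecMulVec_mul_vecMulVec, vecMulVec_smul, ← h]
    simp only [smul_smul]
    congr 1; ring
  simp only [reflMat, sub_mul, mul_sub, one_mul, mul_one, h2, two_smul]
  abel

theorem reflMat_det {c : ℝ} {v : Fin n → ℝ} (h : c * (v ⬝ᵥ v) = 2) : (reflMat c v).det = -1 := by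
  have : reflMat c v = 1 + replicateCol Unit (-c • v) * replicateRow Unit v := by
    rw [← vecMulVec_eq, reflMat, smul_vecMulVec, neg_smul, sub_eq_add_neg]
  rw [this, det_one_add_replicateCol_mul_replicateRow, dotProduct_smul, smul_eq_mul]
  linarith

theorem reflMat_mul_reflMat_mem {c d : ℝ} {v w : Fin n → ℝ} (h : c * (v ⬝ᵥ v) = 2)
    (h' : d * (w ⬝ᵥ w) = 2) :
    reflMat c v * reflMat d w ∈ specialOrthogonalGroup (Fin n) ℝ := by
  refine (mem_SO_iff _).2 ⟨?_, by rw [det_mul, reflMat_det h, reflMat_det h']; norm_num⟩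
  rw [transpose_mul, reflMat_transpose, reflMat_transpose, Matrix.mul_assoc,
    ← Matrix.mul_assoc (reflMat d w), reflMat_mul_self h', Matrix.one_mul, reflMat_mul_self h]

theorem reflMat_apply (c : ℝ) (v : Fin n → ℝ) (i j : Fin n) :
    reflMat c v i j = (1 : Matrix (Fin n) (Fin n) ℝ) i j - c * (v i * v j) := by
  simp [reflMat, vecMulVec_apply]

variable {m : ℕ}

/-- The last basis vector. -/
def lastVec (m : ℕ) : Fin (m + 1) → ℝ := Pi.single (Fin.last m) 1

theorem two_mul_lastVec : (2 : ℝ) * (lastVec m ⬝ᵥ lastVec m) = 2 := by simp [lastVec]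

theorem reflMat_lastVec_apply_last (i : Fin (m + 1)) :
    reflMat 2 (lastVec m) i (Fin.last m) = - lastVec m i := by
  rw [reflMat_apply]
  by_cases h : i = Fin.last m
  · subst h; simp [lastVec]; norm_num
  · simp [lastVec, h]

/-- For a unit vector `u ≠ -e`, the rotation with `e ↦ u`, where `e` is the last basis vector. -/
def rotTo (u : Fin (m + 1) → ℝ) : Matrix (Fin (m + 1)) (Fin (m + 1)) ℝ :=
  reflMat (1 + u (Fin.last m))⁻¹ (lastVec m + u) * reflMat 2 (lastVec m)

theorem rotTo_aux {u : Fin (m + 1) → ℝ} (hu : u ⬝ᵥ u = 1) (h : 1 + u (Fin.last m) ≠ 0) :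
    (1 + u (Fin.last m))⁻¹ * ((lastVec m + u) ⬝ᵥ (lastVec m + u)) = 2 := by
  have : (lastVec m + u) ⬝ᵥ (lastVec m + u) = 2 * (1 + u (Fin.last m)) := by
    simp only [dotProduct_add, add_dotProduct, hu]
    simp [lastVec]; ring
  rw [this]; field_simp

theorem rotTo_mem {u : Fin (m + 1) → ℝ} (hu : u ⬝ᵥ u = 1) (h : 1 + u (Fin.last m) ≠ 0) :
    rotTo u ∈ specialOrthogonalGroup (Fin (m + 1)) ℝ :=
  reflMat_mul_reflMat_mem (rotTo_aux hu h) two_mul_lastVec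

theorem mul_reflMat_lastVec_apply_last (B : Matrix (Fin (m + 1)) (Fin (m + 1)) ℝ)
    (i : Fin (m + 1)) : (B * reflMat 2 (lastVec m)) i (Fin.last m) = - B i (Fin.last m) := by
  rw [mul_apply]
  simp only [reflMat_lastVec_apply_last]
  simp [lastVec, Pi.single_apply]

/-- The first reflection sends the last basis vector e to -e; the second, in the hyperplane
perpendicular to e + u, exchanges e and -u, so e goes to u. -/
theorem rotTo_apply_last {u : Fin (m + 1) → ℝ} (h : 1 + u (Fin.last m) ≠ 0) (i : Fin (m + 1)) :
    rotTo u i (Fin.last m) = u i := by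
  rw [rotTo, mul_reflMat_lastVec_apply_last, reflMat_apply]
  by_cases hi : i = Fin.last m
  · subst hi
    simp [lastVec]; field_simp; ring
  · simp [lastVec, hi]; field_simp

/-- Only u = -e escapes `rotTo`. There the reflection of e is composed with a reflection along a
basis vector perpendicular to e, which exists because m ≥ 1. -/
theorem exists_SO_apply_last (hm : 1 ≤ m) {u : Fin (m + 1) → ℝ} (hu : u ⬝ᵥ u = 1) :
    ∃ A : SO (m + 1), ∀ i, A.1 i (Fin.last m) = u i := by
  by_cases h : 1 + u (Fin.last m) = 0
  · have h0 : (0 : Fin (m + 1)) ≠ Fin.last m := by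
      intro h'; have := congrArg Fin.val h'; simp at this; omega
    have hul : u = - lastVec m := by
      have hl : u (Fin.last m) = -1 := by linarith
      have hz : (u + lastVec m) ⬝ᵥ (u + lastVec m) = 0 := by
        simp only [dotProduct_add, add_dotProduct, hu]
        simp [lastVec, hl]
      exact eq_neg_of_add_eq_zero_left (dotProduct_self_eq_zero.1 hz)
    refine ⟨⟨reflMat 2 (Pi.single 0 1) * reflMat 2 (lastVec m),
      reflMat_mul_reflMat_mem (by simp) two_mul_lastVec⟩, fun i => ?_⟩
    simp only
    rw [mul_reflMat_lastVec_apply_last, reflMat_apply, hul]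
    simp [h0.symm, lastVec, Matrix.one_apply, Pi.single_apply]
  · exact ⟨⟨rotTo u, rotTo_mem hu h⟩, rotTo_apply_last h⟩

theorem blockOne_castSucc_castSucc (A : Matrix (Fin n) (Fin n) ℝ) (i j : Fin n) :
    blockOne A i.castSucc j.castSucc = A i j := by
  have hs : ∀ i : Fin n, (finSumFinEquiv.symm i.castSucc : Fin n ⊕ Fin 1) = Sum.inl i := fun i => by
    rw [Equiv.symm_apply_eq]; rfl
  simp [blockOne, hs]

theorem blockOne_last (A : Matrix (Fin n) (Fin n) ℝ) (i : Fin (n + 1)) :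
    blockOne A i (Fin.last n) = lastVec n i := by
  have hs : ∀ i : Fin n, (finSumFinEquiv.symm i.castSucc : Fin n ⊕ Fin 1) = Sum.inl i := fun i => by
    rw [Equiv.symm_apply_eq]; rfl
  have hl : (finSumFinEquiv.symm (Fin.last n) : Fin n ⊕ Fin 1) = Sum.inr 0 := by
    rw [Equiv.symm_apply_eq]; rfl
  refine Fin.lastCases ?_ (fun i => ?_) i
  · simp [blockOne, hl, lastVec]
  · simp [blockOne, hl, hs, lastVec]

theorem blockOne_last_left (A : Matrix (Fin n) (Fin n) ℝ) (i : Fin (n + 1)) :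
    blockOne A (Fin.last n) i = lastVec n i := by
  have hs : ∀ i : Fin n, (finSumFinEquiv.symm i.castSucc : Fin n ⊕ Fin 1) = Sum.inl i := fun i => by
    rw [Equiv.symm_apply_eq]; rfl
  have hl : (finSumFinEquiv.symm (Fin.last n) : Fin n ⊕ Fin 1) = Sum.inr 0 := by
    rw [Equiv.symm_apply_eq]; rfl
  refine Fin.lastCases ?_ (fun i => ?_) i
  · simp [blockOne, hl, lastVec]
  · simp [blockOne, hl, hs, lastVec]

/-- The rotations which fix the last basis vector form the subgroup `SO(m)`. -/
theorem exists_incl_eq {A : SO (m + 1)} (hA : ∀ i, A.1 i (Fin.last m) = lastVec m i) :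
    ∃ B : SO m, A = incl m B := by
  have hmul := ((mem_SO_iff A.1).1 A.2).1
  have hmul' : A.1ᵀ * A.1 = 1 := mul_eq_one_comm.1 hmul
  -- Orthogonality of the columns: since the last column is the basis vector, the last row is forced
  -- to be one too.
  have hrow : ∀ j, A.1 (Fin.last m) j = lastVec m j := fun j => by
    have h := congrFun (congrFun hmul' (j)) (Fin.last m)
    rw [mul_apply] at h
    simp only [transpose_apply, hA, lastVec, Pi.single_apply, mul_ite, mul_one, mul_zero,
      Finset.sum_ite_eq', Finset.mem_univ, if_true] at h
    rw [h, Matrix.one_apply]; simp [lastVec, Pi.single_apply]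
  set B : Matrix (Fin m) (Fin m) ℝ := fun i j => A.1 i.castSucc j.castSucc with hB
  have hAB : A.1 = blockOne B := by
    ext i j
    refine Fin.lastCases ?_ (fun i => ?_) i <;> refine Fin.lastCases ?_ (fun j => ?_) j
    · rw [hA, blockOne_last]
    · rw [hrow, blockOne_last_left]
    · rw [hA, blockOne_last]
    · rw [blockOne_castSucc_castSucc]
  have hinj : ∀ C D : Matrix (Fin m) (Fin m) ℝ, blockOne C = blockOne D → C = D := by
    intro C D h
    ext i j
    have := congrFun (congrFun h i.castSucc) j.castSucc
    simpa only [blockOne_castSucc_castSucc] using this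
  have htr : (blockOne B)ᵀ = blockOne Bᵀ := by simp [blockOne, fromBlocks_transpose]
  have hmem : B ∈ specialOrthogonalGroup (Fin m) ℝ := by
    refine (mem_SO_iff _).2 ⟨hinj _ _ ?_, ?_⟩
    · rw [blockOne_mul, ← htr, ← hAB, hmul, blockOne_one]
    · have h := ((mem_SO_iff A.1).1 A.2).2
      rw [hAB] at h
      simpa [blockOne] using h
  exact ⟨⟨B, hmem⟩, Subtype.ext hAB⟩

end Reflections

/-! ### The geometry of the action of `SO(m + 1)` on `S^{m + 1}` -/

section Sphere

open Matrix

variable {n m : ℕ}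

theorem rot_mul (A B : SO n) (x : Sph n) : rot (A * B) x = rot A (rot B x) := by
  apply Subtype.ext
  simp only [rot, map_mul, Submonoid.coe_mul, mulVec_mulVec]

theorem rot_one (x : Sph n) : rot (1 : SO n) x = x := by
  apply Subtype.ext
  simp only [rot, map_one, Submonoid.coe_one, one_mulVec]

theorem rot_inv_eq {A : SO n} {x y : Sph n} (h : rot A x = y) : rot A⁻¹ y = x := by
  rw [← h, ← rot_mul, inv_mul_cancel, rot_one]

theorem rot_apply_last (A : SO n) (x : Sph n) : (rot A x).1 (Fin.last n) = x.1 (Fin.last n) := by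
  change (blockOne A.1 *ᵥ x.1.ofLp) (Fin.last n) = _
  simp [mulVec, dotProduct, blockOne_last_left, lastVec, Pi.single_apply]

theorem rot_apply_castSucc (A : SO n) (x : Sph n) (i : Fin n) :
    (rot A x).1 i.castSucc = ∑ j, A.1 i j * x.1 j.castSucc := by
  change (blockOne A.1 *ᵥ x.1.ofLp) i.castSucc = _
  rw [mulVec, dotProduct, Fin.sum_univ_castSucc]
  simp [blockOne_castSucc_castSucc, blockOne_last, lastVec]

theorem Sph.sum_sq (x : Sph n) :
    ∑ i : Fin n, x.1 i.castSucc ^ 2 + x.1 (Fin.last n) ^ 2 = 1 := by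
  have h := x.2
  rw [mem_sphere_zero_iff_norm] at h
  have h2 := EuclideanSpace.norm_sq_eq x.1
  rw [h, Fin.sum_univ_castSucc] at h2
  simpa using h2.symm

theorem Sph.abs_last_le (x : Sph n) : -1 ≤ x.1 (Fin.last n) ∧ x.1 (Fin.last n) ≤ 1 := by
  have h := Sph.sum_sq x
  have h0 : 0 ≤ ∑ i : Fin n, x.1 i.castSucc ^ 2 := Finset.sum_nonneg fun _ _ => sq_nonneg _
  exact abs_le.1 ((sq_le_one_iff_abs_le_one _).1 (by linarith))

theorem Sph.ext_coord {x y : Sph n} (h : ∀ i : Fin n, x.1 i.castSucc = y.1 i.castSucc)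
    (h' : x.1 (Fin.last n) = y.1 (Fin.last n)) : x = y := by
  apply Subtype.ext
  ext i
  exact Fin.lastCases h' h i

theorem contMDiff_sph_coord (i : Fin (n + 1)) :
    ContMDiff (𝓡 n) 𝓘(ℝ, ℝ) ∞ (fun x : Sph n => x.1 i) :=
  haveI := Fact.mk (finrank_euclideanSpace_fin (𝕜 := ℝ) (n := n + 1))
  (EuclideanSpace.proj (𝕜 := ℝ) i).contDiff.contMDiff.comp contMDiff_coe_sphere

/-- The meridian vector `(0, …, 0, cos (π t / 2), sin (π t / 2))`. -/
def meridVec (m : ℕ) (t : ℝ) : EuclideanSpace ℝ (Fin (m + 1 + 1)) :=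
  EuclideanSpace.single (Fin.last m).castSucc (Real.cos (Real.pi / 2 * t)) +
    EuclideanSpace.single (Fin.last (m + 1)) (Real.sin (Real.pi / 2 * t))

theorem meridVec_castSucc (t : ℝ) (i : Fin (m + 1)) :
    meridVec m t i.castSucc = Real.cos (Real.pi / 2 * t) * lastVec m i := by
  simp [meridVec, lastVec, Pi.single_apply]

theorem meridVec_last (t : ℝ) :
    meridVec m t (Fin.last (m + 1)) = Real.sin (Real.pi / 2 * t) := by
  have : Fin.last (m + 1) ≠ (Fin.last m).castSucc := (Fin.castSucc_lt_last _).ne'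
  simp [meridVec, this]

theorem meridVec_mem (t : ℝ) : meridVec m t ∈ Metric.sphere (0 : EuclideanSpace ℝ (Fin (m + 1 + 1))) 1 := by
  rw [mem_sphere_zero_iff_norm, ← sq_eq_sq₀ (norm_nonneg _) zero_le_one, EuclideanSpace.norm_sq_eq,
    Fin.sum_univ_castSucc]
  simp only [meridVec_castSucc, meridVec_last]
  simp [lastVec, Pi.single_apply]

/-- The meridian from the south pole to the north pole. -/
def merid (m : ℕ) : ℝ → Sph (m + 1) := Set.codRestrict (meridVec m) _ meridVec_mem

theorem merid_castSucc (t : ℝ) (i : Fin (m + 1)) :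
    (merid m t).1 i.castSucc = Real.cos (Real.pi / 2 * t) * lastVec m i := meridVec_castSucc t i

theorem merid_last (t : ℝ) : (merid m t).1 (Fin.last (m + 1)) = Real.sin (Real.pi / 2 * t) :=
  meridVec_last t

theorem contMDiff_merid : ContMDiff 𝓘(ℝ, ℝ) (𝓡 (m + 1)) ∞ (merid m) := by
  have := Fact.mk (finrank_euclideanSpace_fin (𝕜 := ℝ) (n := m + 1 + 1))
  refine ContMDiff.codRestrict_sphere ?_ _
  refine ContDiff.contMDiff ?_
  rw [contDiff_euclidean]
  intro i
  refine Fin.lastCases ?_ (fun i => ?_) i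
  · simp only [meridVec_last]; fun_prop
  · simp only [meridVec_castSucc]; fun_prop

theorem rot_merid_castSucc (A : SO (m + 1)) (t : ℝ) (i : Fin (m + 1)) :
    (rot A (merid m t)).1 i.castSucc = Real.cos (Real.pi / 2 * t) * A.1 i (Fin.last m) := by
  rw [rot_apply_castSucc]
  simp [merid_castSucc, lastVec, Pi.single_apply, mul_comm]

theorem rot_incl_merid (B : SO m) (t : ℝ) : rot (incl m B) (merid m t) = merid m t := by
  refine Sph.ext_coord (fun i => ?_) (rot_apply_last _ _)
  rw [rot_merid_castSucc, merid_castSucc]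
  congr 1
  exact blockOne_last B.1 i

theorem merid_eq_pole {t : ℝ} (hc : Real.cos (Real.pi / 2 * t) = 0)
    {s : ℝ} (hs : |s| = 1) (h : Real.sin (Real.pi / 2 * t) = s) : merid m t = pole (m + 1) s hs := by
  refine Sph.ext_coord (fun i => ?_) ?_
  · rw [merid_castSucc, hc]
    simp [pole, (Fin.castSucc_lt_last i).ne]
  · rw [merid_last, h]; simp [pole]

theorem merid_one (hs : |(1 : ℝ)| = 1) : merid m 1 = pole (m + 1) 1 hs :=
  merid_eq_pole (by simp) hs (by simp)

theorem merid_neg_one (hs : |(-1 : ℝ)| = 1) : merid m (-1) = pole (m + 1) (-1) hs :=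
  merid_eq_pole (by simp) hs (by simp)

/-- The parameter on the meridian of the points with the same height. -/
def height (x : Sph (m + 1)) : ℝ := 2 / Real.pi * Real.arcsin (x.1 (Fin.last (m + 1)))

theorem pi_half_mul_height (x : Sph (m + 1)) :
    Real.pi / 2 * height x = Real.arcsin (x.1 (Fin.last (m + 1))) := by
  have := Real.pi_ne_zero
  rw [height]; field_simp

theorem height_mem (x : Sph (m + 1)) : height x ∈ Icc (-1 : ℝ) 1 := by
  have h1 := Real.neg_pi_div_two_le_arcsin (x.1 (Fin.last (m + 1)))
  have h2 := Real.arcsin_le_pi_div_two (x.1 (Fin.last (m + 1)))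
  rw [← pi_half_mul_height] at h1 h2
  have hp : 0 < Real.pi / 2 := by positivity
  constructor <;> nlinarith

theorem sin_height (x : Sph (m + 1)) :
    Real.sin (Real.pi / 2 * height x) = x.1 (Fin.last (m + 1)) := by
  rw [pi_half_mul_height, Real.sin_arcsin (Sph.abs_last_le x).1 (Sph.abs_last_le x).2]

theorem cos_height (x : Sph (m + 1)) :
    Real.cos (Real.pi / 2 * height x) = √(1 - x.1 (Fin.last (m + 1)) ^ 2) := by
  rw [pi_half_mul_height, Real.cos_arcsin]

theorem height_rot (A : SO (m + 1)) (x : Sph (m + 1)) : height (rot A x) = height x := by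
  rw [height, height, rot_apply_last]

theorem height_merid {t : ℝ} (ht : t ∈ Icc (-1 : ℝ) 1) : height (merid m t) = t := by
  have hp := Real.pi_pos
  rw [height, merid_last, Real.arcsin_sin (by nlinarith [ht.1]) (by nlinarith [ht.2])]
  field_simp

theorem cos_pos_of_mem {t : ℝ} (ht : t ∈ Ioo (-1 : ℝ) 1) : 0 < Real.cos (Real.pi / 2 * t) := by
  have hp := Real.pi_pos
  exact Real.cos_pos_of_mem_Ioo ⟨by nlinarith [ht.1], by nlinarith [ht.2]⟩

/-- Every point of the sphere is the image of a point of the meridian under a rotation. -/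
theorem exists_rot_merid (hm : 1 ≤ m) (x : Sph (m + 1)) :
    ∃ A : SO (m + 1), rot A (merid m (height x)) = x := by
  have hsum := Sph.sum_sq x
  set s := x.1 (Fin.last (m + 1)) with hs
  have hnn : 0 ≤ ∑ i : Fin (m + 1), x.1 i.castSucc ^ 2 := Finset.sum_nonneg fun _ _ => sq_nonneg _
  set q := √(1 - s ^ 2) with hq
  have hqq : q ^ 2 = 1 - s ^ 2 := Real.sq_sqrt (by linarith)
  -- `q` is the radius of the sphere of latitude through `x`. It vanishes exactly when `x` is a
  -- pole, and then `x` lies on the meridian; otherwise division by `q` gives a unit vector.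
  by_cases h0 : q = 0
  · refine ⟨1, ?_⟩
    rw [rot_one]
    refine Sph.ext_coord (fun i => ?_) ?_
    · rw [merid_castSucc, cos_height, ← hs, ← hq, h0, zero_mul]
      have hz : ∑ i : Fin (m + 1), x.1 i.castSucc ^ 2 = 0 := by rw [h0] at hqq; linarith
      exact (pow_eq_zero_iff two_ne_zero).1
        ((Finset.sum_eq_zero_iff_of_nonneg fun _ _ => sq_nonneg _).1 hz i (Finset.mem_univ _)) |>.symm
    · rw [merid_last, sin_height]
  · obtain ⟨A, hA⟩ := exists_SO_apply_last hm (u := fun i => x.1 i.castSucc / q) (by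
      simp only [dotProduct, ← sq, div_pow]
      rw [← Finset.sum_div, hqq, div_eq_one_iff_eq (by rw [← hqq]; positivity)]
      linarith)
    refine ⟨A, Sph.ext_coord (fun i => ?_) ?_⟩
    · rw [rot_merid_castSucc, hA, cos_height, ← hs, ← hq]
      field_simp
    · rw [rot_apply_last, merid_last, sin_height]

/-- Two rotations with the same value at a point of the meridian away from the poles differ by an
element of `SO(m)`. -/
theorem exists_incl_of_rot_merid_eq {A : SO (m + 1)} {t : ℝ} (ht : t ∈ Ioo (-1 : ℝ) 1)
    (h : rot A (merid m t) = merid m t) : ∃ B : SO m, A = incl m B := by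
  refine exists_incl_eq fun i => ?_
  have h1 := congrArg (fun x : Sph (m + 1) => x.1 i.castSucc) h
  simp only [rot_merid_castSucc, merid_castSucc] at h1
  exact mul_left_cancel₀ (cos_pos_of_mem ht).ne' h1

/-! ### Local sections of the action near the meridian -/

/-- The points of the sphere near the meridian, away from the poles. -/
def nearMerid (m : ℕ) : Set (Sph (m + 1)) := {x | 0 < x.1 (Fin.last m).castSucc}

theorem isOpen_nearMerid : IsOpen (nearMerid m) :=
  isOpen_lt continuous_const (contMDiff_sph_coord _).continuous

theorem merid_mem_nearMerid {t : ℝ} (ht : t ∈ Ioo (-1 : ℝ) 1) : merid m t ∈ nearMerid m := by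
  change 0 < (merid m t).1 (Fin.last m).castSucc
  rw [merid_castSucc]
  simpa [lastVec] using cos_pos_of_mem ht

theorem one_sub_sq_pos {x : Sph (m + 1)} (hx : x ∈ nearMerid m) :
    0 < 1 - x.1 (Fin.last (m + 1)) ^ 2 := by
  have h := Sph.sum_sq x
  have h1 : x.1 (Fin.last m).castSucc ^ 2 ≤ ∑ i : Fin (m + 1), x.1 i.castSucc ^ 2 :=
    Finset.single_le_sum (f := fun i : Fin (m + 1) => x.1 i.castSucc ^ 2)
      (fun _ _ => sq_nonneg _) (Finset.mem_univ _)
  have h2 : 0 < x.1 (Fin.last m).castSucc ^ 2 := pow_pos hx 2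
  linarith

/-- The longitude of a point away from the poles. -/
def longitude (x : Sph (m + 1)) : Fin (m + 1) → ℝ :=
  fun i => x.1 i.castSucc / √(1 - x.1 (Fin.last (m + 1)) ^ 2)

theorem longitude_sq {x : Sph (m + 1)} (hx : x ∈ nearMerid m) :
    longitude x ⬝ᵥ longitude x = 1 := by
  have h := one_sub_sq_pos hx
  simp only [longitude, dotProduct, ← sq, div_pow]
  rw [← Finset.sum_div, Real.sq_sqrt h.le, div_eq_one_iff_eq h.ne']
  linarith [Sph.sum_sq x]

theorem longitude_last_pos {x : Sph (m + 1)} (hx : x ∈ nearMerid m) :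
    0 < longitude x (Fin.last m) := div_pos hx (Real.sqrt_pos.2 (one_sub_sq_pos hx))

open Classical in
/-- A rotation which takes the meridian to the meridian of the given point. -/
def meridRot (x : Sph (m + 1)) : SO (m + 1) :=
  if h : x ∈ nearMerid m then
    ⟨rotTo (longitude x), rotTo_mem (longitude_sq h) (by linarith [longitude_last_pos h])⟩ else 1

theorem rot_meridRot {x : Sph (m + 1)} (hx : x ∈ nearMerid m) :
    rot (meridRot x) (merid m (height x)) = x := by
  have hp := Real.sqrt_pos.2 (one_sub_sq_pos hx)
  refine Sph.ext_coord (fun i => ?_) ?_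
  · rw [rot_merid_castSucc, meridRot, dif_pos hx, cos_height]
    simp only
    rw [rotTo_apply_last (by linarith [longitude_last_pos hx]), longitude]
    field_simp
  · rw [rot_apply_last, merid_last, sin_height]

theorem height_mem_Ioo {x : Sph (m + 1)} (hx : x ∈ nearMerid m) : height x ∈ Ioo (-1 : ℝ) 1 := by
  have h := one_sub_sq_pos hx
  have hc := cos_height x
  have hp := Real.sqrt_pos.2 h
  refine ⟨lt_of_le_of_ne (height_mem x).1 fun h' => ?_, lt_of_le_of_ne (height_mem x).2 fun h' => ?_⟩
  · rw [← h'] at hc; simp at hc; linarith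
  · rw [h'] at hc; simp at hc; linarith

/-- The arcsine is smooth only inside (-1, 1), so the poles must be excluded; this is why smoothness
there needs the radial lifts below. -/
theorem contMDiffOn_height : ContMDiffOn (𝓡 (m + 1)) 𝓘(ℝ, ℝ) ∞ height (nearMerid m) := by
  intro x hx
  have h := one_sub_sq_pos hx
  have h1 : ContDiffAt ℝ ∞ (fun s : ℝ => 2 / Real.pi * Real.arcsin s) (x.1 (Fin.last (m + 1))) := by
    refine contDiffAt_const.mul (Real.contDiffAt_arcsin ?_ ?_) <;> intro h' <;> rw [h'] at h <;>
      norm_num at h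
  exact (h1.contMDiffAt.comp x (contMDiff_sph_coord _ x)).contMDiffWithinAt

/-- On `nearMerid` the last coordinate of the longitude is positive, so the denominator 1 + u in
`rotTo` does not vanish. -/
theorem contMDiffOn_meridRot :
    ContMDiffOn (𝓡 (m + 1)) 𝓘(ℝ, Mat (m + 1)) ∞ (fun x => (meridRot x).mat) (nearMerid m) := by
  have h1 : ContMDiffOn (𝓡 (m + 1)) 𝓘(ℝ, Fin (m + 1) → ℝ) ∞ (longitude (m := m)) (nearMerid m) := by
    refine contMDiffOn_pi_space.2 fun i x hx => ?_
    have hp := one_sub_sq_pos hx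
    have h2 : ContDiffAt ℝ ∞ (fun p : ℝ × ℝ => p.1 / √(1 - p.2 ^ 2))
        (x.1 i.castSucc, x.1 (Fin.last (m + 1))) := by
      refine contDiffAt_fst.div (ContDiffAt.sqrt (by fun_prop) hp.ne') (Real.sqrt_pos.2 hp).ne'
    have h3 : ContMDiffAt (𝓡 (m + 1)) 𝓘(ℝ, ℝ × ℝ) ∞
        (fun x : Sph (m + 1) => (x.1 i.castSucc, x.1 (Fin.last (m + 1)))) x :=
      (contMDiff_sph_coord _ x).prodMk_space (contMDiff_sph_coord _ x)
    exact (h2.contMDiffAt.comp x h3).contMDiffWithinAt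
  have h4 : ContDiffOn ℝ ∞ (fun u : Fin (m + 1) → ℝ => (fun i j => rotTo u i j : Mat (m + 1)))
      {u | 0 < u (Fin.last m)} := by
    refine contDiffOn_pi.2 fun i => contDiffOn_pi.2 fun j => ?_
    simp only [rotTo, mul_apply, reflMat_apply, Pi.add_apply]
    refine ContDiffOn.sum fun l _ => ContDiffOn.mul (contDiffOn_const.sub (ContDiffOn.mul
      (ContDiffOn.inv (by fun_prop) fun u hu => ?_) (by fun_prop))) contDiffOn_const
    have : 0 < u (Fin.last m) := hu
    linarith
  refine (h4.contMDiffOn.comp h1 fun x hx => longitude_last_pos hx).congr fun x hx => ?_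
  rw [meridRot, dif_pos hx]
  rfl

end Sphere

/-! ### Lifts of the meridian -/

section Lifts

variable {𝔤 : Type v} [NormedAddCommGroup 𝔤] [NormedSpace ℝ 𝔤]
  {G : Type u} [TopologicalSpace G] [ChartedSpace 𝔤 G] [Group G] {n m : ℕ}

theorem NGBundle.smul_act_eq (ξ : NGBundle 𝔤 G n) {a : ξ.E} {A : SO n} {h : G}
    (ha : A • a = MulOpposite.op h • a) (k : G) :
    A • MulOpposite.op k • a = MulOpposite.op (k⁻¹ * h * k) • MulOpposite.op k • a := by
  rw [ξ.comm, ha, ξ.act_act, ξ.act_act]; congr 2; group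

theorem NGBundle.isotropy_act_unique (ξ : NGBundle 𝔤 G n) {a : ξ.E} {A : SO n} {h h' k : G}
    (ha : A • a = MulOpposite.op h • a)
    (hb : A • MulOpposite.op k • a = MulOpposite.op h' • MulOpposite.op k • a) :
    h' = k⁻¹ * h * k :=
  ξ.act_injective _ (hb.symm.trans (ξ.smul_act_eq ha k))

/-- Translating a point by `k` conjugates its isotropy by `k⁻¹`. If the isotropy is `γ` before and
after, then `k` commutes with the image of `γ`; this is how the centralizer enters the
classification. -/
theorem NGBundle.diff_mem_Z (ξ : NGBundle 𝔤 G n) {γ : SmoothHom 𝔤 G m} {ι : SO m → SO n} {a b : ξ.E}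
    (hab : ξ.proj a = ξ.proj b) (ha : ∀ A, ι A • a = MulOpposite.op (γ.hom A) • a)
    (hb : ∀ A, ι A • b = MulOpposite.op (γ.hom A) • b) : ξ.diff a b ∈ Z γ := by
  refine Subgroup.mem_centralizer_iff.2 ?_
  rintro _ ⟨A, rfl⟩
  have h := hb A
  rw [← ξ.act_diff hab] at h
  have h1 := ξ.isotropy_act_unique (ha A) h
  rw [mul_assoc, eq_inv_mul_iff_mul_eq] at h1
  exact h1.symm

theorem conj_eq_of_mem_Z {γ : SmoothHom 𝔤 G m} {g : G} (hg : g ∈ Z γ) (A : SO m) :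
    g⁻¹ * γ.hom A * g = γ.hom A := by
  have := Subgroup.mem_centralizer_iff.1 hg _ ⟨A, rfl⟩
  rw [mul_assoc, this]; group

/-- A smooth lift of the meridian, defined on `S`, on which `SO(m)` acts through `γ`. -/
structure IsLiftOn (ξ : NGBundle 𝔤 G (m + 1)) (γ : SmoothHom 𝔤 G m) (z : ℝ → ξ.E) (S : Set ℝ) :
    Prop where
  smooth : ContMDiffOn 𝓘(ℝ, ℝ) (totalModel 𝔤 (m + 1)) ∞ z S
  proj : ∀ t ∈ S, ξ.proj (z t) = merid m t
  equiv : ∀ t ∈ S, ∀ A, incl m A • z t = MulOpposite.op (γ.hom A) • z t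

variable {ξ : NGBundle 𝔤 G (m + 1)} {γ : SmoothHom 𝔤 G m} {z w : ℝ → ξ.E} {S : Set ℝ}

theorem IsLiftOn.mono {S' : Set ℝ} (h : IsLiftOn ξ γ z S) (hS : S' ⊆ S) : IsLiftOn ξ γ z S' :=
  ⟨h.smooth.mono hS, fun t ht => h.proj t (hS ht), fun t ht => h.equiv t (hS ht)⟩

theorem IsLiftOn.act (h : IsLiftOn ξ γ z S) {g : ℝ → G} (hg : ContMDiffOn 𝓘(ℝ, ℝ) 𝓘(ℝ, 𝔤) ∞ g S)
    (hgZ : ∀ t ∈ S, g t ∈ Z γ) : IsLiftOn ξ γ (fun t => MulOpposite.op (g t) • z t) S where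
  smooth t ht := ξ.contMDiffWithinAt_act (h.smooth t ht) (hg t ht)
  proj t ht := by rw [ξ.proj_actG, h.proj t ht]
  equiv t ht A := by rw [ξ.smul_act_eq (h.equiv t ht A), conj_eq_of_mem_Z (hgZ t ht)]

/-- A lift for any homomorphism can be translated to a lift for `γ` which passes through a given
point. -/
theorem IsLiftOn.act_const [IsManifold 𝓘(ℝ, 𝔤) ∞ G] {γ' : SmoothHom 𝔤 G m}
    (h : IsLiftOn ξ γ' w S) {t₁ : ℝ}
    (ht₁ : t₁ ∈ S) {b : ξ.E} (hb : ξ.proj b = merid m t₁)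
    (hbγ : ∀ A, incl m A • b = MulOpposite.op (γ.hom A) • b) :
    IsLiftOn ξ γ (fun t => MulOpposite.op (ξ.diff (w t₁) b) • w t) S where
  smooth t ht := ξ.contMDiffWithinAt_act (h.smooth t ht) contMDiffWithinAt_const
  proj t ht := by rw [ξ.proj_actG, h.proj t ht]
  equiv t ht A := by
    have hp : ξ.proj (w t₁) = ξ.proj b := by rw [h.proj t₁ ht₁, hb]
    have hA := hbγ A
    rw [← ξ.act_diff hp] at hA
    rw [ξ.smul_act_eq (h.equiv t ht A), ← ξ.isotropy_act_unique (h.equiv t₁ ht₁ A) hA]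

variable [LieGroup 𝓘(ℝ, 𝔤) ∞ G]

theorem IsLiftOn.contMDiffOn_diff {γ' : SmoothHom 𝔤 G m} (hz : IsLiftOn ξ γ z S)
    (hw : IsLiftOn ξ γ' w S) :
    ContMDiffOn 𝓘(ℝ, ℝ) 𝓘(ℝ, 𝔤) ∞ (fun t => ξ.diff (z t) (w t)) S := fun t ht =>
  ξ.contMDiffWithinAt_diff (hz.smooth t ht) (hw.smooth t ht)
    (fun s hs => by rw [hz.proj s hs, hw.proj s hs]) ht

/-- A smooth function which is the identity for `t ≤ p` and has the value `b` for `q ≤ t`. -/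
def stopAt (p q b t : ℝ) : ℝ := t + (b - t) * Real.smoothTransition ((t - p) / (q - p))

theorem contDiff_stopAt (p q b : ℝ) : ContDiff ℝ ∞ (stopAt p q b) := by
  have h : ContDiff ℝ ∞ (fun t : ℝ => Real.smoothTransition ((t - p) / (q - p))) :=
    Real.smoothTransition.contDiff.comp (by fun_prop)
  exact contDiff_id.add ((contDiff_const.sub contDiff_id).mul h)

theorem stopAt_of_le {p q b t : ℝ} (hpq : p < q) (ht : t ≤ p) : stopAt p q b t = t := by
  rw [stopAt, Real.smoothTransition.zero_of_nonpos
    (div_nonpos_of_nonpos_of_nonneg (by linarith) (by linarith))]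
  ring

theorem stopAt_of_ge {p q b t : ℝ} (hpq : p < q) (ht : q ≤ t) : stopAt p q b t = b := by
  rw [stopAt, Real.smoothTransition.one_of_one_le ((one_le_div (by linarith)).2 (by linarith))]
  ring

theorem stopAt_mem {p q b t : ℝ} (hpq : p < q) (hqb : q ≤ b) {a : ℝ} (ha : a ≤ t) (hab : a ≤ b) :
    stopAt p q b t ∈ Icc a b := by
  rcases le_total q t with h | h
  · rw [stopAt_of_ge hpq h]; exact ⟨hab, le_rfl⟩
  · have h0 := Real.smoothTransition.nonneg ((t - p) / (q - p))
    have h1 := Real.smoothTransition.le_one ((t - p) / (q - p))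
    have hbt : 0 ≤ b - t := by linarith
    constructor
    · rw [stopAt]; nlinarith
    · rw [stopAt]; nlinarith

/-- Two overlapping lifts can be joined after a translation of the second. -/
theorem IsLiftOn.exists_join {l a b d : ℝ} (hla : l ≤ a) (hab : a < b) (hbd : b ≤ d)
    (hz : IsLiftOn ξ γ z (Icc l b)) (hw : IsLiftOn ξ γ w (Icc a d)) :
    ∃ z' : ℝ → ξ.E, IsLiftOn ξ γ z' (Icc l d) ∧ (∃ a' > a, EqOn z' z (Icc l a')) ∧
      ∃ k ∈ Z γ, ∀ t ∈ Icc b d, z' t = MulOpposite.op k • w t := by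
  -- `p` and `q` divide the overlap [a, b] into thirds. There z = w · g with g in `Z γ`.
  -- Precomposing g with `stopAt p q b` leaves it unchanged up to `p` and holds it at `g b` from `q`
  -- on, so the modified translate of `w` continues `z` and ends as a constant translate of `w`.
  set p := (2 * a + b) / 3 with hp
  set q := (a + 2 * b) / 3 with hq
  have hpq : p < q := by linarith
  have hap : a < p := by linarith
  have hqb : q < b := by linarith
  set g : ℝ → G := fun t => ξ.diff (w t) (z t) with hg
  have hz' : IsLiftOn ξ γ z (Icc a b) := hz.mono (Icc_subset_Icc_left hla)
  have hw' : IsLiftOn ξ γ w (Icc a b) := hw.mono (Icc_subset_Icc_right hbd)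
  have hgs : ContMDiffOn 𝓘(ℝ, ℝ) 𝓘(ℝ, 𝔤) ∞ g (Icc a b) := hw'.contMDiffOn_diff hz'
  have hgZ : ∀ t ∈ Icc a b, g t ∈ Z γ := fun t ht =>
    ξ.diff_mem_Z (by rw [hw'.proj t ht, hz'.proj t ht]) (hw'.equiv t ht) (hz'.equiv t ht)
  have hmaps : ∀ t ∈ Icc a d, stopAt p q b t ∈ Icc a b := fun t ht =>
    stopAt_mem hpq hqb.le ht.1 hab.le
  have hv : IsLiftOn ξ γ (fun t => MulOpposite.op (g (stopAt p q b t)) • w t) (Icc a d) :=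
    hw.act (hgs.comp (contDiff_stopAt p q b).contMDiff.contMDiffOn hmaps)
      fun t ht => hgZ _ (hmaps t ht)
  have heq : ∀ t ∈ Icc a p, MulOpposite.op (g (stopAt p q b t)) • w t = z t := fun t ht => by
    have htb : t ∈ Icc a b := ⟨ht.1, by linarith [ht.2]⟩
    rw [stopAt_of_le hpq ht.2]
    exact ξ.act_diff (by rw [hw'.proj t htb, hz'.proj t htb])
  set z' : ℝ → ξ.E := fun t => if t ≤ p then z t else MulOpposite.op (g (stopAt p q b t)) • w t
    with hz'def
  have e1 : ∀ t, t ≤ p → z' t = z t := fun t ht => if_pos ht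
  have e2 : ∀ t, a ≤ t → z' t = MulOpposite.op (g (stopAt p q b t)) • w t := fun t ht => by
    by_cases h : t ≤ p
    · rw [e1 t h, heq t ⟨ht, h⟩]
    · exact if_neg h
  refine ⟨z', ⟨fun t ht => ?_, fun t ht => ?_, fun t ht => ?_⟩, ⟨p, hap, fun t ht => e1 t ht.2⟩,
    g b, hgZ b ⟨hab.le, le_rfl⟩, fun t ht => ?_⟩
  · rcases lt_or_ge t p with h | h
    · have h1 : ContMDiffWithinAt 𝓘(ℝ, ℝ) (totalModel 𝔤 (m + 1)) ∞ z (Icc l d) t := by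
        refine (hz.smooth t ⟨ht.1, by linarith⟩).mono_of_mem_nhdsWithin ?_
        filter_upwards [self_mem_nhdsWithin, mem_nhdsWithin_of_mem_nhds (Iio_mem_nhds h)]
          with s hs hs' using ⟨hs.1, by linarith [show s < p from hs']⟩
      refine h1.congr_of_eventuallyEq ?_ (e1 t h.le)
      filter_upwards [mem_nhdsWithin_of_mem_nhds (Iio_mem_nhds h)] with s hs
        using e1 s (le_of_lt hs)
    · have hat : a < t := by linarith
      have h1 := (hv.smooth t ⟨hat.le, ht.2⟩).mono_of_mem_nhdsWithin (t := Icc l d) (by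
        filter_upwards [self_mem_nhdsWithin, mem_nhdsWithin_of_mem_nhds (Ioi_mem_nhds hat)]
          with s hs hs' using ⟨le_of_lt hs', hs.2⟩)
      refine h1.congr_of_eventuallyEq ?_ (e2 t hat.le)
      filter_upwards [mem_nhdsWithin_of_mem_nhds (Ioi_mem_nhds hat)] with s hs
        using e2 s (le_of_lt hs)
  · rcases le_total t p with h | h
    · rw [e1 t h, hz.proj t ⟨ht.1, by linarith⟩]
    · rw [e2 t (by linarith)]; exact hv.proj t ⟨by linarith, ht.2⟩
  · rcases le_total t p with h | h
    · rw [e1 t h]; exact hz.equiv t ⟨ht.1, by linarith⟩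
    · rw [e2 t (by linarith)]; exact hv.equiv t ⟨by linarith, ht.2⟩
  · rw [e2 t (by linarith [ht.1]), stopAt_of_ge hpq (by linarith [ht.1])]

variable [CompleteSpace 𝔤]

/-- An equivariant local section is restricted to the meridian, which SO(m) fixes pointwise. The
homomorphism `γ'` depends on the chosen point; `IsLiftOn.act_const` later replaces it by `γ`. -/
theorem NGBundle.exists_local_lift (ξ : NGBundle 𝔤 G (m + 1)) (t₀ : ℝ) :
    ∃ (ε : ℝ) (γ' : SmoothHom 𝔤 G m) (w : ℝ → ξ.E), 0 < ε ∧
      IsLiftOn ξ γ' w (Ioo (t₀ - ε) (t₀ + ε)) := by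
  obtain ⟨a, ha⟩ := ξ.exists_fibre (merid m t₀)
  obtain ⟨γ', hγ'⟩ := ξ.exists_isotropyHom (isMatSmooth_incl m) a
    (fun A => by rw [ha, rot_incl_merid])
  obtain ⟨D, s, hD, haD, hs, -, hps, hsA⟩ := ξ.exists_equivariant_section (isMatSmooth_incl m) γ' a hγ'
  rw [ha] at haD
  obtain ⟨ε, hε, hball⟩ := Metric.isOpen_iff.1 (hD.preimage contMDiff_merid.continuous) t₀ haD
  rw [Real.ball_eq_Ioo] at hball
  refine ⟨ε, γ', fun t => s (merid m t), hε, ⟨hs.comp contMDiff_merid.contMDiffOn hball,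
    fun t ht => hps _ (hball ht), fun t ht A => ?_⟩⟩
  rw [(hsA _ (hball ht) A).2, rot_incl_merid]

/-- A lift near the south pole extends to the whole meridian. -/
theorem IsLiftOn.exists_extension {z₀ : ℝ → ξ.E} {b₀ : ℝ} (hb₀ : -1 < b₀) (hb₁ : b₀ ≤ 1)
    (hz₀ : IsLiftOn ξ γ z₀ (Icc (-1) b₀)) :
    ∃ z, IsLiftOn ξ γ z (Icc (-1) 1) ∧ ∃ a > -1, EqOn z z₀ (Icc (-1) a) := by
  set P : ℝ → Prop := fun t => ∃ z, IsLiftOn ξ γ z (Icc (-1) t) ∧ ∃ a > -1, EqOn z z₀ (Icc (-1) a)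
    with hP
  have hmono : ∀ t t', t' ≤ t → P t → P t' := by
    rintro t t' h ⟨z, hz, ha⟩
    exact ⟨z, hz.mono (Icc_subset_Icc_right h), ha⟩
  -- The length `ε` depends on `t₀` alone, so a lift reaching any point just below the supremum `T`
  -- can be carried past `T`.
  have hstep : ∀ t₀, ∃ ε > 0, ∀ t₁, b₀ ≤ t₁ → t₀ - ε < t₁ → t₁ ≤ t₀ → P t₁ → P (t₀ + ε) := by
    intro t₀
    obtain ⟨ε, γ', w, hε, hw⟩ := ξ.exists_local_lift t₀
    refine ⟨ε / 2, by linarith, ?_⟩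
    rintro t₁ h1 h2 h3 ⟨z, hz, a₀, ha₀, hza⟩
    -- The join takes place on [a, t₁], inside the domain of the local lift and to the right of -1,
    -- so nothing changes near the south pole.
    obtain ⟨a, haa, hab⟩ := exists_between (max_lt (show -1 < t₁ by linarith) h2)
    have ha1 : -1 < a := lt_of_le_of_lt (le_max_left _ _) haa
    have ha2 : t₀ - ε / 2 < a := lt_of_le_of_lt (le_max_right _ _) haa
    have ht₁ : t₁ ∈ Icc (-1 : ℝ) t₁ := ⟨by linarith, le_rfl⟩
    have hw' := hw.act_const (t₁ := t₁) ⟨by linarith, by linarith⟩ (hz.proj t₁ ht₁)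
      (hz.equiv t₁ ht₁)
    obtain ⟨z', hz', ⟨a', ha', hzz⟩, -⟩ := hz.exists_join (d := t₀ + ε / 2) ha1.le hab
      (by linarith) (hw'.mono fun t ht => ⟨by linarith [ht.1], by linarith [ht.2]⟩)
    refine ⟨z', hz', min a' a₀, lt_min (by linarith) ha₀, fun t ht => ?_⟩
    rw [hzz ⟨ht.1, ht.2.trans (min_le_left _ _)⟩, hza ⟨ht.1, ht.2.trans (min_le_right _ _)⟩]
  set T := sSup {t | t ∈ Icc b₀ 1 ∧ P t} with hT
  have hbdd : BddAbove {t | t ∈ Icc b₀ 1 ∧ P t} := ⟨1, fun t ht => ht.1.2⟩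
  have hmem : b₀ ∈ {t | t ∈ Icc b₀ 1 ∧ P t} :=
    ⟨⟨le_rfl, hb₁⟩, z₀, hz₀, b₀, hb₀, fun _ _ => rfl⟩
  obtain ⟨ε, hε, hPε⟩ := hstep T
  obtain ⟨t₁, ht₁, hlt⟩ := exists_lt_of_lt_csSup ⟨b₀, hmem⟩ (show T - ε < T by linarith)
  have hPT := hPε t₁ ht₁.1.1 hlt (le_csSup hbdd ht₁) ht₁.2
  have h1T : 1 ≤ T + ε := by
    by_contra! hcon
    have hb : b₀ ≤ T := le_csSup hbdd hmem
    have : T + ε ≤ T := le_csSup hbdd ⟨⟨by linarith, hcon.le⟩, hPT⟩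
    linarith
  exact hmono _ _ h1T hPT

/-! ### Lifts which are radial near the poles -/

/-- The restriction of the lift `z` to `S` extends to an equivariant section over a neighbourhood
of the meridian points with parameter in `S`, with isotropy representation `α`. -/
def IsRadialOn (ξ : NGBundle 𝔤 G (m + 1)) (α : SmoothHom 𝔤 G (m + 1)) (z : ℝ → ξ.E)
    (S : Set ℝ) : Prop :=
  ∃ (D : Set (Sph (m + 1))) (s : Sph (m + 1) → ξ.E), IsOpen D ∧
    ContMDiffOn (𝓡 (m + 1)) (totalModel 𝔤 (m + 1)) ∞ s D ∧ (∀ x ∈ D, ξ.proj (s x) = x) ∧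
    (∀ x ∈ D, ∀ A, rot A x ∈ D ∧ A • s x = MulOpposite.op (α.hom A) • s (rot A x)) ∧
    ∀ t ∈ S, merid m t ∈ D ∧ z t = s (merid m t)

omit [LieGroup 𝓘(ℝ, 𝔤) ∞ G] [CompleteSpace 𝔤] in
theorem IsRadialOn.act [IsManifold 𝓘(ℝ, 𝔤) ∞ G] {α α' : SmoothHom 𝔤 G (m + 1)} {z' : ℝ → ξ.E}
    (h : IsRadialOn ξ α z S) (k : G)
    (hα : ∀ A, α'.hom A = k⁻¹ * α.hom A * k) {S' : Set ℝ} (hS' : S' ⊆ S)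
    (hz' : ∀ t ∈ S', z' t = MulOpposite.op k • z t) :
    IsRadialOn ξ α' z' S' := by
  obtain ⟨D, s, h1, h2, h3, h4, h5⟩ := h
  refine ⟨D, fun x => MulOpposite.op k • s x, h1,
    (ξ.contMDiff_act k).comp_contMDiffOn h2, fun x hx => by rw [ξ.proj_actG, h3 x hx],
    fun x hx A => ⟨(h4 x hx A).1, ?_⟩, fun t ht => ⟨(h5 t (hS' ht)).1, ?_⟩⟩
  · rw [ξ.comm, (h4 x hx A).2, ξ.act_act, ξ.act_act, hα]; congr 2; group
  · rw [hz' t ht, (h5 t (hS' ht)).2]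

/-- A lift of the meridian with isotropy representations `α` and `β` at the poles. -/
structure IsLiftWith (ξ : NGBundle 𝔤 G (m + 1)) (γ : SmoothHom 𝔤 G m)
    (α β : SmoothHom 𝔤 G (m + 1)) (z : ℝ → ξ.E) : Prop where
  lift : IsLiftOn ξ γ z (Icc (-1) 1)
  south : ∀ A, A • z (-1) = MulOpposite.op (α.hom A) • z (-1)
  north : ∀ A, A • z 1 = MulOpposite.op (β.hom A) • z 1

/-- A lift of the meridian which is radial near the poles. -/
structure IsRadialLift (ξ : NGBundle 𝔤 G (m + 1)) (γ : SmoothHom 𝔤 G m)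
    (α β : SmoothHom 𝔤 G (m + 1)) (z : ℝ → ξ.E) : Prop extends IsLiftWith ξ γ α β z where
  radial_south : ∃ a > -1, IsRadialOn ξ α z (Icc (-1) a)
  radial_north : ∃ b < 1, IsRadialOn ξ β z (Icc b 1)

omit [LieGroup 𝓘(ℝ, 𝔤) ∞ G] [CompleteSpace 𝔤] in
theorem rot_merid_one (A : SO (m + 1)) : rot A (merid m 1) = merid m 1 := by
  rw [merid_one (by simp), rot_pole]

omit [LieGroup 𝓘(ℝ, 𝔤) ∞ G] [CompleteSpace 𝔤] in
theorem rot_merid_neg_one (A : SO (m + 1)) : rot A (merid m (-1)) = merid m (-1) := by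
  rw [merid_neg_one (by simp), rot_pole]

/-- The equivariant section through a point over a pole. -/
theorem NGBundle.exists_radial (ξ : NGBundle 𝔤 G (m + 1)) (α : SmoothHom 𝔤 G (m + 1)) {t₀ : ℝ}
    {a : ξ.E} (ha : ξ.proj a = merid m t₀) (hα : ∀ A : SO (m + 1), A • a = MulOpposite.op (α.hom A) • a) :
    ∃ (ε : ℝ) (w : ℝ → ξ.E), 0 < ε ∧ w t₀ = a ∧
      IsRadialOn ξ α w (Ioo (t₀ - ε) (t₀ + ε)) ∧
      IsLiftOn ξ α.restrict w (Ioo (t₀ - ε) (t₀ + ε)) := by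
  obtain ⟨D, s, hD, haD, hs, hsa, hps, hsA⟩ := ξ.exists_equivariant_section isMatSmooth_id α a hα
  rw [ha] at haD hsa
  obtain ⟨ε, hε, hball⟩ := Metric.isOpen_iff.1 (hD.preimage contMDiff_merid.continuous) t₀ haD
  rw [Real.ball_eq_Ioo] at hball
  refine ⟨ε, fun t => s (merid m t), hε, hsa, ⟨D, s, hD, hs, hps, hsA, fun t ht =>
    ⟨hball ht, rfl⟩⟩, ⟨hs.comp contMDiff_merid.contMDiffOn hball,
    fun t ht => hps _ (hball ht), fun t ht A => ?_⟩⟩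
  have h := (hsA _ (hball ht) (incl m A)).2
  rw [MonoidHom.id_apply, rot_incl_merid] at h
  exact h

/-- Starting from the equivariant section at the south pole, the lift is extended to the north pole,
and near its end it is joined to an equivariant section through its endpoint. The join translates
that section by some `k` in `Z γ`, where γ is the restriction of `α`; radiality survives with `β`
the conjugate of `β₀` by `k⁻¹`. -/
theorem NGBundle.exists_radialLift (ξ : NGBundle 𝔤 G (m + 1)) (α : SmoothHom 𝔤 G (m + 1))
    {a : ξ.E} (ha : ξ.proj a = merid m (-1)) (hα : ∀ A : SO (m + 1), A • a = MulOpposite.op (α.hom A) • a) :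
    ∃ (β : SmoothHom 𝔤 G (m + 1)) (z : ℝ → ξ.E), β.restrict = α.restrict ∧
      IsRadialLift ξ α.restrict α β z := by
  obtain ⟨ε, z₀, hε, hz₀a, hz₀r, hz₀⟩ := ξ.exists_radial α ha hα
  set b₀ := min (-1 + ε / 2) 1 with hb₀
  have hb₀1 : -1 < b₀ := lt_min (by linarith) (by norm_num)
  obtain ⟨z₁, hz₁, a₁, ha₁, hz₁e⟩ := (hz₀.mono (S' := Icc (-1) b₀) fun t ht =>
    ⟨by linarith [ht.1], by linarith [ht.2.trans (min_le_left _ _)]⟩).exists_extension hb₀1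
      (min_le_right _ _)
  have h1mem : (1 : ℝ) ∈ Icc (-1 : ℝ) 1 := by norm_num
  obtain ⟨β₀, hβ₀⟩ := ξ.exists_isotropyHom isMatSmooth_id (z₁ 1)
    (fun A => by rw [hz₁.proj 1 h1mem]; exact rot_merid_one A)
  obtain ⟨δ, w, hδ, hw1, hwr, hw⟩ := ξ.exists_radial β₀ (hz₁.proj 1 h1mem) hβ₀
  have hβγ : β₀.restrict = α.restrict := SmoothHom.ext 𝔤 fun A =>
    ξ.act_injective (z₁ 1) ((hβ₀ (incl m A)).symm.trans (hz₁.equiv 1 h1mem A))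
  rw [hβγ] at hw
  -- The maximum with 0 keeps the second join in the northern half, so the radial piece at the south
  -- pole is not disturbed.
  set c := max (1 - δ / 2) 0 with hc
  have hc1 : c < 1 := max_lt (by linarith) one_pos
  have hc0 : 0 ≤ c := le_max_right _ _
  have hcδ : 1 - δ / 2 ≤ c := le_max_left _ _
  set b := (c + 1) / 2 with hb
  obtain ⟨z, hz, ⟨a', ha', hza⟩, k, hk, hzk⟩ := (hz₁.mono (Icc_subset_Icc_right
    (show b ≤ 1 by linarith))).exists_join (a := c) (d := 1) (by linarith) (by linarith)
      (by linarith) (hw.mono fun t ht => ⟨by linarith [ht.1], by linarith [ht.2]⟩)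
  obtain ⟨β, hβ⟩ := ξ.exists_isotropyHom isMatSmooth_id (z 1)
    (fun A => by rw [hz.proj 1 h1mem]; exact rot_merid_one A)
  have hz1 : z 1 = MulOpposite.op k • z₁ 1 := by
    rw [hzk 1 ⟨by linarith, le_rfl⟩, hw1]
  have hβk : ∀ A, β.hom A = k⁻¹ * β₀.hom A * k := fun A =>
    ξ.isotropy_act_unique (hβ₀ A) (by rw [← hz1]; exact hβ A)
  set a₂ := min (min a' a₁) b₀ with ha₂
  have ha₂1 : -1 < a₂ := lt_min (lt_min (by linarith) ha₁) hb₀1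
  have hzz₀ : ∀ t ∈ Icc (-1) a₂, z t = z₀ t := fun t ht => by
    have h1 : t ≤ min a' a₁ := ht.2.trans (min_le_left _ _)
    rw [hza ⟨ht.1, h1.trans (min_le_left _ _)⟩, hz₁e ⟨ht.1, h1.trans (min_le_right _ _)⟩]
  refine ⟨β, z, SmoothHom.ext 𝔤 fun A => ?_, ⟨⟨hz, fun A => ?_, hβ⟩, ⟨a₂, ha₂1, ?_⟩, ⟨b, by linarith, ?_⟩⟩⟩
  · exact ξ.act_injective (z 1) ((hβ (incl m A)).symm.trans (hz.equiv 1 h1mem A))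
  · rw [hzz₀ _ ⟨le_rfl, ha₂1.le⟩, hz₀a, hα]
  · refine hz₀r.act 1 (by simp) (fun t ht => ⟨by linarith [ht.1], ?_⟩)
      (fun t ht => by simp [hzz₀ t ht])
    have h1 := (ht.2.trans (min_le_right _ _)).trans (min_le_left _ _)
    linarith
  · exact hwr.act k hβk (fun t ht => ⟨by linarith [ht.1], by linarith [ht.2]⟩) hzk

omit [CompleteSpace 𝔤] in
/-- Radial lifts can be changed along a path in `Z_γ`. -/
theorem IsRadialLift.exists_of_path {α β α' β' : SmoothHom 𝔤 G (m + 1)}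
    (h : IsRadialLift ξ γ α β z) {g : ℝ → G}
    (hg : ContMDiffOn 𝓘(ℝ, ℝ) 𝓘(ℝ, 𝔤) ∞ g (Icc (-1) 1)) (hgZ : ∀ t ∈ Icc (-1 : ℝ) 1, g t ∈ Z γ)
    (hα : ∀ A, α'.hom A = g (-1) * α.hom A * (g (-1))⁻¹)
    (hβ : ∀ A, β'.hom A = g 1 * β.hom A * (g 1)⁻¹) :
    ∃ z', IsRadialLift ξ γ α' β' z' := by
  -- `χ` is -1 up to -1/2 and 1 from 1/2 on. The reparametrized path is thus constant near both
  -- poles, where translation preserves radiality, and keeps its endpoints.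
  set χ : ℝ → ℝ := fun t => 2 * Real.smoothTransition (t + 1 / 2) - 1 with hχ
  have hχs : ContDiff ℝ ∞ χ :=
    (contDiff_const.mul (Real.smoothTransition.contDiff.comp (by fun_prop))).sub contDiff_const
  have hχm : ∀ t, χ t ∈ Icc (-1 : ℝ) 1 := fun t => by
    have h0 := Real.smoothTransition.nonneg (t + 1 / 2)
    have h1 := Real.smoothTransition.le_one (t + 1 / 2)
    constructor <;> simp only [hχ] <;> linarith
  have hχ0 : ∀ t ≤ -(1 / 2), χ t = -1 := fun t ht => by
    simp only [hχ]; rw [Real.smoothTransition.zero_of_nonpos (by linarith)]; norm_num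
  have hχ1 : ∀ t ≥ 1 / 2, χ t = 1 := fun t ht => by
    simp only [hχ]; rw [Real.smoothTransition.one_of_one_le (by linarith)]; norm_num
  set z' : ℝ → ξ.E := fun t => MulOpposite.op (g (χ t))⁻¹ • z t with hz'
  have e0 : ∀ t ≤ -(1 / 2), z' t = MulOpposite.op (g (-1))⁻¹ • z t := fun t ht => by
    simp only [hz', hχ0 t ht]
  have e1 : ∀ t ≥ 1 / 2, z' t = MulOpposite.op (g 1)⁻¹ • z t := fun t ht => by
    simp only [hz', hχ1 t ht]
  obtain ⟨a, ha, hra⟩ := h.radial_south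
  obtain ⟨b, hb, hrb⟩ := h.radial_north
  refine ⟨z', ⟨⟨h.lift.act (g := fun t => (g (χ t))⁻¹)
    (hg.comp hχs.contMDiff.contMDiffOn fun t _ => hχm t).inv
    (fun t _ => inv_mem (hgZ _ (hχm t))), fun A => ?_, fun A => ?_⟩,
    ⟨min a (-(1 / 2)), lt_min ha (by norm_num), ?_⟩, ⟨max b (1 / 2), max_lt hb (by norm_num), ?_⟩⟩⟩
  · rw [e0 _ (by norm_num), ξ.smul_act_eq (h.south A), hα, inv_inv]
  · rw [e1 _ (by norm_num), ξ.smul_act_eq (h.north A), hβ, inv_inv]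
  · exact hra.act (g (-1))⁻¹ (fun A => by rw [hα, inv_inv])
      (Icc_subset_Icc_right (min_le_left _ _)) (fun t ht => e0 t (ht.2.trans (min_le_right _ _)))
  · exact hrb.act (g 1)⁻¹ (fun A => by rw [hβ, inv_inv])
      (Icc_subset_Icc_left (le_max_left _ _)) (fun t ht => e1 t ((le_max_right _ _).trans ht.1))

omit [CompleteSpace 𝔤] in
/-- Lifts in isomorphic bundles differ by a path in `Z_γ`. -/
theorem IsLiftWith.exists_path {ξ' : NGBundle 𝔤 G (m + 1)} {α β α' β' : SmoothHom 𝔤 G (m + 1)}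
    {z' : ℝ → ξ'.E} (h : IsLiftWith ξ γ α β z) (h' : IsLiftWith ξ' γ α' β' z') (hξ : ξ.Iso ξ') :
    ∃ g : ℝ → G, ContMDiffOn 𝓘(ℝ, ℝ) 𝓘(ℝ, 𝔤) ∞ g (Icc (-1) 1) ∧
      (∀ t ∈ Icc (-1 : ℝ) 1, g t ∈ Z γ) ∧
      (∀ A, α'.hom A = g (-1) * α.hom A * (g (-1))⁻¹) ∧
      (∀ A, β'.hom A = g 1 * β.hom A * (g 1)⁻¹) := by
  obtain ⟨f, f1, f2, f3⟩ := hξ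
  have hfz : IsLiftOn ξ' γ (fun t => f (z t)) (Icc (-1) 1) :=
    ⟨f.contMDiff.comp_contMDiffOn h.lift.smooth, fun t ht => by rw [f3, h.lift.proj t ht],
      fun t ht A => by rw [← f1, h.lift.equiv t ht, f2]⟩
  have hp : ∀ t ∈ Icc (-1 : ℝ) 1, ξ'.proj (f (z t)) = ξ'.proj (z' t) := fun t ht => by
    rw [hfz.proj t ht, h'.lift.proj t ht]
  have key : ∀ t ∈ Icc (-1 : ℝ) 1, ∀ (A : SO (m + 1)) (x x' : G), A • z t = MulOpposite.op x • z t →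
      A • z' t = MulOpposite.op x' • z' t →
      x' = (ξ'.diff (f (z t)) (z' t))⁻¹ * x * (ξ'.diff (f (z t)) (z' t))⁻¹⁻¹ := by
    intro t ht A x x' hx hx'
    rw [inv_inv]
    refine ξ'.isotropy_act_unique (a := f (z t)) (A := A) (by rw [← f1, hx, f2]) ?_
    rw [ξ'.act_diff (hp t ht), hx']
  refine ⟨fun t => (ξ'.diff (f (z t)) (z' t))⁻¹, (hfz.contMDiffOn_diff h'.lift).inv,
    fun t ht => inv_mem (ξ'.diff_mem_Z (hp t ht) (hfz.equiv t ht) (h'.lift.equiv t ht)),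
    fun A => key _ (by norm_num) A _ _ (h.south A) (h'.south A),
    fun A => key _ (by norm_num) A _ _ (h.north A) (h'.north A)⟩

end Lifts

/-! ### Bundles with equal isotropy representations are isomorphic -/

section Iso

variable {𝔤 : Type v} [NormedAddCommGroup 𝔤] [NormedSpace ℝ 𝔤]
  {G : Type u} [TopologicalSpace G] [ChartedSpace 𝔤 G] [Group G] {n m : ℕ}

theorem continuous_height : Continuous (height (m := m)) :=
  continuous_const.mul (Real.continuous_arcsin.comp (contMDiff_sph_coord _).continuous)

variable {ξ ξ' : NGBundle 𝔤 G (m + 1)} {γ : SmoothHom 𝔤 G m} {α β : SmoothHom 𝔤 G (m + 1)}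
  {z : ℝ → ξ.E} {z' : ℝ → ξ'.E}

theorem IsLiftWith.exists_eq_act (h : IsLiftWith ξ γ α β z) (hm : 1 ≤ m) (y : ξ.E) :
    ∃ (g : G) (A : SO (m + 1)),
      y = MulOpposite.op g • A • z (height (ξ.proj y)) := by
  obtain ⟨A, hA⟩ := exists_rot_merid hm (ξ.proj y)
  obtain ⟨g, hg⟩ := ξ.exists_act (A • z (height (ξ.proj y))) y
    (by rw [ξ.proj_actSO, h.lift.proj _ (height_mem _), hA])
  exact ⟨g, A, hg⟩

/-- The stabilizer of a meridian point is the whole group at the poles and SO(m) elsewhere. In each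
case its action on the lift is prescribed by `α`, `β` or `γ`, hence is the same in both bundles. -/
theorem IsLiftWith.exists_stabilizer (h : IsLiftWith ξ γ α β z) (h' : IsLiftWith ξ' γ α β z')
    {t : ℝ} (ht : t ∈ Icc (-1 : ℝ) 1) {C : SO (m + 1)} (hC : rot C (merid m t) = merid m t) :
    ∃ k : G, C • z t = MulOpposite.op k • z t ∧ C • z' t = MulOpposite.op k • z' t := by
  rcases eq_or_lt_of_le ht.1 with h1 | h1
  · subst h1; exact ⟨_, h.south C, h'.south C⟩
  rcases eq_or_lt_of_le ht.2 with h2 | h2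
  · subst h2; exact ⟨_, h.north C, h'.north C⟩
  obtain ⟨B, rfl⟩ := exists_incl_of_rot_merid_eq ⟨h1, h2⟩ hC
  exact ⟨_, h.lift.equiv t ht B, h'.lift.equiv t ht B⟩

/-- Well-definedness of the isomorphism to be built: the height determines `t`, and two rotations
giving the same point differ by a stabilizer element, which acts through the same `k` on `z` and
`z'`. -/
theorem IsLiftWith.act_eq_act (h : IsLiftWith ξ γ α β z) (h' : IsLiftWith ξ' γ α β z')
    {t t₁ : ℝ} (ht : t ∈ Icc (-1 : ℝ) 1) (ht₁ : t₁ ∈ Icc (-1 : ℝ) 1) {A A₁ : SO (m + 1)}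
    {g g₁ : G} (heq : MulOpposite.op g • A • z t = MulOpposite.op g₁ • A₁ • z t₁) :
    MulOpposite.op g • A • z' t = MulOpposite.op g₁ • A₁ • z' t₁ := by
  have hp := congrArg ξ.proj heq
  rw [ξ.proj_actG, ξ.proj_actG, ξ.proj_actSO, ξ.proj_actSO, h.lift.proj t ht,
    h.lift.proj t₁ ht₁] at hp
  have htt := congrArg height hp
  rw [height_rot, height_rot, height_merid ht, height_merid ht₁] at htt
  subst htt
  obtain ⟨k, hk, hk'⟩ := h.exists_stabilizer h' (C := A₁⁻¹ * A) ht
    (by rw [rot_mul, rot_inv_eq hp.symm])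
  have hz : ∀ {η : NGBundle 𝔤 G (m + 1)} {y : η.E}, (A₁⁻¹ * A) • y = MulOpposite.op k • y →
      MulOpposite.op g • A • y = MulOpposite.op (k * g) • A₁ • y := fun {η y} hy => by
    rw [← η.act_act, ← η.comm A₁ k, ← hy, ← mul_smul, mul_inv_cancel_left]
  rw [hz hk] at heq
  rw [hz hk', ξ.act_injective _ heq]

variable [LieGroup 𝓘(ℝ, 𝔤) ∞ G]

/-- A smooth section `s` writes each point as `s x` times a smooth function with values in `G`; an
equivariant map is then determined by the image of the section. -/
theorem NGBundle.contMDiffAt_of_section {f : ξ.E → ξ'.E}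
    (hf : ∀ (g : G) y, f (MulOpposite.op g • y) = MulOpposite.op g • f y)
    {D : Set (Sph (m + 1))} (hD : IsOpen D) {s : Sph (m + 1) → ξ.E} {s' : Sph (m + 1) → ξ'.E}
    (hs : ContMDiffOn (𝓡 (m + 1)) (totalModel 𝔤 (m + 1)) ∞ s D)
    (hs' : ContMDiffOn (𝓡 (m + 1)) (totalModel 𝔤 (m + 1)) ∞ s' D)
    (hps : ∀ x ∈ D, ξ.proj (s x) = x) (hfs : ∀ x ∈ D, f (s x) = s' x) {y : ξ.E}
    (hy : ξ.proj y ∈ D) :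
    ContMDiffAt (totalModel 𝔤 (m + 1)) (totalModel 𝔤 (m + 1)) ∞ f y := by
  have hDy : ξ.proj ⁻¹' D ∈ 𝓝 y :=
    (hD.preimage ξ.smooth_proj.continuous).mem_nhds hy
  have h1 := hs.comp ξ.smooth_proj.contMDiffOn (s := ξ.proj ⁻¹' D) (fun _ h => h) y hy
  have h1' := hs'.comp ξ.smooth_proj.contMDiffOn (s := ξ.proj ⁻¹' D) (fun _ h => h) y hy
  have h2 := ξ.contMDiffWithinAt_diff (f₁ := s ∘ ξ.proj) (f₂ := id) h1 contMDiffWithinAt_id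
    (fun w hw => hps _ hw) hy
  refine ((ξ'.contMDiffWithinAt_act h1' h2).contMDiffAt hDy).congr_of_eventuallyEq ?_
  filter_upwards [hDy] with w hw
  have h3 := ξ.act_diff (a := s (ξ.proj w)) (b := w) (hps _ hw)
  conv_lhs => rw [← h3, hf, hfs _ hw]
  rfl

/-- Away from the poles the lift is spread to a smooth local section by the rotations `meridRot`,
and `f` carries this section to the corresponding one built from `z'`. -/
theorem IsLiftWith.exists_smooth_map_near (h : IsLiftWith ξ γ α β z) (h' : IsLiftWith ξ' γ α β z')
    {f : ξ.E → ξ'.E}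
    (hf : ∀ t ∈ Icc (-1 : ℝ) 1, ∀ (g : G) (A : SO (m + 1)),
      f (MulOpposite.op g • A • z t) = MulOpposite.op g • A • z' t)
    (hfg : ∀ (g : G) y, f (MulOpposite.op g • y) = MulOpposite.op g • f y)
    {t : ℝ} (ht : t ∈ Ioo (-1 : ℝ) 1) :
    ContMDiffAt (totalModel 𝔤 (m + 1)) (totalModel 𝔤 (m + 1)) ∞ f (z t) := by
  have hsm : ∀ {η : NGBundle 𝔤 G (m + 1)} {w : ℝ → η.E}, IsLiftWith η γ α β w →
      ContMDiffOn (𝓡 (m + 1)) (totalModel 𝔤 (m + 1)) ∞ (fun x => meridRot x • w (height x))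
        (nearMerid m) := fun {η w} hw x hx =>
    η.contMDiffWithinAt_smul (contMDiffOn_meridRot x hx)
      ((hw.lift.smooth.comp contMDiffOn_height fun x _ => height_mem x) x hx)
  refine NGBundle.contMDiffAt_of_section hfg isOpen_nearMerid (hsm h) (hsm h') (fun x hx => ?_)
    (fun x hx => ?_) ?_
  · rw [ξ.proj_actSO, h.lift.proj _ (height_mem x), rot_meridRot hx]
  · simpa using hf (height x) (height_mem x) 1 (meridRot x)
  · rw [h.lift.proj t ⟨ht.1.le, ht.2.le⟩]; exact merid_mem_nearMerid ht

/-- Near a pole the comparison uses the equivariant sections extending the two lifts. They are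
matched by `f` along the meridian, hence everywhere by rotation, because both transform by the same
`δ`. -/
theorem IsLiftWith.exists_smooth_map_radial (h : IsLiftWith ξ γ α β z)
    {δ : SmoothHom 𝔤 G (m + 1)} {f : ξ.E → ξ'.E} (hm : 1 ≤ m)
    (hf : ∀ t ∈ Icc (-1 : ℝ) 1, ∀ (g : G) (A : SO (m + 1)),
      f (MulOpposite.op g • A • z t) = MulOpposite.op g • A • z' t)
    (hfg : ∀ (g : G) y, f (MulOpposite.op g • y) = MulOpposite.op g • f y)
    {S : Set ℝ} (hz : IsRadialOn ξ δ z S) (hz' : IsRadialOn ξ' δ z' S)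
    {U : Set ℝ} (hU : IsOpen U) (hUS : U ∩ Icc (-1) 1 ⊆ S) {t : ℝ} (ht : t ∈ U ∩ Icc (-1) 1) :
    ContMDiffAt (totalModel 𝔤 (m + 1)) (totalModel 𝔤 (m + 1)) ∞ f (z t) := by
  obtain ⟨D, s, hD, hs, hps, hA, hzs⟩ := hz
  obtain ⟨D', s', hD', hs', -, hA', hzs'⟩ := hz'
  -- The condition on the height ensures that the meridian point of the same height lies where both
  -- lifts agree with their sections.
  have hO : IsOpen (D ∩ D' ∩ height ⁻¹' U) := (hD.inter hD').inter (hU.preimage continuous_height)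
  refine NGBundle.contMDiffAt_of_section hfg hO
    (hs.mono fun x hx => hx.1.1) (hs'.mono fun x hx => hx.1.2) (fun x hx => hps x hx.1.1)
    (fun x hx => ?_) ?_
  · obtain ⟨A, hAx⟩ := exists_rot_merid hm x
    have hxS : height x ∈ S := hUS ⟨hx.2, height_mem x⟩
    have e := (hA _ (hzs _ hxS).1 A).2
    have e' := (hA' _ (hzs' _ hxS).1 A).2
    rw [hAx, ← (hzs _ hxS).2] at e
    rw [hAx, ← (hzs' _ hxS).2] at e'
    have e1 : s x = MulOpposite.op (δ.hom A)⁻¹ • A • z (height x) := by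
      rw [e, ξ.act_act]; simp
    rw [e1, hf _ (height_mem x), e', ξ'.act_act]; simp
  · rw [mem_inter_iff, h.lift.proj t ht.2, mem_preimage, height_merid ht.2]
    exact ⟨⟨(hzs t (hUS ht)).1, (hzs' t (hUS ht)).1⟩, ht.1⟩

omit [LieGroup 𝓘(ℝ, 𝔤) ∞ G] in
theorem IsRadialOn.mono {S S' : Set ℝ} (h : IsRadialOn ξ α z S) (hS : S' ⊆ S) :
    IsRadialOn ξ α z S' := by
  obtain ⟨D, s, h1, h2, h3, h4, h5⟩ := h
  exact ⟨D, s, h1, h2, h3, h4, fun t ht => h5 t (hS ht)⟩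

theorem IsRadialLift.exists_smooth_map (h : IsRadialLift ξ γ α β z) (h' : IsRadialLift ξ' γ α β z')
    (hm : 1 ≤ m) : ∃ f : ξ.E → ξ'.E,
      ContMDiff (totalModel 𝔤 (m + 1)) (totalModel 𝔤 (m + 1)) ∞ f ∧
      ∀ t ∈ Icc (-1 : ℝ) 1, ∀ (g : G) (A : SO (m + 1)),
        f (MulOpposite.op g • A • z t) = MulOpposite.op g • A • z' t := by
  choose gg AA hgA using h.exists_eq_act hm
  set f : ξ.E → ξ'.E := fun y => MulOpposite.op (gg y) • AA y • z' (height (ξ.proj y)) with hfdef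
  have hf : ∀ t ∈ Icc (-1 : ℝ) 1, ∀ (g : G) (A : SO (m + 1)),
      f (MulOpposite.op g • A • z t) = MulOpposite.op g • A • z' t := fun t ht g A =>
    h.act_eq_act h'.toIsLiftWith (height_mem _) ht (hgA _).symm
  have hfg : ∀ (g : G) y, f (MulOpposite.op g • y) = MulOpposite.op g • f y := fun g y => by
    conv_lhs => rw [hgA y, ξ.act_act, hf _ (height_mem _), ← ξ'.act_act]
  have hfA : ∀ (A : SO (m + 1)) y, f (A • y) = A • f y := fun A y => by
    conv_lhs => rw [hgA y, ξ.comm, ← mul_smul, hf _ (height_mem _), mul_smul, ← ξ'.comm]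
  have hz : ∀ t ∈ Icc (-1 : ℝ) 1,
      ContMDiffAt (totalModel 𝔤 (m + 1)) (totalModel 𝔤 (m + 1)) ∞ f (z t) := by
    intro t ht
    rcases eq_or_lt_of_le ht.1 with h1 | h1
    · obtain ⟨a, ha, hr⟩ := h.radial_south
      obtain ⟨a', ha', hr'⟩ := h'.radial_south
      refine h.exists_smooth_map_radial hm hf hfg (S := Icc (-1) (min a a'))
        (hr.mono (Icc_subset_Icc_right (min_le_left _ _)))
        (hr'.mono (Icc_subset_Icc_right (min_le_right _ _))) (U := Iio (min a a')) isOpen_Iio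
        (fun s hs => ⟨hs.2.1, le_of_lt hs.1⟩) ⟨?_, ht⟩
      rw [← h1]; exact lt_min ha ha'
    rcases eq_or_lt_of_le ht.2 with h2 | h2
    · obtain ⟨a, ha, hr⟩ := h.radial_north
      obtain ⟨a', ha', hr'⟩ := h'.radial_north
      refine h.exists_smooth_map_radial hm hf hfg (S := Icc (max a a') 1)
        (hr.mono (Icc_subset_Icc_left (le_max_left _ _)))
        (hr'.mono (Icc_subset_Icc_left (le_max_right _ _))) (U := Ioi (max a a')) isOpen_Ioi
        (fun s hs => ⟨le_of_lt hs.1, hs.2.2⟩) ⟨?_, ht⟩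
      rw [h2]; exact max_lt ha ha'
    · exact h.exists_smooth_map_near h'.toIsLiftWith hf hfg ⟨h1, h2⟩
  refine ⟨f, fun y => ?_, hf⟩
  -- Equivariance moves the question from `y` to the point of the lift in its orbit, where
  -- smoothness is already known.
  have hfy : f = fun w => MulOpposite.op (gg y) • AA y • f ((AA y)⁻¹ • MulOpposite.op (gg y)⁻¹ • w) := by
    ext w
    rw [hfA, hfg, smul_inv_smul, ξ'.act_act]; simp
  rw [hfy]
  have hy : (AA y)⁻¹ • MulOpposite.op (gg y)⁻¹ • y = z (height (ξ.proj y)) := by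
    rw [inv_smul_eq_iff, MulOpposite.op_inv, inv_smul_eq_iff]
    exact hgA y
  have h1 := (ξ.contMDiff_smul (AA y)⁻¹).comp (ξ.contMDiff_act (gg y)⁻¹)
  have h2 : ContMDiffAt (totalModel 𝔤 (m + 1)) (totalModel 𝔤 (m + 1)) ∞ f
      ((AA y)⁻¹ • MulOpposite.op (gg y)⁻¹ • y) := by rw [hy]; exact hz _ (height_mem _)
  exact ((ξ'.contMDiff_act (gg y)).comp (ξ'.contMDiff_smul (AA y))).contMDiffAt.comp y
    (ContMDiffAt.comp y (g := f) h2 h1.contMDiffAt)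

/-- Two bundles with radial lifts with the same isotropy representations are isomorphic. -/
theorem IsRadialLift.iso (h : IsRadialLift ξ γ α β z) (h' : IsRadialLift ξ' γ α β z')
    (hm : 1 ≤ m) : ξ.Iso ξ' := by
  obtain ⟨f, hfs, hf⟩ := h.exists_smooth_map h' hm
  obtain ⟨f', hfs', hf'⟩ := h'.exists_smooth_map h hm
  refine ⟨⟨⟨f, f', fun y => ?_, fun y => ?_⟩, hfs, hfs'⟩, fun A y => ?_, fun g y => ?_, fun y => ?_⟩
  · obtain ⟨g, A, hy⟩ := h.exists_eq_act hm y
    rw [hy, hf _ (height_mem _), hf' _ (height_mem _)]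
  · obtain ⟨g, A, hy⟩ := h'.exists_eq_act hm y
    rw [hy, hf' _ (height_mem _), hf _ (height_mem _)]
  · change f (A • y) = A • f y
    obtain ⟨g, B, hy⟩ := h.exists_eq_act hm y
    rw [hy, ξ.comm, ← mul_smul, hf _ (height_mem _), hf _ (height_mem _), mul_smul, ← ξ'.comm]
  · change f (MulOpposite.op g • y) = MulOpposite.op g • f y
    obtain ⟨k, B, hy⟩ := h.exists_eq_act hm y
    rw [hy, ξ.act_act, hf _ (height_mem _), hf _ (height_mem _), ξ'.act_act]
  · change ξ'.proj (f y) = ξ.proj y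
    obtain ⟨g, B, hy⟩ := h.exists_eq_act hm y
    rw [hy, hf _ (height_mem _), ξ.proj_actG, ξ'.proj_actG, ξ.proj_actSO, ξ'.proj_actSO,
      h.lift.proj _ (height_mem _), h'.lift.proj _ (height_mem _)]

end Iso

/-! ### Smoothness of the action of `SO(n)` on the sphere -/

section RotSmooth

variable {n m : ℕ}

open Classical in
/-- The radial retraction of the complement of the origin to the sphere. -/
def normalize (v : EuclideanSpace ℝ (Fin (n + 1))) : Sph n :=
  if h : v = 0 then pole n 1 (by simp) else
    ⟨‖v‖⁻¹ • v, by
      rw [mem_sphere_zero_iff_norm, norm_smul, norm_inv, norm_norm,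
        inv_mul_cancel₀ (norm_ne_zero_iff.2 h)]⟩

theorem normalize_coe (x : Sph n) : normalize x.1 = x := by
  have hx := x.2
  rw [mem_sphere_zero_iff_norm] at hx
  have h0 : x.1 ≠ 0 := fun h => by rw [h, norm_zero] at hx; exact zero_ne_one hx
  rw [normalize, dif_neg h0]
  apply Subtype.ext
  simp [hx]

theorem contMDiffOn_normalize :
    ContMDiffOn 𝓘(ℝ, EuclideanSpace ℝ (Fin (n + 1))) (𝓡 n) ∞ (normalize (n := n)) {v | v ≠ 0} := by
  have := Fact.mk (finrank_euclideanSpace_fin (𝕜 := ℝ) (n := n + 1))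
  -- `ContMDiff.codRestrict_sphere` applies to maps smooth on a whole manifold, so the complement of
  -- the origin is treated as a manifold of its own.
  let U : TopologicalSpace.Opens (EuclideanSpace ℝ (Fin (n + 1))) := ⟨{v | v ≠ 0}, isOpen_ne⟩
  intro v hv
  refine ContMDiffAt.contMDiffWithinAt ?_
  refine (contMDiffAt_subtype_iff (U := U) (x := ⟨v, hv⟩)).1 ?_
  have h1 : ContMDiff 𝓘(ℝ, EuclideanSpace ℝ (Fin (n + 1)))
      𝓘(ℝ, EuclideanSpace ℝ (Fin (n + 1))) ∞ (fun w : U => ‖w.1‖⁻¹ • w.1) := by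
    intro w
    refine (contMDiffAt_subtype_iff (U := U) (f := fun w => ‖w‖⁻¹ • w)).2 ?_
    have hw : w.1 ≠ 0 := w.2
    exact (((contDiffAt_norm ℝ hw).inv (norm_ne_zero_iff.2 hw)).smul contDiffAt_id).contMDiffAt
  have hmem : ∀ w : U, ‖w.1‖⁻¹ • w.1 ∈ Metric.sphere (0 : EuclideanSpace ℝ (Fin (n + 1))) 1 := by
    intro w
    have hw : w.1 ≠ 0 := w.2
    rw [mem_sphere_zero_iff_norm, norm_smul, norm_inv, norm_norm,
      inv_mul_cancel₀ (norm_ne_zero_iff.2 hw)]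
  have h2 := ContMDiff.codRestrict_sphere (n := n) h1 hmem
  refine (h2 ⟨v, hv⟩).congr_of_eventuallyEq (Filter.Eventually.of_forall fun w => ?_)
  have hw : w.1 ≠ 0 := w.2
  change normalize w.1 = _
  rw [normalize, dif_neg hw]
  rfl

/-- The linear extension of the action of `SO(n)` on the sphere to matrices and vectors. -/
def rotVec (M : Mat n) (v : EuclideanSpace ℝ (Fin (n + 1))) : EuclideanSpace ℝ (Fin (n + 1)) :=
  WithLp.toLp 2 (Matrix.mulVec (blockOne (Matrix.of M)) v.ofLp)

theorem contDiff_rotVec : ContDiff ℝ ∞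
    (fun p : Mat n × EuclideanSpace ℝ (Fin (n + 1)) => rotVec p.1 p.2) := by
  rw [contDiff_euclidean]
  intro i
  have h : ∀ j, ContDiff ℝ ∞ (fun M : Mat n => blockOne (Matrix.of M) i j) := fun j =>
    contDiff_pi.1 (contDiff_pi.1 (contDiff_blockOne n) i) j
  simp only [rotVec, Matrix.mulVec, dotProduct]
  exact ContDiff.sum fun j _ => ((h j).comp contDiff_fst).mul
    ((EuclideanSpace.proj (𝕜 := ℝ) j).contDiff.comp contDiff_snd)

/-- A general matrix does not preserve the sphere. The linear extension is therefore followed by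
normalization, which is smooth wherever the image vector is nonzero and changes nothing on SO(n). -/
theorem smoothAlong_rot : SmoothAlong (𝓘(ℝ, Mat n).prod (𝓡 n)) (𝓡 n)
    (fun q : SO n × Sph n => ((SO.mat q.1, q.2) : Mat n × Sph n))
    (fun q : SO n × Sph n => rot q.1 q.2) := by
  have := Fact.mk (finrank_euclideanSpace_fin (𝕜 := ℝ) (n := n + 1))
  have h1 : ContMDiff (𝓘(ℝ, Mat n).prod (𝓡 n)) 𝓘(ℝ, EuclideanSpace ℝ (Fin (n + 1))) ∞
      (fun p : Mat n × Sph n => rotVec p.1 p.2.1) := by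
    refine contDiff_rotVec.contMDiff.comp (f := fun p : Mat n × Sph n => (p.1, p.2.1)) ?_
    exact contMDiff_fst.prodMk_space (contMDiff_coe_sphere.comp contMDiff_snd)
  have he : ∀ (A : SO n) (x : Sph n), rotVec A.mat x.1 = (rot A x).1 := fun A x => rfl
  rintro ⟨A, x⟩
  refine ⟨(fun p : Mat n × Sph n => rotVec p.1 p.2.1) ⁻¹' {v | v ≠ 0},
    isOpen_ne.preimage h1.continuous, ?_, _,
    contMDiffOn_normalize.comp h1.contMDiffOn (fun _ h => h), ?_⟩
  · change rotVec A.mat x.1 ≠ 0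
    rw [he]
    exact ne_zero_of_mem_unit_sphere _
  · rintro ⟨B, y⟩ -
    change normalize (rotVec B.mat y.1) = rot B y
    rw [he, normalize_coe]

theorem contMDiff_rot (A : SO n) : ContMDiff (𝓡 n) (𝓡 n) ∞ (rot A) := by
  intro x
  have h : ContMDiffWithinAt (𝓡 n) (𝓘(ℝ, Mat n).prod (𝓡 n)) ∞
      (fun y : Sph n => ((A.mat, y) : Mat n × Sph n)) univ x :=
    contMDiffWithinAt_const.prodMk contMDiffWithinAt_id
  exact smoothAlong_rot.comp_contMDiffWithinAt (p := fun x => (A, x)) h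

end RotSmooth

/-! ### Smooth fibre bundles from gluing data -/

section Core

open OpenPartialHomeomorph

variable {E₀ : Type*} [NormedAddCommGroup E₀] [NormedSpace ℝ E₀] {H : Type*} [TopologicalSpace H]
  (I : ModelWithCorners ℝ E₀ H) {B F ι : Type*} [TopologicalSpace B] [TopologicalSpace F]
  [ChartedSpace H (B × F)] (Q : FiberBundleCore ι B F)

variable (H) in
/-- The charts of the total space of a fibre bundle obtained from the local trivializations and
the charts of the product of the base and the fibre. -/
@[reducible]
def coreChartedSpace : ChartedSpace H Q.TotalSpace where
  atlas := {f | ∃ i, ∃ c ∈ atlas H (B × F), f = (Q.localTriv i).toOpenPartialHomeomorph ≫ₕ c}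
  chartAt z := (Q.localTrivAt z.1).toOpenPartialHomeomorph ≫ₕ chartAt H (Q.localTrivAt z.1 z)
  mem_chart_source z := by
    rw [trans_source]
    exact ⟨(Q.mem_localTrivAt_source z z.1).2 (Q.mem_localTrivAt_baseSet z.1), mem_chart_source H _⟩
  chart_mem_atlas z := ⟨_, _, chart_mem_atlas H _, rfl⟩

variable [IsManifold I ∞ (B × F)]

/-- A change of charts of the total space is `trivChange` expressed in charts of B × F, and this is
smooth by hypothesis. -/
theorem core_isManifold
    (hQ : ∀ i j, ContMDiffOn I I ∞ (Q.trivChange i j) (Q.trivChange i j).source) :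
    letI := coreChartedSpace H Q; IsManifold I ∞ Q.TotalSpace := by
  let _ := coreChartedSpace H Q
  refine isManifold_of_contDiffOn I ∞ _ ?_
  rintro _ _ ⟨i, c, hc, rfl⟩ ⟨j, c', hc', rfl⟩
  set s : Set (B × F) := {p | p ∈ c.source ∧ p ∈ (Q.trivChange i j).source ∧
    Q.trivChange i j p ∈ c'.source} with hs
  have h1 := (contMDiffOn_iff_of_mem_maximalAtlas' (I := I) (I' := I) (n := ∞)
    (IsManifold.subset_maximalAtlas hc) (IsManifold.subset_maximalAtlas hc') (s := s)
    (fun p hp => hp.1) (fun p hp => hp.2.2)).1 ((hQ i j).mono fun p hp => hp.2.1)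
  -- The inverse trivialization stores a point in the preferred coordinate `Q.indexAt x`; the
  -- cocycle identity eliminates this intermediate index.
  have htr : ∀ p ∈ (Q.trivChange i j).source,
      Q.localTriv j ((Q.localTriv i).toOpenPartialHomeomorph.symm p) = Q.trivChange i j p := by
    rintro ⟨x, v⟩ hx
    rw [Q.mem_trivChange_source] at hx
    refine Prod.ext rfl ?_
    exact Q.coordChange_comp i (Q.indexAt x) j x ⟨⟨hx.1, Q.mem_baseSet_at x⟩, hx.2⟩ v
  have key : ∀ y ∈ I.symm ⁻¹' (((Q.localTriv i).toOpenPartialHomeomorph ≫ₕ c).symm ≫ₕ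
      ((Q.localTriv j).toOpenPartialHomeomorph ≫ₕ c')).source ∩ range I,
      c.symm (I.symm y) ∈ s ∧ y ∈ c.extend I '' s := by
    rintro y ⟨hy, hyI⟩
    simp only [mfld_simps] at hy
    obtain ⟨⟨h2, h3⟩, h4, h5⟩ := hy
    have hsrc : c.symm (I.symm y) ∈ (Q.trivChange i j).source := by
      rw [Q.mem_trivChange_source]; exact ⟨h3, h4⟩
    have hmem : c.symm (I.symm y) ∈ s := by
      refine ⟨c.map_target h2, hsrc, ?_⟩
      rw [← htr _ hsrc]; exact h5
    refine ⟨hmem, c.symm (I.symm y), hmem, ?_⟩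
    rw [c.extend_coe, Function.comp_apply, c.right_inv h2, I.right_inv hyI]
  refine (h1.mono fun y hy => (key y hy).2).congr fun y hy => ?_
  change I (c' (Q.localTriv j ((Q.localTriv i).toOpenPartialHomeomorph.symm (c.symm (I.symm y))))) = _
  rw [htr _ (key y hy).1.2.1]
  rfl

/-- Locally the trivialization is a chart of the total space followed by the inverse of a chart of B
× F, and dually for its inverse. -/
theorem core_contMDiffOn_localTriv
    (hQ : ∀ i j, ContMDiffOn I I ∞ (Q.trivChange i j) (Q.trivChange i j).source) (i : ι) :
    letI := coreChartedSpace H Q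
    ContMDiffOn I I ∞ (Q.localTriv i) (Q.localTriv i).source ∧
      ContMDiffOn I I ∞ (Q.localTriv i).toOpenPartialHomeomorph.symm (Q.localTriv i).target := by
  let _ := coreChartedSpace H Q
  have := core_isManifold I Q hQ
  have hat : ∀ c ∈ atlas H (B × F), (Q.localTriv i).toOpenPartialHomeomorph ≫ₕ c ∈
      IsManifold.maximalAtlas I ∞ Q.TotalSpace := fun c hc =>
    IsManifold.subset_maximalAtlas ⟨i, c, hc, rfl⟩
  constructor
  · intro z hz
    set c := chartAt H (Q.localTriv i z) with hc
    have hcz : Q.localTriv i z ∈ c.source := mem_chart_source H _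
    have h1 := contMDiffOn_of_mem_maximalAtlas (hat c (chart_mem_atlas H _))
    have h2 := contMDiffOn_symm_of_mem_maximalAtlas (I := I) (n := ∞)
      (IsManifold.subset_maximalAtlas (chart_mem_atlas H (Q.localTriv i z)))
    have hsrc : z ∈ ((Q.localTriv i).toOpenPartialHomeomorph ≫ₕ c).source := by
      rw [trans_source]; exact ⟨hz, hcz⟩
    have h3 := (h1 z hsrc).contMDiffAt (OpenPartialHomeomorph.open_source _ |>.mem_nhds hsrc)
    have h4 := (h2 (c (Q.localTriv i z)) (c.map_source hcz)).contMDiffAt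
      (c.open_target.mem_nhds (c.map_source hcz))
    refine ((h4.comp z (f := (Q.localTriv i).toOpenPartialHomeomorph ≫ₕ c)
      h3).congr_of_eventuallyEq ?_).contMDiffWithinAt
    filter_upwards [OpenPartialHomeomorph.open_source _ |>.mem_nhds hsrc] with w hw
    rw [trans_source] at hw
    exact (c.left_inv hw.2).symm
  · intro p hp
    set c := chartAt H p with hc
    have hcz : p ∈ c.source := mem_chart_source H _
    have h1 := contMDiffOn_symm_of_mem_maximalAtlas (hat c (chart_mem_atlas H _))
    have h2 := contMDiffOn_of_mem_maximalAtlas (I := I) (n := ∞)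
      (IsManifold.subset_maximalAtlas (chart_mem_atlas H p))
    have hsrc : c p ∈ ((Q.localTriv i).toOpenPartialHomeomorph ≫ₕ c).target := by
      rw [trans_target]
      refine ⟨c.map_source hcz, ?_⟩
      rw [mem_preimage, c.left_inv hcz]; exact hp
    have h3 := (h1 _ hsrc).contMDiffAt (OpenPartialHomeomorph.open_target _ |>.mem_nhds hsrc)
    have h4 := (h2 p hcz).contMDiffAt (c.open_source.mem_nhds hcz)
    refine ((h3.comp p (f := c) h4).congr_of_eventuallyEq ?_).contMDiffWithinAt
    filter_upwards [c.open_source.mem_nhds hcz] with w hw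
    change _ = (Q.localTriv i).toOpenPartialHomeomorph.symm (c.symm (c w))
    rw [c.left_inv hw]

end Core

/-! ### Bundles from equivariant cocycles -/

/-- An `SO(n)`-equivariant `G`-valued cocycle on an invariant open cover of `S^n`, where `SO(n)`
acts on the trivial bundle over each member of the cover by a homomorphism to `G`. -/
structure Cocycle (𝔤 : Type v) [NormedAddCommGroup 𝔤] [NormedSpace ℝ 𝔤]
    (G : Type u) [TopologicalSpace G] [ChartedSpace 𝔤 G] [Group G] (n : ℕ) where
  /-- the index set of the cover -/
  ι : Type
  /-- the members of the cover -/
  baseSet : ι → Set (Sph n)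
  isOpen_baseSet : ∀ i, IsOpen (baseSet i)
  /-- a choice of a member of the cover around each point -/
  indexAt : Sph n → ι
  mem_baseSet_at : ∀ x, x ∈ baseSet (indexAt x)
  indexAt_rot : ∀ A x, indexAt (rot A x) = indexAt x
  rot_mem : ∀ i A, ∀ x ∈ baseSet i, rot A x ∈ baseSet i
  /-- the transition functions -/
  tr : ι → ι → Sph n → G
  smooth_tr : ∀ i j, ContMDiffOn (𝓡 n) 𝓘(ℝ, 𝔤) ∞ (tr i j) (baseSet i ∩ baseSet j)
  tr_self : ∀ i, ∀ x ∈ baseSet i, tr i i x = 1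
  tr_comp : ∀ i j k, ∀ x ∈ baseSet i ∩ baseSet j ∩ baseSet k, tr j k x * tr i j x = tr i k x
  /-- the homomorphisms by which `SO(n)` acts on the fibres -/
  a : ι → SmoothHom 𝔤 G n
  tr_rot : ∀ i j A, ∀ x ∈ baseSet i ∩ baseSet j,
    tr i j (rot A x) * (a i).hom A = (a j).hom A * tr i j x

namespace Cocycle

variable {𝔤 : Type v} [NormedAddCommGroup 𝔤] [NormedSpace ℝ 𝔤]
  {G : Type u} [TopologicalSpace G] [ChartedSpace 𝔤 G] [Group G] [LieGroup 𝓘(ℝ, 𝔤) ∞ G] {n : ℕ}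
  (c : Cocycle 𝔤 G n)

theorem contMDiffOn_change (i j : c.ι) :
    ContMDiffOn (totalModel 𝔤 n) 𝓘(ℝ, 𝔤) ∞ (fun p : Sph n × G => c.tr i j p.1 * p.2)
      ((c.baseSet i ∩ c.baseSet j) ×ˢ univ) :=
  ((c.smooth_tr i j).comp contMDiffOn_fst fun _ h => h.1).mul contMDiffOn_snd

/-- The gluing data of the underlying fibre bundle. -/
def core : FiberBundleCore c.ι (Sph n) G where
  baseSet := c.baseSet
  isOpen_baseSet := c.isOpen_baseSet
  indexAt := c.indexAt
  mem_baseSet_at := c.mem_baseSet_at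
  coordChange i j x g := c.tr i j x * g
  coordChange_self i x hx g := by rw [c.tr_self i x hx, one_mul]
  continuousOn_coordChange i j := (c.contMDiffOn_change i j).continuousOn
  coordChange_comp i j k x hx g := by rw [← mul_assoc, c.tr_comp i j k x hx]

theorem contMDiffOn_trivChange (i j : c.ι) :
    ContMDiffOn (totalModel 𝔤 n) (totalModel 𝔤 n) ∞ (c.core.trivChange i j)
      (c.core.trivChange i j).source :=
  contMDiffOn_fst.prodMk (c.contMDiffOn_change i j)

/-- The total space. -/
def Total : Type u := c.core.TotalSpace

instance : TopologicalSpace c.Total := c.core.toTopologicalSpace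

instance : ChartedSpace (ModelProd (EuclideanSpace ℝ (Fin n)) 𝔤) c.Total :=
  coreChartedSpace _ c.core

instance : IsManifold (totalModel 𝔤 n) ∞ c.Total :=
  core_isManifold (totalModel 𝔤 n) c.core c.contMDiffOn_trivChange

variable {c} in
/-- The projection. -/
def Total.proj (z : c.Total) : Sph n := Bundle.TotalSpace.proj z

variable {c} in
/-- The coordinate in the fibre with respect to the preferred trivialization. -/
def Total.coord (z : c.Total) : G := Bundle.TotalSpace.snd z

/-- The point with given projection and coordinate. -/
def point (x : Sph n) (g : G) : c.Total := ⟨x, g⟩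

/-- The local trivializations. -/
def triv (i : c.ι) : Bundle.Trivialization G (Total.proj (c := c)) := c.core.localTriv i

theorem triv_apply (i : c.ι) (z : c.Total) :
    c.triv i z = (z.proj, c.tr (c.indexAt z.proj) i z.proj * z.coord) := rfl

theorem contMDiffOn_triv (i : c.ι) :
    ContMDiffOn (totalModel 𝔤 n) (totalModel 𝔤 n) ∞ (c.triv i) (c.triv i).source :=
  (core_contMDiffOn_localTriv (totalModel 𝔤 n) c.core c.contMDiffOn_trivChange i).1

theorem contMDiffOn_triv_symm (i : c.ι) :
    ContMDiffOn (totalModel 𝔤 n) (totalModel 𝔤 n) ∞ (c.triv i).toOpenPartialHomeomorph.symm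
      (c.triv i).target :=
  (core_contMDiffOn_localTriv (totalModel 𝔤 n) c.core c.contMDiffOn_trivChange i).2

theorem contMDiff_proj : ContMDiff (totalModel 𝔤 n) (𝓡 n) ∞ (Total.proj (c := c)) := fun z =>
  (contMDiffAt_fst (I := 𝓡 n) (J := 𝓘(ℝ, 𝔤))).comp z
    ((c.contMDiffOn_triv (c.indexAt z.proj)).contMDiffAt
      ((c.triv _).open_source.mem_nhds (c.mem_baseSet_at z.proj)))

instance : MulAction Gᵐᵒᵖ c.Total where
  smul h z := c.point z.proj (z.coord * h.unop)
  one_smul z := by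
    change c.point z.proj (z.coord * 1) = z
    rw [mul_one]; rfl
  mul_smul h k z := by
    change c.point z.proj (z.coord * (k.unop * h.unop)) = c.point z.proj (z.coord * k.unop * h.unop)
    rw [mul_assoc]

instance : MulAction (SO n) c.Total where
  smul A z := c.point (rot A z.proj) ((c.a (c.indexAt z.proj)).hom A * z.coord)
  one_smul z := by
    change c.point (rot 1 z.proj) ((c.a (c.indexAt z.proj)).hom 1 * z.coord) = z
    rw [rot_one, map_one, one_mul]; rfl
  mul_smul A B z := by
    change c.point (rot (A * B) z.proj) ((c.a (c.indexAt z.proj)).hom (A * B) * z.coord) =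
      c.point (rot A (rot B z.proj)) ((c.a (c.indexAt (rot B z.proj))).hom A *
        ((c.a (c.indexAt z.proj)).hom B * z.coord))
    rw [rot_mul, map_mul, c.indexAt_rot, mul_assoc]

theorem act_def (g : G) (z : c.Total) :
    MulOpposite.op g • z = c.point z.proj (z.coord * g) := rfl

theorem smul_def (A : SO n) (z : c.Total) :
    A • z = c.point (rot A z.proj) ((c.a (c.indexAt z.proj)).hom A * z.coord) := rfl

theorem triv_act (i : c.ι) (g : G) (z : c.Total) :
    c.triv i (MulOpposite.op g • z) = (z.proj, (c.triv i z).2 * g) := by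
  rw [triv_apply, triv_apply, mul_assoc]; rfl

/-- The action is defined in the preferred coordinate; the compatibility `tr_rot` makes it left
multiplication through `c.a i` in every trivialization. -/
theorem triv_smul {i : c.ι} (A : SO n) {z : c.Total} (hz : z.proj ∈ c.baseSet i) :
    c.triv i (A • z) = (rot A z.proj, (c.a i).hom A * (c.triv i z).2) := by
  have h := c.tr_rot (c.indexAt z.proj) i A z.proj ⟨c.mem_baseSet_at _, hz⟩
  change (rot A z.proj, c.tr (c.indexAt (rot A z.proj)) i (rot A z.proj) *
    ((c.a (c.indexAt z.proj)).hom A * z.coord)) = _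
  rw [c.indexAt_rot, ← mul_assoc, h, mul_assoc]
  rfl

theorem eq_triv_symm {i : c.ι} {z : c.Total} {p : Sph n × G} (hz : z.proj ∈ c.baseSet i)
    (h : c.triv i z = p) : (c.triv i).toOpenPartialHomeomorph.symm p = z := by
  rw [← h]
  exact (c.triv i).toOpenPartialHomeomorph.left_inv hz

theorem contMDiff_actG : ContMDiff ((totalModel 𝔤 n).prod 𝓘(ℝ, 𝔤)) (totalModel 𝔤 n) ∞
    (fun q : c.Total × G => MulOpposite.op q.2 • q.1) := by
  rintro ⟨z, g⟩
  set i := c.indexAt z.proj with hi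
  have hz : z.proj ∈ c.baseSet i := c.mem_baseSet_at _
  have hpr : ContMDiff ((totalModel 𝔤 n).prod 𝓘(ℝ, 𝔤)) (𝓡 n) ∞
      (fun q : c.Total × G => q.1.proj) := c.contMDiff_proj.comp contMDiff_fst
  have h1 : ContMDiffAt ((totalModel 𝔤 n).prod 𝓘(ℝ, 𝔤)) (totalModel 𝔤 n) ∞
      (fun q : c.Total × G => c.triv i q.1) (z, g) :=
    ((c.contMDiffOn_triv i).contMDiffAt ((c.triv i).open_source.mem_nhds hz)).comp (z, g)
      contMDiffAt_fst
  have h2 : ContMDiffAt ((totalModel 𝔤 n).prod 𝓘(ℝ, 𝔤)) (totalModel 𝔤 n) ∞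
      (fun q : c.Total × G => ((q.1.proj, (c.triv i q.1).2 * q.2) : Sph n × G)) (z, g) :=
    (hpr (z, g)).prodMk ((contMDiffAt_snd.comp (z, g) h1).mul contMDiffAt_snd)
  have ht : ((z.proj, (c.triv i z).2 * g) : Sph n × G) ∈ (c.triv i).target :=
    (c.triv i).mem_target.2 hz
  have h3 := ((c.contMDiffOn_triv_symm i).contMDiffAt ((c.triv i).open_target.mem_nhds ht)).comp
    (z, g) h2
  refine h3.congr_of_eventuallyEq ?_
  filter_upwards [hpr.continuous.continuousAt.eventually ((c.isOpen_baseSet i).mem_nhds hz)] with q hq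
  exact (c.eq_triv_symm (z := MulOpposite.op q.2 • q.1) hq (c.triv_act i q.2 q.1)).symm

/-- In a trivialization the action is (x, g) ↦ (A x, a(A) g). The local extensions of the rotation
and of the homomorphism to matrices give the extension of the action. -/
theorem smoothAlong_actSO : SmoothAlong (𝓘(ℝ, Mat n).prod (totalModel 𝔤 n)) (totalModel 𝔤 n)
    (fun q : SO n × c.Total => ((SO.mat q.1, q.2) : Mat n × c.Total))
    (fun q : SO n × c.Total => q.1 • q.2) := by
  rintro ⟨A, z⟩
  set i := c.indexAt z.proj with hi
  have hz : z.proj ∈ c.baseSet i := c.mem_baseSet_at _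
  obtain ⟨U₁, hU₁, hA₁, F₁, hF₁, h₁⟩ := (c.a i).smooth A
  obtain ⟨U₂, hU₂, hA₂, F₂, hF₂, h₂⟩ := smoothAlong_rot (A, z.proj)
  have hpr : ContMDiff (𝓘(ℝ, Mat n).prod (totalModel 𝔤 n)) (𝓘(ℝ, Mat n).prod (𝓡 n)) ∞
      (fun q : Mat n × c.Total => ((q.1, q.2.proj) : Mat n × Sph n)) :=
    contMDiff_fst.prodMk (c.contMDiff_proj.comp contMDiff_snd)
  set V : Set (Mat n × c.Total) :=
    (fun q : Mat n × c.Total => ((q.1, q.2.proj) : Mat n × Sph n)) ⁻¹' ((U₁ ×ˢ c.baseSet i) ∩ U₂)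
    with hV
  have hVo : IsOpen V := ((hU₁.prod (c.isOpen_baseSet i)).inter hU₂).preimage hpr.continuous
  have hf2 : ContMDiffOn (𝓘(ℝ, Mat n).prod (totalModel 𝔤 n)) (𝓡 n) ∞
      (fun q : Mat n × c.Total => F₂ (q.1, q.2.proj)) V :=
    hF₂.comp hpr.contMDiffOn fun q hq => hq.2
  have hf1 : ContMDiffOn (𝓘(ℝ, Mat n).prod (totalModel 𝔤 n)) 𝓘(ℝ, 𝔤) ∞
      (fun q : Mat n × c.Total => F₁ q.1) V :=
    hF₁.comp contMDiffOn_fst fun q hq => hq.1.1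
  have hf3 : ContMDiffOn (𝓘(ℝ, Mat n).prod (totalModel 𝔤 n)) (totalModel 𝔤 n) ∞
      (fun q : Mat n × c.Total => c.triv i q.2) V :=
    (c.contMDiffOn_triv i).comp contMDiffOn_snd fun q hq => hq.1.2
  have hf4 : ContMDiffOn (𝓘(ℝ, Mat n).prod (totalModel 𝔤 n)) (totalModel 𝔤 n) ∞
      (fun q : Mat n × c.Total => ((F₂ (q.1, q.2.proj), F₁ q.1 * (c.triv i q.2).2) : Sph n × G)) V :=
    hf2.prodMk (hf1.mul (contMDiff_snd.comp_contMDiffOn hf3))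
  refine ⟨V ∩ (fun q : Mat n × c.Total => F₂ (q.1, q.2.proj)) ⁻¹' c.baseSet i,
    hf2.continuousOn.isOpen_inter_preimage hVo (c.isOpen_baseSet i), ⟨⟨⟨hA₁, hz⟩, hA₂⟩, ?_⟩, _,
    (c.contMDiffOn_triv_symm i).comp (hf4.mono inter_subset_left)
      (fun q hq => (c.triv i).mem_target.2 hq.2), ?_⟩
  · change F₂ (A.mat, z.proj) ∈ c.baseSet i
    rw [h₂ (A, z.proj) hA₂]
    exact c.rot_mem i A _ hz
  · rintro ⟨B, w⟩ ⟨⟨⟨hB, hw⟩, hBw⟩, -⟩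
    refine c.eq_triv_symm (c.rot_mem i B _ hw) ?_
    rw [c.triv_smul B hw]
    change _ = (F₂ (B.mat, w.proj), F₁ B.mat * (c.triv i w).2)
    rw [h₂ (B, w.proj) hBw, h₁ B hB]

/-- The `(n, G)`-bundle of an equivariant cocycle. -/
def bundle : NGBundle 𝔤 G n where
  E := c.Total
  proj := Total.proj
  smooth_proj := c.contMDiff_proj
  smooth_actG := c.contMDiff_actG
  free_actG z g h := mul_eq_left.1 (congrArg Total.coord h)
  proj_actG _ _ := rfl
  locally_trivial x := ⟨c.triv (c.indexAt x), c.mem_baseSet_at x, c.contMDiffOn_triv _,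
    c.contMDiffOn_triv_symm _, fun z _ g => by rw [triv_act]⟩
  smooth_actSO := c.smoothAlong_actSO
  comm A g z := by
    rw [act_def, smul_def, act_def, smul_def]
    exact congrArg _ (mul_assoc _ _ _).symm
  proj_actSO _ _ := rfl

end Cocycle

/-! ### The bundle with given isotropy representations -/

section Clutching

variable {𝔤 : Type v} [NormedAddCommGroup 𝔤] [NormedSpace ℝ 𝔤]
  {G : Type u} [TopologicalSpace G] [ChartedSpace 𝔤 G] [Group G] {m : ℕ} (hm : 1 ≤ m)

include hm

/-- A rotation which moves the point of the meridian of the height of `x` to `x`. -/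
def someRot (x : Sph (m + 1)) : SO (m + 1) := (exists_rot_merid hm x).choose

theorem rot_someRot (x : Sph (m + 1)) : rot (someRot hm x) (merid m (height x)) = x :=
  (exists_rot_merid hm x).choose_spec

/-- The transition function between the trivial bundles with actions given by `α` and `β`. -/
def transition (α β : SmoothHom 𝔤 G (m + 1)) (x : Sph (m + 1)) : G :=
  β.hom (someRot hm x) * (α.hom (someRot hm x))⁻¹

theorem transition_self (α : SmoothHom 𝔤 G (m + 1)) (x : Sph (m + 1)) :
    transition hm α α x = 1 := mul_inv_cancel _

theorem transition_comp (α β γ : SmoothHom 𝔤 G (m + 1)) (x : Sph (m + 1)) :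
    transition hm β γ x * transition hm α β x = transition hm α γ x := by
  simp only [transition]; group

variable {α β : SmoothHom 𝔤 G (m + 1)} (h : α.restrict = β.restrict)

include h

omit hm in
theorem hom_incl_eq (C : SO m) : α.hom (incl m C) = β.hom (incl m C) :=
  DFunLike.congr_fun (congrArg SmoothHom.hom h) C

/-- Off the poles a rotation taking the meridian point to `x` is unique up to SO(m), where `α` and
`β` agree; the transition function is therefore independent of the choice made in `someRot`. -/
theorem transition_rot (A : SO (m + 1)) {x : Sph (m + 1)} (hx : height x ∈ Ioo (-1 : ℝ) 1) :
    transition hm α β (rot A x) = β.hom A * transition hm α β x * (α.hom A)⁻¹ := by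
  obtain ⟨C, hC⟩ := exists_incl_of_rot_merid_eq (A := (A * someRot hm x)⁻¹ * someRot hm (rot A x)) hx
    (by
      have h1 := rot_someRot hm (rot A x)
      rw [height_rot] at h1
      rw [rot_mul, h1]
      exact rot_inv_eq (by rw [rot_mul, rot_someRot]))
  have h2 : someRot hm (rot A x) = A * someRot hm x * incl m C := by rw [← hC]; group
  simp only [transition, h2, map_mul, hom_incl_eq h C]
  group

theorem transition_merid {t : ℝ} (ht : t ∈ Ioo (-1 : ℝ) 1) :
    transition hm α β (merid m t) = 1 := by
  obtain ⟨C, hC⟩ := exists_incl_of_rot_merid_eq (A := someRot hm (merid m t)) ht (by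
    have h1 := rot_someRot hm (merid m t)
    rwa [height_merid (Ioo_subset_Icc_self ht)] at h1)
  rw [transition, hC, hom_incl_eq h C, mul_inv_cancel]

/-- By equivariance `x` may be rotated onto the meridian. Nearby, the arbitrary choice of rotation
can be replaced by the smooth choice `meridRot` without changing the transition function. -/
theorem contMDiffAt_transition [LieGroup 𝓘(ℝ, 𝔤) ∞ G] {x : Sph (m + 1)}
    (hx : height x ∈ Ioo (-1 : ℝ) 1) :
    ContMDiffAt (𝓡 (m + 1)) 𝓘(ℝ, 𝔤) ∞ (transition hm α β) x := by
  set A := someRot hm x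
  have hA : rot A⁻¹ x = merid m (height x) := rot_inv_eq (rot_someRot hm x)
  have hr := contMDiff_rot (n := m + 1) A⁻¹
  have hnear : rot A⁻¹ x ∈ nearMerid m := by rw [hA]; exact merid_mem_nearMerid hx
  have h1 : ContMDiffAt (𝓡 (m + 1)) 𝓘(ℝ, Mat (m + 1)) ∞
      (fun y => (meridRot (rot A⁻¹ y)).mat) x :=
    (contMDiffOn_meridRot.contMDiffAt (isOpen_nearMerid.mem_nhds hnear)).comp x (hr x)
  have h2 : ∀ δ : SmoothHom 𝔤 G (m + 1), ContMDiffAt (𝓡 (m + 1)) 𝓘(ℝ, 𝔤) ∞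
      (fun y => δ.hom (meridRot (rot A⁻¹ y))) x := fun δ =>
    δ.smooth.comp_contMDiffWithinAt h1
  refine (((contMDiffAt_const (c := β.hom A)).mul ((h2 β).mul (h2 α).inv)).mul
    (contMDiffAt_const (c := (α.hom A)⁻¹))).congr_of_eventuallyEq ?_
  filter_upwards [hr.continuous.continuousAt.eventually (isOpen_nearMerid.mem_nhds hnear)] with y hy
  have hy1 := height_mem_Ioo hy
  have h3 := transition_rot hm h A (x := rot A⁻¹ y) hy1
  rw [← rot_mul, mul_inv_cancel, rot_one] at h3
  rw [h3]
  congr 2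
  have h4 := transition_rot hm h (meridRot (rot A⁻¹ y)) (x := merid m (height (rot A⁻¹ y)))
    (by rwa [height_merid (Ioo_subset_Icc_self hy1)])
  rw [rot_meridRot hy, transition_merid hm h hy1, mul_one] at h4
  exact h4

variable [LieGroup 𝓘(ℝ, 𝔤) ∞ G]

/-- The cocycle with respect to the complements of the two poles. -/
def clutchingCocycle : Cocycle 𝔤 G (m + 1) where
  ι := Bool
  -- The index `false` stands for the complement of the north pole, with action through `α`; `true`
  -- for the complement of the south pole, with action through `β`.
  baseSet i := {x | bif i then -1 < height x else height x < 1}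
  isOpen_baseSet i := by
    cases i
    · exact isOpen_lt continuous_height continuous_const
    · exact isOpen_lt continuous_const continuous_height
  -- The value is `true` at the north pole only. It depends on the height alone, so it is invariant
  -- under rotations.
  indexAt x := !decide (height x < 1)
  mem_baseSet_at x := by
    by_cases hx : height x < 1
    · simp [hx]
    · simp only [hx, decide_false, Bool.not_false, cond_true, mem_ofPred_eq]
      linarith
  indexAt_rot A x := by rw [height_rot]
  rot_mem i A x hx := by rwa [mem_ofPred_eq, height_rot]
  tr i j := transition hm (bif i then β else α) (bif j then β else α)
  smooth_tr i j x hx := by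
    refine ContMDiffAt.contMDiffWithinAt ?_
    cases i <;> cases j
    · exact contMDiffAt_const.congr_of_eventuallyEq
        (Filter.Eventually.of_forall (transition_self hm α))
    · exact contMDiffAt_transition hm h ⟨hx.2, hx.1⟩
    · exact contMDiffAt_transition hm h.symm ⟨hx.1, hx.2⟩
    · exact contMDiffAt_const.congr_of_eventuallyEq
        (Filter.Eventually.of_forall (transition_self hm β))
  tr_self i x _ := transition_self hm _ x
  tr_comp i j k x _ := transition_comp hm _ _ _ x
  a i := bif i then β else α
  tr_rot i j A x hx := by
    cases i <;> cases j
    · simp [transition_self]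
    · simp [transition_rot hm h A (x := x) ⟨hx.2, hx.1⟩]
    · simp [transition_rot hm h.symm A (x := x) ⟨hx.1, hx.2⟩]
    · simp [transition_self]

/-- The lift has constant coordinate 1. Since the transition function is 1 along the open meridian,
it has coordinate 1 in both trivializations and is smooth across the jump of the preferred index. -/
theorem exists_bundle_isLiftWith :
    ∃ (ξ : NGBundle 𝔤 G (m + 1)) (z : ℝ → ξ.E), IsLiftWith ξ α.restrict α β z := by
  set c := clutchingCocycle hm h with hc
  have hact : ∀ (A : SO (m + 1)) (t : ℝ), rot A (merid m t) = merid m t →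
      A • c.point (merid m t) 1 =
        MulOpposite.op ((c.a (c.indexAt (merid m t))).hom A) • c.point (merid m t) 1 := by
    intro A t hA
    rw [Cocycle.smul_def, Cocycle.act_def]
    change c.point (rot A (merid m t)) ((c.a (c.indexAt (merid m t))).hom A * 1) =
      c.point (merid m t) (1 * (c.a (c.indexAt (merid m t))).hom A)
    rw [hA, mul_one, one_mul]
  have htr : ∀ i, ∀ t ∈ Icc (-1 : ℝ) 1, merid m t ∈ c.baseSet i →
      c.tr (c.indexAt (merid m t)) i (merid m t) = 1 := by
    intro i t ht hi
    by_cases hj : c.indexAt (merid m t) = i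
    · rw [hj, c.tr_self i _ hi]
    · have hat := c.mem_baseSet_at (merid m t)
      generalize c.indexAt (merid m t) = j at hj hat
      change bif i then -1 < height (merid m t) else height (merid m t) < 1 at hi
      change bif j then -1 < height (merid m t) else height (merid m t) < 1 at hat
      rw [height_merid ht] at hi hat
      cases i <;> cases j
      · exact absurd rfl hj
      · exact transition_merid hm h.symm ⟨hat, hi⟩
      · exact transition_merid hm h ⟨hi, hat⟩
      · exact absurd rfl hj
  have ha : ∀ s : ℝ, s ∈ Icc (-1 : ℝ) 1 → c.a (c.indexAt (merid m s)) = if s < 1 then α else β := by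
    intro s hs
    change (bif !decide (height (merid m s) < 1) then β else α) = _
    rw [height_merid hs]
    by_cases h1 : s < 1 <;> simp [h1]
  refine ⟨c.bundle, fun t => c.point (merid m t) 1, ⟨?_, fun t _ => rfl, fun t ht A => ?_⟩,
    fun A => ?_, fun A => ?_⟩
  · intro t ht
    set i := c.indexAt (merid m t)
    have hi : merid m t ∈ c.baseSet i := c.mem_baseSet_at _
    have h1 : ContMDiffWithinAt 𝓘(ℝ, ℝ) (totalModel 𝔤 (m + 1)) ∞
        (fun s => ((merid m s, 1) : Sph (m + 1) × G)) (Icc (-1) 1) t :=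
      (contMDiff_merid t).contMDiffWithinAt.prodMk contMDiffWithinAt_const
    have h2 : ((merid m t, 1) : Sph (m + 1) × G) ∈ (c.triv i).target := (c.triv i).mem_target.2 hi
    have h3 := ((c.contMDiffOn_triv_symm i).contMDiffAt
      ((c.triv i).open_target.mem_nhds h2)).comp_contMDiffWithinAt t h1
    have key : ∀ s ∈ Icc (-1 : ℝ) 1, merid m s ∈ c.baseSet i → c.point (merid m s) 1 =
        (c.triv i).toOpenPartialHomeomorph.symm (merid m s, 1) := fun s hs hsi => by
      refine (c.eq_triv_symm (z := c.point (merid m s) 1) hsi ?_).symm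
      rw [c.triv_apply]
      change (merid m s, c.tr (c.indexAt (merid m s)) i (merid m s) * 1) = _
      rw [htr i s hs hsi, mul_one]
    refine h3.congr_of_eventuallyEq ?_ (key t ht hi)
    filter_upwards [self_mem_nhdsWithin, mem_nhdsWithin_of_mem_nhds
      ((c.isOpen_baseSet i).preimage contMDiff_merid.continuous |>.mem_nhds hi)] with s hs hsi
    exact key s hs hsi
  · refine (hact (incl m A) t (rot_incl_merid A t)).trans ?_
    rw [ha t ht]
    split_ifs
    · rfl
    · rw [← hom_incl_eq h A]; rfl
  · refine (hact A (-1) (rot_merid_neg_one A)).trans ?_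
    rw [ha _ (by norm_num), if_pos (by norm_num)]
    rfl
  · refine (hact A 1 (rot_merid_one A)).trans ?_
    rw [ha _ (by norm_num), if_neg (by norm_num)]
    rfl

end Clutching

/-! ### The classification -/

section Classification

variable {𝔤 : Type v} [NormedAddCommGroup 𝔤] [NormedSpace ℝ 𝔤]
  {G : Type u} [TopologicalSpace G] [ChartedSpace 𝔤 G] [Group G] [LieGroup 𝓘(ℝ, 𝔤) ∞ G] {m n : ℕ}

theorem NGBundle.isotropy_eq (ξ : NGBundle 𝔤 G n) (a : ξ.E)
    (ha : ∀ A : SO n, rot A (ξ.proj a) = ξ.proj a) {α : SmoothHom 𝔤 G n}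
    (h : ∀ A : SO n, A • a = MulOpposite.op (α.hom A) • a) : ξ.isotropy a ha = α :=
  SmoothHom.ext _ fun A => ξ.act_injective a (by rw [← ξ.isotropy_spec, h])

theorem isotropyClass_eq (ξ : NGBundle 𝔤 G n) {s : ℝ} (hs : |s| = 1) {a : ξ.E}
    (ha : ξ.proj a = pole n s hs) {α : SmoothHom 𝔤 G n}
    (h : ∀ A : SO n, A • a = MulOpposite.op (α.hom A) • a) :
    isotropyClass 𝔤 G n s hs (Quotient.mk _ ξ) = Quotient.mk (conjSetoid 𝔤 G n) α := by
  have hr : ∀ A : SO n, rot A (ξ.proj a) = ξ.proj a := fun A => by rw [ha, rot_pole]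
  rw [← ξ.isotropy_eq a hr h]
  exact Quotient.sound (NGBundle.isotropy_conj ((isoSetoid 𝔤 G n).refl ξ) _ _
    (by rw [(ξ.exists_fibre _).choose_spec, ha]) _ _)

theorem IsLiftWith.J_eq {ξ : NGBundle 𝔤 G (m + 1)} {γ : SmoothHom 𝔤 G m}
    {α β : SmoothHom 𝔤 G (m + 1)} {z : ℝ → ξ.E} (h : IsLiftWith ξ γ α β z) :
    J 𝔤 G (m + 1) (Quotient.mk _ ξ) = (Quotient.mk _ α, Quotient.mk _ β) :=
  Prod.ext
    (isotropyClass_eq ξ _ ((h.lift.proj (-1) (by norm_num)).trans (merid_neg_one _)) h.south)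
    (isotropyClass_eq ξ _ ((h.lift.proj 1 (by norm_num)).trans (merid_one _)) h.north)

/-- The hypothesis gives `γ` only up to conjugation by some `g`; translating the chosen point over
the south pole by `g⁻¹` turns this into an equality. -/
theorem exists_isotropy_extending {ξ : NGBundle 𝔤 G (m + 1)} {γ : SmoothHom 𝔤 G m}
    (h : Jbar 𝔤 G m (Quotient.mk _ ξ) = Quotient.mk (conjSetoid 𝔤 G m) γ) :
    ∃ (a : ξ.E) (α : SmoothHom 𝔤 G (m + 1)), ξ.proj a = merid m (-1) ∧ α.restrict = γ ∧
      ∀ A : SO (m + 1), A • a = MulOpposite.op (α.hom A) • a := by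
  have hs : |(-1 : ℝ)| = 1 := by simp
  obtain ⟨a₀, h₀⟩ := ξ.exists_fibre (pole (m + 1) (-1) hs)
  have hr₀ : ∀ A : SO (m + 1), rot A (ξ.proj a₀) = ξ.proj a₀ := fun A => by rw [h₀, rot_pole]
  have h1 := isotropyClass_eq ξ hs h₀ (ξ.isotropy_spec a₀ hr₀)
  change Res 𝔤 G m (isotropyClass 𝔤 G (m + 1) (-1) hs (Quotient.mk _ ξ)) = _ at h
  rw [h1] at h
  obtain ⟨g, hg⟩ : (conjSetoid 𝔤 G m).r (ξ.isotropy a₀ hr₀).restrict γ := Quotient.exact h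
  have hpr : ξ.proj (MulOpposite.op g⁻¹ • a₀) = pole (m + 1) (-1) hs := by rw [ξ.proj_actG, h₀]
  have hr : ∀ A : SO (m + 1), rot A (ξ.proj (MulOpposite.op g⁻¹ • a₀)) =
      ξ.proj (MulOpposite.op g⁻¹ • a₀) := fun A => by rw [hpr, rot_pole]
  refine ⟨MulOpposite.op g⁻¹ • a₀, ξ.isotropy _ hr, hpr.trans (merid_neg_one hs).symm,
    SmoothHom.ext _ fun A => ?_, ξ.isotropy_spec _ hr⟩
  rw [hg]
  refine ξ.act_injective (MulOpposite.op g⁻¹ • a₀) ?_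
  refine (ξ.isotropy_spec _ hr (incl m A)).symm.trans ?_
  rw [ξ.comm, ξ.isotropy_spec a₀ hr₀, ξ.act_act, ξ.act_act]
  change MulOpposite.op ((ξ.isotropy a₀ hr₀).hom (incl m A) * g⁻¹) • a₀ =
    MulOpposite.op (g⁻¹ * (g * (ξ.isotropy a₀ hr₀).hom (incl m A) * g⁻¹)) • a₀
  congr 2
  group

/-- The relation between an isomorphism class of bundles and a class of pairs that some lift of the
meridian to a representing bundle has a representing pair as isotropy representations at its ends. -/
def HasLiftClass {γ : SmoothHom 𝔤 G m} (x : BundleClasses 𝔤 G (m + 1)) (q : Rγ γ) : Prop :=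
  ∃ (ξ : NGBundle 𝔤 G (m + 1)) (p : ExtPairs γ) (z : ℝ → ξ.E),
    x = Quotient.mk _ ξ ∧ q = Quotient.mk (pathSetoid γ) p ∧ IsLiftWith ξ γ p.1.1 p.1.2 z

variable {γ : SmoothHom 𝔤 G m} {x x' : BundleClasses 𝔤 G (m + 1)} {q q' : Rγ γ}

theorem HasLiftClass.j_eq (h : HasLiftClass x q) : (j γ q).1 = J 𝔤 G (m + 1) x := by
  obtain ⟨ξ, p, z, rfl, rfl, hz⟩ := h
  exact hz.J_eq.symm

theorem HasLiftClass.Jbar_eq (h : HasLiftClass x q) :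
    Jbar 𝔤 G m x = Quotient.mk (conjSetoid 𝔤 G m) γ := by
  obtain ⟨ξ, p, z, rfl, rfl, hz⟩ := h
  change Res 𝔤 G m (J 𝔤 G (m + 1) _).1 = _
  rw [hz.J_eq]
  exact congrArg (Quotient.mk (conjSetoid 𝔤 G m)) p.2.1

theorem exists_hasLiftClass (hm : 1 ≤ m) (q : Rγ γ) :
    ∃ x : BundleClasses 𝔤 G (m + 1), HasLiftClass x q := by
  obtain ⟨p, rfl⟩ := Quotient.exists_rep q
  obtain ⟨ξ, z, hz⟩ := exists_bundle_isLiftWith hm (p.2.1.trans p.2.2.symm)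
  rw [p.2.1] at hz
  exact ⟨_, ξ, p, z, rfl, rfl, hz⟩

/-- Any two lifts are related by a path in `Z γ`; no radiality is needed for this half. -/
theorem HasLiftClass.unique (h : HasLiftClass x q) (h' : HasLiftClass x q') : q = q' := by
  obtain ⟨ξ, p, z, rfl, rfl, hz⟩ := h
  obtain ⟨ξ', p', z', hx, rfl, hz'⟩ := h'
  exact Quotient.sound (hz.exists_path hz' (Quotient.exact hx))

variable [CompleteSpace 𝔤]

theorem exists_isRadialLift {ξ : NGBundle 𝔤 G (m + 1)}
    (h : Jbar 𝔤 G m (Quotient.mk _ ξ) = Quotient.mk (conjSetoid 𝔤 G m) γ) :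
    ∃ (p : ExtPairs γ) (z : ℝ → ξ.E), IsRadialLift ξ γ p.1.1 p.1.2 z := by
  obtain ⟨a, α, ha, rfl, hα⟩ := exists_isotropy_extending h
  obtain ⟨β, z, hβ, hz⟩ := ξ.exists_radialLift α ha hα
  exact ⟨⟨(α, β), rfl, hβ⟩, z, hz⟩

theorem exists_liftClass (h : Jbar 𝔤 G m x = Quotient.mk (conjSetoid 𝔤 G m) γ) :
    ∃ q : Rγ γ, HasLiftClass x q := by
  obtain ⟨ξ, rfl⟩ := Quotient.exists_rep x
  obtain ⟨p, z, hz⟩ := exists_isRadialLift h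
  exact ⟨_, ξ, p, z, rfl, rfl, hz.toIsLiftWith⟩

/-- The given lifts need not be radial, so radial ones are chosen in both bundles; by
`HasLiftClass.unique` their pairs still represent `q`. One radial lift is then moved along the path
relating the pairs, after which both have the same isotropy and the bundles are isomorphic. -/
theorem HasLiftClass.class_unique (hm : 1 ≤ m) (h : HasLiftClass x q) (h' : HasLiftClass x' q) :
    x = x' := by
  obtain ⟨ξ, rfl⟩ := Quotient.exists_rep x
  obtain ⟨ξ', rfl⟩ := Quotient.exists_rep x'
  obtain ⟨p, z, hz⟩ := exists_isRadialLift h.Jbar_eq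
  obtain ⟨p', z', hz'⟩ := exists_isRadialLift h'.Jbar_eq
  have e : (Quotient.mk (pathSetoid γ) p : Rγ γ) = Quotient.mk (pathSetoid γ) p' :=
    (HasLiftClass.unique ⟨ξ, p, z, rfl, rfl, hz.toIsLiftWith⟩ h).trans
      (HasLiftClass.unique h' ⟨ξ', p', z', rfl, rfl, hz'.toIsLiftWith⟩)
  obtain ⟨g, hg, hgZ, hα, hβ⟩ : (pathSetoid γ).r p p' := Quotient.exact e
  obtain ⟨w, hw⟩ := hz.exists_of_path hg hgZ hα hβ
  exact Quotient.sound (hw.iso hz' hm)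

end Classification

end EquivBundle

end

/-- The relation `HasLiftClass` is the graph of the bijection: each class over `γ` is related to
exactly one element of Rγ, and conversely. Finite dimension supplies the completeness needed for the
Haar averages and the implicit function theorem. -/
theorem mainTheorem10
    {𝔤 : Type*} [NormedAddCommGroup 𝔤] [NormedSpace ℝ 𝔤] [FiniteDimensional ℝ 𝔤]
    {G : Type*} [TopologicalSpace G] [ChartedSpace 𝔤 G] [Group G] [LieGroup 𝓘(ℝ, 𝔤) ∞ G]
    (m : ℕ) (hm : 1 ≤ m) (γ : EquivBundle.SmoothHom 𝔤 G m) :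
    ∃ Jtilde : {x : EquivBundle.BundleClasses 𝔤 G (m + 1) //
          EquivBundle.Jbar 𝔤 G m x = Quotient.mk (EquivBundle.conjSetoid 𝔤 G m) γ} →
        EquivBundle.Rγ γ,
      Function.Bijective Jtilde ∧
      ∀ x, (EquivBundle.j γ (Jtilde x)).1 = EquivBundle.J 𝔤 G (m + 1) x.1 := by
  have : CompleteSpace 𝔤 := FiniteDimensional.complete ℝ 𝔤
  choose f hf using fun x : {x : EquivBundle.BundleClasses 𝔤 G (m + 1) //
    EquivBundle.Jbar 𝔤 G m x = Quotient.mk (EquivBundle.conjSetoid 𝔤 G m) γ} =>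
      EquivBundle.exists_liftClass x.2
  refine ⟨f, ⟨fun x x' h => ?_, fun q => ?_⟩, fun x => (hf x).j_eq⟩
  · have h' := hf x'
    rw [← h] at h'
    exact Subtype.ext ((hf x).class_unique hm h')
  · obtain ⟨x, hx⟩ := EquivBundle.exists_hasLiftClass hm q
    exact ⟨⟨x, hx.Jbar_eq⟩, (hf _).unique hx⟩
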